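/- **Theorem 4.1.** Let $(M^{2m+1},J,\theta)$, $m\ge 2$, be a compact strictly pseudoconvex CR manifold: $M$ is a smooth manifold without boundary, $\theta$ is a nowhere vanishing $1$-form, $J$ is a complex structure on $H=\ker\theta$ such that $T_{1,0}M=\{X-\sqrt{-1}JX: X\in H\}$ is closed under brackets, and $d\theta(X,JX)>0$ for $0\ne X\in H$. Let $T$ be the Reeb field ($\theta(T)=1$, $T\lrcorner d\theta=0$), extend $J$ by $JT=0$, let $g_\theta(X,Y)=d\theta(\pi_HX,J\pi_HY)+\theta(X)\theta(Y)$ be the Webster metric, where $\pi_H:TM\to H$ is the projection along $T$, and let $\nabla$ be the Tanaka-Webster connection, i.e. the unique linear connection on $TM$ preserving $H$ with $\nabla g_\theta=0$, $\nabla J=0$, $\nabla\theta=0$, whose torsion satisfies $T_\nabla(X,Y)=-g_\theta(X,JY)T$ and $T_\nabla(T,JX)=-JT_\nabla(T,X)$ for $X,Y\in H$. Let $\{T_\alpha\}_{\alpha=1}^m$, $T_\alpha=\frac1{\sqrt2}(e_\alpha-\sqrt{-1}Je_\alpha)$, be the unitary frame of $T_{1,0}M$ of a local $g_\theta$-orthonormal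 frame $\{T,e_\alpha,Je_\alpha\}$, put $T_{\bar\alpha}=\overline{T_\alpha}$, let $\{\theta,\theta^\alpha,\theta^{\bar\alpha}\}$ be the coframe dual to $\{T,T_\alpha,T_{\bar\alpha}\}$, and put $A_{\alpha\beta}=g_\theta(T_\nabla(T,T_\alpha),T_\beta)$. Let $(N^n,h)$ be a Riemannian manifold with Levi-Civita connection $\nabla^h$ and local orthonormal frame $\{E_j\}$, and suppose that $N$ has nonpositive Hermitian curvature: with $R_{ijkl}=h(R(E_k,E_l)E_j,E_i)$, where $R(X,Y)=[\nabla^h_X,\nabla^h_Y]-\nabla^h_{[X,Y]}$, one has $R_{ijkl}u^iv^j\overline{u^k}\,\overline{v^l}\le 0$ for all complex tangent vectors $u,v$. Let $\phi:M\to N$ be a smooth map. Put $\beta(X,Y)=\nabla^h_Y(d\phi(X))-d\phi(\nabla_YX)$ and $(\nabla_Z\beta)(X,Y)=\nabla^h_Z(\beta(X,Y))-\beta(\nabla_ZX,Y)-\beta(X,\nabla_ZY)$, and for $A,B,C\in\{\alpha,\bar\alpha\}$ let $\phi^j_A=h(d\phi(T_A),E_j)$ and $\phi^j_{ABC}=h((\nabla_{T_C}\beta)(T_A,T_B),E_j)$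 (extended complex-multilinearly). Define $$P\phi=(P^j_\beta\phi)\,\theta^\beta\otimes E_j,\qquad P^j_\beta\phi=\sum_{\alpha=1}^m\left(\phi^j_{\bar\alpha\alpha\beta}+\sqrt{-1}\,m\,A_{\beta\alpha}\phi^j_{\bar\alpha}\right),\qquad d_b\phi=(\phi^j_\beta\theta^\beta+\phi^j_{\bar\beta}\theta^{\bar\beta})\otimes E_j .$$ Then $\langle P\phi+\overline{P\phi},d_b\phi\rangle=\sum_{j,\beta}\left(P^j_\beta\phi\;\phi^j_{\bar\beta}+\overline{P^j_\beta\phi}\;\phi^j_\beta\right)$ is integrable with respect to the volume form $\Psi=\theta\wedge(d\theta)^m$ ($M$ being oriented by $\Psi$), and $$-\int_M\langle P\phi+\overline{P\phi},d_b\phi\rangle\,\Psi\ \ge\ 0 .$$ -/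

import Mathlib

open scoped Manifold ContDiff Topology
open MeasureTheory

noncomputable section

namespace CRGeom

/-- The model space `ℝᵏ` of a `k`-dimensional manifold. -/
abbrev Mod (k : ℕ) : Type := EuclideanSpace ℝ (Fin k)

/-! ### Tensor calculus on a manifold

Tensors are evaluated at vectors `u, v, …` at a point `x` by extending these vectors to the vector
fields `FiberBundle.extend`, which are smooth near `x`. -/

section Calculus

variable {k : ℕ} {M : Type*} [TopologicalSpace M] [ChartedSpace (Mod k) M]
  [IsManifold (𝓡 k) ∞ M]

/-- The vector field, smooth near `x`, that extends a tangent vector at `x`. -/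
abbrev extv {x : M} (u : TangentSpace (𝓡 k) x) : (y : M) → TangentSpace (𝓡 k) y :=
  FiberBundle.extend (Mod k) u

/-- The vector field `X` is differentiable at `x`. -/
abbrev DiffFieldAt (X : (y : M) → TangentSpace (𝓡 k) y) (x : M) : Prop :=
  MDifferentiableAt (𝓡 k) ((𝓡 k).prod 𝓘(ℝ, Mod k))
    (fun y => (⟨y, X y⟩ : Bundle.TotalSpace (Mod k) (TangentSpace (𝓡 k) (M := M)))) x

/-- The vector field `X` is smooth on `U`. -/
abbrev SmoothFieldOn (X : (y : M) → TangentSpace (𝓡 k) y) (U : Set M) : Prop :=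
  ContMDiffOn (𝓡 k) ((𝓡 k).prod 𝓘(ℝ, Mod k)) ∞
    (fun y => (⟨y, X y⟩ : Bundle.TotalSpace (Mod k) (TangentSpace (𝓡 k) (M := M)))) U

/-- `dθ(u, v) = X(θ(Y)) - Y(θ(X)) - θ([X, Y])` at `x`, where `X`, `Y` extend `u`, `v`. -/
def extDerivOne (θ : (x : M) → TangentSpace (𝓡 k) x →L[ℝ] ℝ) (x : M)
    (u v : TangentSpace (𝓡 k) x) : ℝ :=
  mvfderiv (𝓡 k) (fun y => θ y (extv v y)) x u - mvfderiv (𝓡 k) (fun y => θ y (extv u y)) x v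
    - θ x (VectorField.mlieBracket (𝓡 k) (extv u) (extv v) x)

/-- The type of operators `D` that take a vector field `X` to `v ↦ D_v X`; a linear connection
is such an operator with `IsCovariantDerivativeOn (Mod k) D`. Note the order: `D X x v` is
`(D_v X)(x)`. -/
abbrev Conn (k : ℕ) (M : Type*) [TopologicalSpace M] [ChartedSpace (Mod k) M] :=
  ((x : M) → TangentSpace (𝓡 k) x) →
    ((x : M) → TangentSpace (𝓡 k) x →L[ℝ] TangentSpace (𝓡 k) x)

/-- The torsion `D_u Y - D_v X - [X, Y]` at `x`, where `X`, `Y` extend `u`, `v`. -/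
def torsion (D : Conn k M) (x : M) (u v : TangentSpace (𝓡 k) x) : TangentSpace (𝓡 k) x :=
  D (extv v) x u - D (extv u) x v - VectorField.mlieBracket (𝓡 k) (extv u) (extv v) x

/-- The curvature `R(u, v)w = D_X D_Y Z - D_Y D_X Z - D_[X, Y] Z` at `x`, where `X`, `Y`, `Z`
extend `u`, `v`, `w`. -/
def curvature (D : Conn k M) (x : M) (u v w : TangentSpace (𝓡 k) x) : TangentSpace (𝓡 k) x :=
  D (fun y => D (extv w) y (extv v y)) x u - D (fun y => D (extv w) y (extv u y)) x v
    - D (extv w) x (VectorField.mlieBracket (𝓡 k) (extv u) (extv v) x)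

/-- `D g = 0`, that is `v(g(X, Y)) = g(D_v X, Y) + g(X, D_v Y)`. -/
def IsMetricConn (D : Conn k M)
    (g : (x : M) → TangentSpace (𝓡 k) x → TangentSpace (𝓡 k) x → ℝ) : Prop :=
  ∀ (x : M) (X Y : (y : M) → TangentSpace (𝓡 k) y),
    DiffFieldAt X x → DiffFieldAt Y x → ∀ v : TangentSpace (𝓡 k) x,
      mvfderiv (𝓡 k) (fun y => g y (X y) (Y y)) x v = g x (D X x v) (Y x) + g x (X x) (D Y x v)

end Calculus

/-! ### Complex-multilinear extensions

A vector `a + √-1 b` of a complexified space `V ⊗ ℂ` is represented by the pair `(a, b) : V × V`.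
`cx₁`, …, `cx₄` are the complex-multilinear extensions of real-multilinear forms. -/

section Complexify

variable {V : Type*}

def cx₁ (L : V → ℝ) (z : V × V) : ℂ := (L z.1 : ℂ) + Complex.I * (L z.2 : ℂ)

def cx₂ (B : V → V → ℝ) (z w : V × V) : ℂ := cx₁ (B z.1) w + Complex.I * cx₁ (B z.2) w

def cx₃ (C : V → V → V → ℝ) (z w t : V × V) : ℂ :=
  cx₂ (C z.1) w t + Complex.I * cx₂ (C z.2) w t

def cx₄ (Q : V → V → V → V → ℝ) (z w t s : V × V) : ℂ :=
  cx₃ (Q z.1) w t s + Complex.I * cx₃ (Q z.2) w t s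

/-- Complex conjugation on `V ⊗ ℂ`. -/
def cbar [Neg V] (z : V × V) : V × V := (z.1, -z.2)

end Complexify

/-! ### The target: Riemannian manifolds -/

section Riemannian

variable {n : ℕ} {N : Type*} [TopologicalSpace N] [ChartedSpace (Mod n) N]
  [IsManifold (𝓡 n) ∞ N]

/-- Smooth Riemannian metrics on `N`. -/
abbrev Metric (n : ℕ) (N : Type*) [TopologicalSpace N] [ChartedSpace (Mod n) N]
    [IsManifold (𝓡 n) ∞ N] :=
  Bundle.ContMDiffRiemannianMetric (𝓡 n) ∞ (Mod n) (fun y : N => TangentSpace (𝓡 n) y)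

/-- `D` is a torsion-free linear connection with `D h = 0`. -/
structure IsLeviCivita (h : Metric n N) (D : Conn n N) : Prop where
  cov : IsCovariantDerivativeOn (Mod n) D
  metric : IsMetricConn D (fun y u v => h.inner y u v)
  torsion_free : ∀ (y : N) (u v : TangentSpace (𝓡 n) y), torsion D y u v = 0

open Classical in
/-- The Levi-Civita connection `∇ʰ`: the unique torsion-free metric connection. (The default
value `0` is never taken, by the fundamental theorem of Riemannian geometry.) -/
def leviCivita (h : Metric n N) : Conn n N :=
  if H : ∃ D : Conn n N, IsLeviCivita h D then H.choose else 0

/-- `R_{ijkl} aⁱ bʲ cᵏ dˡ = h(R(c, d)b, a)`, so that `R_{ijij}` is a sectional curvature. -/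
def riemann (h : Metric n N) (y : N) (a b c d : TangentSpace (𝓡 n) y) : ℝ :=
  h.inner y (curvature (leviCivita h) y c d b) a

/-- Nonpositive Hermitian curvature: `R_{ijkl} uⁱ vʲ ūᵏ v̄ˡ ≤ 0` for all complex tangent vectors
`u`, `v` (this number is real). -/
def NonposHermitianCurvature (h : Metric n N) : Prop :=
  ∀ (y : N) (u v : TangentSpace (𝓡 n) y × TangentSpace (𝓡 n) y),
    (cx₄ (riemann h y) u v (cbar u) (cbar v)).re ≤ 0

end Riemannian

/-! ### The source: strictly pseudoconvex CR manifolds -/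

/-- A strictly pseudoconvex CR manifold `(M, J, θ)` of dimension `2m + 1`. The CR structure is
given by `H = ker θ` and the complex structure `J` on `H`; equivalently by
`T_{1,0}M = {X - √-1 J X : X ∈ H}`. The endomorphism `J` is extended from `H` to `TM` by
`J T = 0`, where the Reeb field `T` spans the radical of `dθ`. -/
structure StrictlyPseudoconvexCR (m : ℕ) (M : Type*) [TopologicalSpace M]
    [ChartedSpace (Mod (2 * m + 1)) M] [IsManifold (𝓡 (2 * m + 1)) ∞ M] where
  /-- the pseudo-Hermitian structure `θ` -/
  θ : (x : M) → TangentSpace (𝓡 (2 * m + 1)) x →L[ℝ] ℝ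
  /-- the complex structure `J` of `H`, extended by `J T = 0` -/
  J : (x : M) → TangentSpace (𝓡 (2 * m + 1)) x →L[ℝ] TangentSpace (𝓡 (2 * m + 1)) x
  smooth_θ : ContMDiff (𝓡 (2 * m + 1))
    ((𝓡 (2 * m + 1)).prod 𝓘(ℝ, Mod (2 * m + 1) →L[ℝ] ℝ)) ∞
    (fun x => Bundle.TotalSpace.mk' (Mod (2 * m + 1) →L[ℝ] ℝ)
      (E := fun x : M => TangentSpace (𝓡 (2 * m + 1)) x →L[ℝ] Bundle.Trivial M ℝ x) x (θ x))
  smooth_J : ContMDiff (𝓡 (2 * m + 1))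
    ((𝓡 (2 * m + 1)).prod 𝓘(ℝ, Mod (2 * m + 1) →L[ℝ] Mod (2 * m + 1))) ∞
    (fun x => Bundle.TotalSpace.mk' (Mod (2 * m + 1) →L[ℝ] Mod (2 * m + 1))
      (E := fun x : M =>
        TangentSpace (𝓡 (2 * m + 1)) x →L[ℝ] TangentSpace (𝓡 (2 * m + 1)) x) x (J x))
  θ_ne_zero : ∀ x, θ x ≠ 0
  J_mem : ∀ x v, θ x v = 0 → θ x (J x v) = 0
  J_sq : ∀ x v, θ x v = 0 → J x (J x v) = -v
  J_radical : ∀ x v, (∀ w, extDerivOne θ x v w = 0) → J x v = 0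
  /-- Integrability `[Γ(T_{1,0}M), Γ(T_{1,0}M)] ⊆ Γ(T_{1,0}M)`: over every open set, the bracket
  `([X, Y] - [JX, JY]) - √-1 ([JX, Y] + [X, JY])` of the sections `X - √-1 JX` and `Y - √-1 JY`
  of `T_{1,0}M` is again of the form `Z - √-1 JZ` with `Z` in `H`. -/
  integrable : ∀ (U : Set M), IsOpen U →
    ∀ X Y : (x : M) → TangentSpace (𝓡 (2 * m + 1)) x,
      SmoothFieldOn X U → SmoothFieldOn Y U →
      (∀ x ∈ U, θ x (X x) = 0) → (∀ x ∈ U, θ x (Y x) = 0) →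
      ∀ x ∈ U,
        letI JX : (x : M) → TangentSpace (𝓡 (2 * m + 1)) x := fun y => J y (X y)
        letI JY : (x : M) → TangentSpace (𝓡 (2 * m + 1)) x := fun y => J y (Y y)
        letI Z := VectorField.mlieBracket (𝓡 (2 * m + 1)) X Y x
          - VectorField.mlieBracket (𝓡 (2 * m + 1)) JX JY x
        θ x Z = 0 ∧
        VectorField.mlieBracket (𝓡 (2 * m + 1)) JX Y x
          + VectorField.mlieBracket (𝓡 (2 * m + 1)) X JY x = J x Z
  /-- The Levi form `G_θ(X, Y) = dθ(X, JY)` is positive definite on `H`. -/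
  pos : ∀ x v, θ x v = 0 → v ≠ 0 → 0 < extDerivOne θ x v (J x v)

namespace StrictlyPseudoconvexCR

variable {m : ℕ} {M : Type*} [TopologicalSpace M] [ChartedSpace (Mod (2 * m + 1)) M]
  [IsManifold (𝓡 (2 * m + 1)) ∞ M] (S : StrictlyPseudoconvexCR m M)

/-- `dθ`. -/
def dθ (x : M) (u v : TangentSpace (𝓡 (2 * m + 1)) x) : ℝ := extDerivOne S.θ x u v

/-- The Reeb field: the unique vector field `T` with `θ(T) = 1` and `T ⌟ dθ = 0`. -/
def reeb (x : M) : TangentSpace (𝓡 (2 * m + 1)) x :=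
  Classical.epsilon fun v => S.θ x v = 1 ∧ ∀ w, S.dθ x v w = 0

/-- The projection `π_H : TM → H` along `T`. -/
def projH (x : M) (u : TangentSpace (𝓡 (2 * m + 1)) x) : TangentSpace (𝓡 (2 * m + 1)) x :=
  u - S.θ x u • S.reeb x

/-- The Webster metric `g_θ(u, v) = G_θ(π_H u, π_H v) + θ(u) θ(v)`. -/
def webster (x : M) (u v : TangentSpace (𝓡 (2 * m + 1)) x) : ℝ :=
  S.dθ x (S.projH x u) (S.J x (S.projH x v)) + S.θ x u * S.θ x v

/-- The defining properties of the Tanaka-Webster connection: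
(1) `H` is parallel; (2) `∇g_θ = 0`, `∇J = 0`, `∇θ = 0`;
(3) `T_∇(X, Y) = -Ω(X, Y) T` and `T_∇(T, JX) = -J T_∇(T, X)` for `X, Y ∈ H`, where
`Ω(X, Y) = g_θ(X, JY)`. -/
structure IsTanakaWebster (D : Conn (2 * m + 1) M) : Prop where
  cov : IsCovariantDerivativeOn (Mod (2 * m + 1)) D
  parallel_H : ∀ (x : M) (X : (y : M) → TangentSpace (𝓡 (2 * m + 1)) y),
    DiffFieldAt X x → (∀ y, S.θ y (X y) = 0) → ∀ v, S.θ x (D X x v) = 0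
  metric : IsMetricConn D S.webster
  parallel_J : ∀ (x : M) (X : (y : M) → TangentSpace (𝓡 (2 * m + 1)) y),
    DiffFieldAt X x → ∀ v, D (fun y => S.J y (X y)) x v = S.J x (D X x v)
  parallel_θ : ∀ (x : M) (X : (y : M) → TangentSpace (𝓡 (2 * m + 1)) y),
    DiffFieldAt X x → ∀ v,
      mvfderiv (𝓡 (2 * m + 1)) (fun y => S.θ y (X y)) x v = S.θ x (D X x v)
  torsion_H : ∀ (x : M) (u v : TangentSpace (𝓡 (2 * m + 1)) x), S.θ x u = 0 → S.θ x v = 0 →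
    torsion D x u v = -(S.webster x u (S.J x v)) • S.reeb x
  torsion_T : ∀ (x : M) (u : TangentSpace (𝓡 (2 * m + 1)) x), S.θ x u = 0 →
    torsion D x (S.reeb x) (S.J x u) = -(S.J x (torsion D x (S.reeb x) u))

open Classical in
/-- The Tanaka-Webster connection `∇`: the unique connection with the properties above. (The
default value `0` is never taken, by the theorem of Tanaka and Webster.) -/
def tanakaWebster : Conn (2 * m + 1) M :=
  if H : ∃ D : Conn (2 * m + 1) M, S.IsTanakaWebster D then H.choose else 0

/-- The pseudo-Hermitian torsion `A(u, v) = g_θ(τ u, v)` with `τ u = T_∇(T, u)`. -/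
def pseudoTorsion (x : M) (u v : TangentSpace (𝓡 (2 * m + 1)) x) : ℝ :=
  S.webster x (torsion S.tanakaWebster x (S.reeb x) u) v

/-- The value on `v₀, …, v_{2m}` of the form `Ψ = θ ∧ (dθ)ᵐ`, with the normalization
`(α ∧ β)(X, Y) = α(X)β(Y) - α(Y)β(X)` for 1-forms. -/
def volForm (x : M) (v : Fin (2 * m + 1) → TangentSpace (𝓡 (2 * m + 1)) x) : ℝ :=
  (1 / 2 ^ m : ℝ) * ∑ σ : Equiv.Perm (Fin (2 * m + 1)), ((Equiv.Perm.sign σ : ℤ) : ℝ) *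
    (S.θ x (v (σ 0)) *
      ∏ i : Fin m, S.dθ x (v (σ ⟨2 * i + 1, by omega⟩)) (v (σ ⟨2 * i + 2, by omega⟩)))

/-- The measure of `Ψ` on the domain of the chart at `p`: the image under the inverse chart of
`|Ψ(∂₁, …, ∂_{2m+1})| dx`. -/
def chartMeasure [MeasurableSpace M] (p : M) : Measure M :=
  Measure.map (extChartAt (𝓡 (2 * m + 1)) p).symm
    ((volume.restrict (extChartAt (𝓡 (2 * m + 1)) p).target).withDensity fun z =>
      ENNReal.ofReal |S.volForm ((extChartAt (𝓡 (2 * m + 1)) p).symm z) fun i =>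
        mfderiv 𝓘(ℝ, Mod (2 * m + 1)) (𝓡 (2 * m + 1)) (extChartAt (𝓡 (2 * m + 1)) p).symm z
          (EuclideanSpace.single i 1 : Mod (2 * m + 1))|)

/-- The measure of the volume form `Ψ = θ ∧ (dθ)ᵐ`, for the orientation in which `Ψ` is positive.
The chart measures agree on the overlaps of the charts, so that they glue to a measure on `M`,
which is the least measure above all of them. -/
def volMeasure [MeasurableSpace M] : Measure M := ⨆ p : M, S.chartMeasure p

/-- `{T, e₁, …, e_m, J e₁, …, J e_m}` is a `g_θ`-orthonormal frame at `x`. -/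
structure IsCRFrame (x : M) (e : Fin m → TangentSpace (𝓡 (2 * m + 1)) x) : Prop where
  horizontal : ∀ α, S.θ x (e α) = 0
  inner_e : ∀ α β, S.webster x (e α) (e β) = if α = β then 1 else 0
  inner_Je : ∀ α β, S.webster x (S.J x (e α)) (S.J x (e β)) = if α = β then 1 else 0
  inner_e_Je : ∀ α β, S.webster x (e α) (S.J x (e β)) = 0

/-- `T_α = (e_α - √-1 J e_α) / √2`, a complex tangent vector. -/
def holo {x : M} (e : Fin m → TangentSpace (𝓡 (2 * m + 1)) x) (α : Fin m) :
    TangentSpace (𝓡 (2 * m + 1)) x × TangentSpace (𝓡 (2 * m + 1)) x :=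
  ((√2)⁻¹ • e α, -((√2)⁻¹ • S.J x (e α)))

/-- `T_ᾱ = (e_α + √-1 J e_α) / √2`. -/
def anti {x : M} (e : Fin m → TangentSpace (𝓡 (2 * m + 1)) x) (α : Fin m) :
    TangentSpace (𝓡 (2 * m + 1)) x × TangentSpace (𝓡 (2 * m + 1)) x :=
  cbar (S.holo e α)

end StrictlyPseudoconvexCR

/-! ### Maps from CR manifolds to Riemannian manifolds -/

section Maps

/-- The pull-back of a connection `D` on `N` by `φ : M → N`, acting on sections `s` of `φ⁻¹TN`.
In the local frame `E_j` of `TN` at `φ(x)` and with `s = sʲ E_j ∘ φ` it is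
`v ↦ dsʲ(v) E_j + sʲ(x) D_{dφ(v)} E_j`. -/
def pullbackConn {k n : ℕ} {M N : Type*} [TopologicalSpace M] [ChartedSpace (Mod k) M]
    [TopologicalSpace N] [ChartedSpace (Mod n) N] [IsManifold (𝓡 n) ∞ N]
    (D : Conn n N) (φ : M → N) (s : (x : M) → TangentSpace (𝓡 n) (φ x)) (x : M)
    (v : TangentSpace (𝓡 k) x) : TangentSpace (𝓡 n) (φ x) :=
  letI t := trivializationAt (Mod n) (fun y : N => TangentSpace (𝓡 n) y) (φ x)
  t.symm (φ x) (mvfderiv (𝓡 k) (fun y => (t ⟨φ y, s y⟩).2) x v)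
    + D (extv (s x)) (φ x) (mfderiv (𝓡 k) (𝓡 n) φ x v)

variable {m n : ℕ} {M : Type*} [TopologicalSpace M] [ChartedSpace (Mod (2 * m + 1)) M]
  [IsManifold (𝓡 (2 * m + 1)) ∞ M] (S : StrictlyPseudoconvexCR m M)
  {N : Type*} [TopologicalSpace N] [ChartedSpace (Mod n) N] [IsManifold (𝓡 n) ∞ N]
  (h : Metric n N) (φ : M → N)

/-- The second fundamental form `β(X, Y) = ∇ʰ_Y (dφ(X)) - dφ(∇_Y X)` with respect to the
Tanaka-Webster connection `∇` and the Levi-Civita connection `∇ʰ`. -/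
def secondForm (x : M) (u v : TangentSpace (𝓡 (2 * m + 1)) x) : TangentSpace (𝓡 n) (φ x) :=
  pullbackConn (leviCivita h) φ (fun y => mfderiv (𝓡 (2 * m + 1)) (𝓡 n) φ y (extv u y)) x v
    - mfderiv (𝓡 (2 * m + 1)) (𝓡 n) φ x (S.tanakaWebster (extv u) x v)

/-- The covariant derivative
`(∇_Z β)(X, Y) = ∇ʰ_Z (β(X, Y)) - β(∇_Z X, Y) - β(X, ∇_Z Y)`, at `(X, Y, Z) = (u, v, w)`. -/
def thirdForm (x : M) (u v w : TangentSpace (𝓡 (2 * m + 1)) x) : TangentSpace (𝓡 n) (φ x) :=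
  pullbackConn (leviCivita h) φ (fun y => secondForm S h φ y (extv u y) (extv v y)) x w
    - secondForm S h φ x (S.tanakaWebster (extv u) x w) v
    - secondForm S h φ x u (S.tanakaWebster (extv v) x w)

/-- `E₁, …, E_n` is an `h`-orthonormal frame at `y`. -/
def IsOrthonormalFrame {y : N} (E : Fin n → TangentSpace (𝓡 n) y) : Prop :=
  ∀ i j, h.inner y (E i) (E j) = if i = j then 1 else 0

variable {x : M} (e : Fin m → TangentSpace (𝓡 (2 * m + 1)) x)
  (E : Fin n → TangentSpace (𝓡 n) (φ x))

/-- The components `φʲ_A = h(dφ(T_A), E_j)`, for a complex tangent vector `T_A`. -/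
def comp₁ (j : Fin n) :
    TangentSpace (𝓡 (2 * m + 1)) x × TangentSpace (𝓡 (2 * m + 1)) x → ℂ :=
  cx₁ fun u => h.inner (φ x) (mfderiv (𝓡 (2 * m + 1)) (𝓡 n) φ x u) (E j)

/-- The components `φʲ_{ABC} = h((∇_{T_C} β)(T_A, T_B), E_j)`; the last index is that of the last
differentiation. -/
def comp₃ (j : Fin n) :
    TangentSpace (𝓡 (2 * m + 1)) x × TangentSpace (𝓡 (2 * m + 1)) x →
    TangentSpace (𝓡 (2 * m + 1)) x × TangentSpace (𝓡 (2 * m + 1)) x →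
    TangentSpace (𝓡 (2 * m + 1)) x × TangentSpace (𝓡 (2 * m + 1)) x → ℂ :=
  cx₃ fun u v w => h.inner (φ x) (thirdForm S h φ x u v w) (E j)

/-- The components `Pʲ_β φ = ∑_α (φʲ_{ᾱ α β} + √-1 m A_{β α} φʲ_ᾱ)` of the operator
`P φ = (Pʲ_β φ) θ^β ⊗ E_j`. -/
def paneitz (j : Fin n) (β : Fin m) : ℂ :=
  ∑ α, (comp₃ S h φ E j (S.anti e α) (S.holo e α) (S.holo e β)
    + Complex.I * m * cx₂ (S.pseudoTorsion x) (S.holo e β) (S.holo e α)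
      * comp₁ h φ E j (S.anti e α))

/-- `⟨P φ + conj (P φ), d_b φ⟩ = ∑_{j, β} (Pʲ_β φ · φʲ_β̄ + conj (Pʲ_β φ) · φʲ_β)`, where
`d_b φ = (φʲ_β θ^β + φʲ_β̄ θ^β̄) ⊗ E_j` and `⟨θ^β, θ^γ̄⟩ = δ_{β γ}`, `⟨θ^β, θ^γ⟩ = 0`. The sum is a
real number. -/
def paneitzPairing : ℝ :=
  (∑ j, ∑ β, (paneitz S h φ e E j β * comp₁ h φ E j (S.anti e β)
    + starRingEnd ℂ (paneitz S h φ e E j β) * comp₁ h φ E j (S.holo e β))).re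

end Maps

end CRGeom

end

open scoped Manifold ContDiff Topology
open MeasureTheory

noncomputable section

namespace CRGeom

set_option maxSynthPendingDepth 3

/-! ### Calculus with operator-valued functions -/

section ClmCalculus

variable {V X Y W : Type*} [NormedAddCommGroup V] [NormedSpace ℝ V]
  [NormedAddCommGroup X] [NormedSpace ℝ X] [NormedAddCommGroup Y] [NormedSpace ℝ Y]
  [NormedAddCommGroup W] [NormedSpace ℝ W]

/-! The theorem is a Bochner argument for the trace-free part of the mixed complex Hessian. Write β
for the second fundamental form of φ and put B_{ᾱβ} = φ_{ᾱβ} - (1/m) (∑_γ φ_{γ̄γ}) δ_{αβ}. Let Z be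
the real horizontal vector field with g(Z, T_ᾱ) = 2 ∑_β ⟨B_{ᾱβ}, φ_β̄⟩. In real terms Z = ∑ Θ(ε_A,
ε_B, ε_B) ε_A over the frame ε = (e, Je), with Θ as in `bform` for c = 1/m: its first two terms
isolate φ_{ᾱβ} φ_β̄, and its last two isolate the trace.

The divergence of Z has two kinds of terms. If the derivative falls on dφ, the result is the
quadratic expression `quadL`. This is the squared norm of the trace-free part of the symmetric
J-invariant part of β, so it is nonnegative by Cauchy-Schwarz (`quadL_nonneg`). If it falls on β,
the Ricci identity (`LocalMap.tff_swap`) exchanges the last two indices of φ_{ᾱβα}. This leaves (m -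
1)/m times φ_{ᾱαβ}, a curvature term of N, and curvature and torsion terms of M. The curvature term
of N is `hermL`, nonnegative by the hypothesis on N. On M the derivatives in the Reeb direction
cancel, and by the first Bianchi identity the curvature contracts to the pseudo-Hermitian torsion
(`ricL_add`), with exactly the coefficient that occurs in P. Hence (`sum_bfD`) div Z = 2 ((m - 1)/m)
⟨Pφ + conj(Pφ), d_bφ⟩ + `hermL` + `quadL`, and integration over the compact manifold M gives the
claim, the coefficient being positive for m ≥ 2.

All computations take place in charts, where fields are vector-valued functions. The Tanaka-Webster
connection is the metric connection whose torsion is prescribed through dθ and τ = -½ J L_T J. It is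
given by a Koszul formula, and integrability together with d(dθ) = 0 shows that it makes T, θ and J
parallel (`LocalCR.fderiv_reeb`, `LocalCR.nablaJ_eq_zero`). Uniqueness (`LocalCR.eq_gamma`)
identifies it with the connection of the statement.

The frames of the statement are chosen independently at each point and need not be continuous. Every
trace is therefore rewritten with a fixed basis and the smooth horizontal cometric `cog`; this makes
Z smooth and the integrand continuous.

The divergence theorem holds because the density of Ψ in a chart has logarithmic derivative tr Γ_a
(`LocalCR.fderiv_volL`). A partition of unity reduces it to compactly supported functions on
ℝ^{2m+1}. -/

lemma fderiv_clm_app {A : V → X →L[ℝ] Y} {x : V → X} {z : V} (hA : DifferentiableAt ℝ A z)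
    (hx : DifferentiableAt ℝ x z) (a : V) :
    fderiv ℝ (fun y => A y (x y)) z a = fderiv ℝ A z a (x z) + A z (fderiv ℝ x z a) := by
  rw [fderiv_clm_apply hA hx]; simp [add_comm]

lemma fderiv_clm_app_const {A : V → X →L[ℝ] Y} {z : V} (hA : DifferentiableAt ℝ A z)
    (x : X) (a : V) : fderiv ℝ (fun y => A y x) z a = fderiv ℝ A z a x := by
  rw [fderiv_clm_app hA (differentiableAt_const x)]; simp

lemma fderiv_clm_app₂ {A : V → X →L[ℝ] Y →L[ℝ] W} {x : V → X} {y : V → Y} {z : V}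
    (hA : DifferentiableAt ℝ A z) (hx : DifferentiableAt ℝ x z) (hy : DifferentiableAt ℝ y z)
    (a : V) :
    fderiv ℝ (fun p => A p (x p) (y p)) z a =
      fderiv ℝ A z a (x z) (y z) + A z (fderiv ℝ x z a) (y z) + A z (x z) (fderiv ℝ y z a) := by
  rw [fderiv_clm_app (hA.clm_apply hx) hy, fderiv_clm_app hA hx]; simp

lemma fderiv_eq_zero_of_eqOn {f : V → X} {U : Set V} (hU : IsOpen U) {c : X}
    (hf : ∀ z ∈ U, f z = c) {z : V} (hz : z ∈ U) : fderiv ℝ f z = 0 := by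
  have : f =ᶠ[𝓝 z] fun _ => c := Filter.eventually_of_mem (hU.mem_nhds hz) hf
  rw [this.fderiv_eq]; simp

lemma fderiv_congr_of_eqOn {f f' : V → X} {U : Set V} (hU : IsOpen U)
    (hf : ∀ z ∈ U, f z = f' z) {z : V} (hz : z ∈ U) : fderiv ℝ f z = fderiv ℝ f' z :=
  Filter.EventuallyEq.fderiv_eq (Filter.eventually_of_mem (hU.mem_nhds hz) hf)

lemma differentiableAt_of_smoothOn {f : V → X} {U : Set V} (hU : IsOpen U)
    (hf : ContDiffOn ℝ ∞ f U) {z : V} (hz : z ∈ U) : DifferentiableAt ℝ f z :=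
  (hf.contDiffAt (hU.mem_nhds hz)).differentiableAt (by simp)

lemma smoothOn_fderiv {f : V → X} {U : Set V} (hU : IsOpen U)
    (hf : ContDiffOn ℝ ∞ f U) : ContDiffOn ℝ ∞ (fderiv ℝ f) U :=
  hf.fderiv_of_isOpen hU (by simp)

lemma sndFDeriv_symm {f : V → X} {U : Set V} (hU : IsOpen U) (hf : ContDiffOn ℝ ∞ f U)
    {z : V} (hz : z ∈ U) (a b : V) :
    fderiv ℝ (fderiv ℝ f) z a b = fderiv ℝ (fderiv ℝ f) z b a :=
  ((hf.contDiffAt (hU.mem_nhds hz)).isSymmSndFDerivAt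
    (by simp only [minSmoothness_of_isRCLikeNormedField]; exact WithTop.coe_le_coe.2 (le_top : (2 : ℕ∞) ≤ ⊤))).eq a b

lemma smoothOn_clm_iff [FiniteDimensional ℝ X] {f : V → X →L[ℝ] Y} {U : Set V} :
    ContDiffOn ℝ ∞ f U ↔ ∀ x, ContDiffOn ℝ ∞ (fun z => f z x) U :=
  contDiffOn_clm_apply

lemma smoothOn_flip [FiniteDimensional ℝ X] [FiniteDimensional ℝ Y] {f : V → X →L[ℝ] Y →L[ℝ] W}
    {U : Set V} (hf : ContDiffOn ℝ ∞ f U) : ContDiffOn ℝ ∞ (fun z => (f z).flip) U :=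
  smoothOn_clm_iff.2 fun _ => smoothOn_clm_iff.2 fun _ =>
    (hf.clm_apply contDiffOn_const).clm_apply contDiffOn_const

lemma smoothOn_inverse [CompleteSpace X] {f : V → X →L[ℝ] Y} {U : Set V}
    (hf : ContDiffOn ℝ ∞ f U) (hi : ∀ z ∈ U, (f z).IsInvertible) :
    ContDiffOn ℝ ∞ (fun z => (f z).inverse) U := fun z hz =>
  ContDiffAt.comp_contDiffWithinAt z (hi z hz).contDiffAt_map_inverse (hf z hz)

end ClmCalculus

/-! ### Nondegenerate bilinear forms as invertible operators. -/

section BilinearForms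

variable {V : Type*} [NormedAddCommGroup V] [NormedSpace ℝ V] [FiniteDimensional ℝ V]

/-- V and its dual have the same dimension. Smoothness of the Reeb field, of inverse metrics and of
Christoffel symbols then follows from smoothness of operator inversion. -/
lemma isInvertible_of_injective {B : V →L[ℝ] V →L[ℝ] ℝ} (h : ∀ v, (∀ w, B v w = 0) → v = 0) :
    B.IsInvertible := by
  have hinj : Function.Injective B.toLinearMap := by
    rw [← LinearMap.ker_eq_bot, LinearMap.ker_eq_bot']
    intro v hv
    exact h v fun w => by
      have : B v = 0 := hv
      simp [this]
  have hfr : Module.finrank ℝ V = Module.finrank ℝ (V →L[ℝ] ℝ) := by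
    rw [← (LinearMap.toContinuousLinearMap (𝕜 := ℝ) (E := V) (F' := ℝ)).finrank_eq]
    exact (Subspace.dual_finrank_eq (K := ℝ) (V := V)).symm
  let e := LinearEquiv.ofInjectiveOfFinrankEq B.toLinearMap hinj hfr
  exact ⟨e.toContinuousLinearEquiv, by ext; rfl⟩

omit [FiniteDimensional ℝ V] in
lemma apply_inverse_apply {B : V →L[ℝ] V →L[ℝ] ℝ} (h : B.IsInvertible) (ξ : V →L[ℝ] ℝ) :
    B (B.inverse ξ) = ξ := by
  obtain ⟨e, rfl⟩ := h
  simp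

end BilinearForms

/-! ### Strictly pseudoconvex CR structures on open sets of a vector space -/

section LocalCR

variable {V : Type*} [NormedAddCommGroup V] [NormedSpace ℝ V]

/-- `dθ` for a 1-form `θ` on a vector space. -/
def levi (θ : V → V →L[ℝ] ℝ) (z : V) : V →L[ℝ] V →L[ℝ] ℝ := fderiv ℝ θ z - (fderiv ℝ θ z).flip

lemma levi_apply (θ : V → V →L[ℝ] ℝ) (z u v : V) :
    levi θ z u v = fderiv ℝ θ z u v - fderiv ℝ θ z v u := rfl

lemma levi_swap (θ : V → V →L[ℝ] ℝ) (z u v : V) : levi θ z u v = -levi θ z v u := by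
  simp [levi_apply]

lemma levi_self (θ : V → V →L[ℝ] ℝ) (z u : V) : levi θ z u u = 0 := by
  simp [levi_apply]

/-- The Reeb field of `θ`. -/
def reebL (θ : V → V →L[ℝ] ℝ) (z : V) : V := (levi θ z + (θ z).smulRight (θ z)).inverse (θ z)

/-- The Webster metric of `(θ, J)`. -/
def websterL (θ : V → V →L[ℝ] ℝ) (J : V → V →L[ℝ] V) (z : V) : V →L[ℝ] V →L[ℝ] ℝ :=
  ((levi θ z).flip.comp (J z)).flip + (θ z).smulRight (θ z)

lemma websterL_apply (θ : V → V →L[ℝ] ℝ) (J : V → V →L[ℝ] V) (z u v : V) :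
    websterL θ J z u v = levi θ z u (J z v) + θ z u * θ z v := rfl

/-- `(θ, J)` is a strictly pseudoconvex CR structure on the open subset `U` of a vector space. -/
structure LocalCR (U : Set V) (θ : V → V →L[ℝ] ℝ) (J : V → V →L[ℝ] V) : Prop where
  isOpen : IsOpen U
  smooth_θ : ContDiffOn ℝ ∞ θ U
  smooth_J : ContDiffOn ℝ ∞ J U
  θ_ne_zero : ∀ z ∈ U, θ z ≠ 0
  J_mem : ∀ z ∈ U, ∀ v, θ z v = 0 → θ z (J z v) = 0
  J_sq : ∀ z ∈ U, ∀ v, θ z v = 0 → J z (J z v) = -v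
  J_radical : ∀ z ∈ U, ∀ v, (∀ w, levi θ z v w = 0) → J z v = 0
  pos : ∀ z ∈ U, ∀ v, θ z v = 0 → v ≠ 0 → 0 < levi θ z v (J z v)
  integrable : ∀ X Y : V → V, ContDiffOn ℝ ∞ X U → ContDiffOn ℝ ∞ Y U →
    (∀ z ∈ U, θ z (X z) = 0) → (∀ z ∈ U, θ z (Y z) = 0) → ∀ z ∈ U,
      θ z (VectorField.lieBracket ℝ X Y z
        - VectorField.lieBracket ℝ (fun y => J y (X y)) (fun y => J y (Y y)) z) = 0 ∧
      VectorField.lieBracket ℝ (fun y => J y (X y)) Y z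
        + VectorField.lieBracket ℝ X (fun y => J y (Y y)) z
        = J z (VectorField.lieBracket ℝ X Y z
          - VectorField.lieBracket ℝ (fun y => J y (X y)) (fun y => J y (Y y)) z)

namespace LocalCR

variable {U : Set V} {θ : V → V →L[ℝ] ℝ} {J : V → V →L[ℝ] V} (H : LocalCR U θ J) {z : V}
  (hz : z ∈ U)
include H hz

lemma dθ : DifferentiableAt ℝ θ z := differentiableAt_of_smoothOn H.isOpen H.smooth_θ hz
lemma dJ : DifferentiableAt ℝ J z := differentiableAt_of_smoothOn H.isOpen H.smooth_J hz

lemma eq_zero_of_horizontal_radical {v : V} (hv : θ z v = 0) (h : ∀ w, levi θ z v w = 0) :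
    v = 0 := by
  by_contra hne
  exact (H.pos z hz v hv hne).ne' (h _)

variable [FiniteDimensional ℝ V]

/-- On ker θ the form dθ is nondegenerate, as pairing v with Jv shows. So a vector with θ = 1 can be
corrected by a horizontal one until dθ annihilates H, and antisymmetry settles the remaining
direction. -/
lemma exists_reeb : ∃ T, θ z T = 1 ∧ ∀ w, levi θ z T w = 0 := by
  obtain ⟨v₁, hv₁⟩ : ∃ v, θ z v ≠ 0 := by
    by_contra! h
    exact H.θ_ne_zero z hz (by ext v; simpa using h v)
  set v₀ := (θ z v₁)⁻¹ • v₁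
  have hv₀ : θ z v₀ = 1 := by simp [v₀, hv₁]
  let K := (θ z).toLinearMap.ker
  let B : K →ₗ[ℝ] Module.Dual ℝ K :=
    LinearMap.mk₂ ℝ (fun u v : K => levi θ z (u : V) (v : V))
      (by simp) (by simp) (by simp) (by simp)
  have hBinj : Function.Injective B := by
    rw [← LinearMap.ker_eq_bot, LinearMap.ker_eq_bot']
    intro u hu
    by_contra hne
    have hu0 : θ z u = 0 := u.2
    have h1 : levi θ z u (J z u) = 0 := by
      have := LinearMap.congr_fun hu ⟨J z u, H.J_mem z hz _ hu0⟩
      simpa [B] using this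
    exact (H.pos z hz u hu0 (by simpa using hne)).ne' h1
  have hBsurj : Function.Surjective B :=
    (LinearMap.injective_iff_surjective_of_finrank_eq_finrank
      (Subspace.dual_finrank_eq (K := ℝ) (V := K)).symm).1 hBinj
  let ξ : Module.Dual ℝ K := ((levi θ z v₀).toLinearMap.domRestrict K)
  obtain ⟨k, hk⟩ := hBsurj (-ξ)
  have hk0 : θ z k = 0 := k.2
  have hT1 : θ z (v₀ + k) = 1 := by simp [hv₀, hk0]
  have hH : ∀ w, θ z w = 0 → levi θ z (v₀ + k) w = 0 := by
    intro w hw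
    have := LinearMap.congr_fun hk ⟨w, hw⟩
    simp only [B, ξ, LinearMap.mk₂_apply, LinearMap.neg_apply, LinearMap.domRestrict_apply] at this
    simp only [map_add, add_apply]
    have h2 : levi θ z k w = -(levi θ z v₀ w) := this
    rw [h2]; ring
  refine ⟨v₀ + k, hT1, fun w => ?_⟩
  have h3 := hH (w - θ z w • (v₀ + k)) (by rw [map_sub, map_smul, hT1]; simp)
  rw [map_sub, map_smul, levi_self] at h3
  simpa using h3

/-- Pairing a null vector of dθ + θ ⊗ θ with T shows that it is horizontal, hence zero by positivity
of the Levi form. Since this operator sends T to θ, the Reeb field is its inverse applied to θ, a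
formula that is smooth in the point. -/
lemma reeb_spec_invertible : (levi θ z + (θ z).smulRight (θ z)).IsInvertible := by
  obtain ⟨T, hT1, hT2⟩ := H.exists_reeb hz
  apply isInvertible_of_injective
  intro v hv
  have h0 : θ z v = 0 := by
    have := hv T
    rw [add_apply, add_apply, levi_swap, hT2] at this
    simpa [hT1] using this
  refine H.eq_zero_of_horizontal_radical hz h0 fun w => ?_
  simpa [h0] using hv w

lemma eq_reebL {T : V} (hT1 : θ z T = 1) (hT2 : ∀ w, levi θ z T w = 0) : T = reebL θ z := by
  have hinv := H.reeb_spec_invertible hz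
  obtain ⟨e, he⟩ := hinv
  have : (levi θ z + (θ z).smulRight (θ z)) T = θ z := by
    ext w; simp [hT1, hT2]
  rw [reebL]
  rw [← he] at this ⊢
  rw [← this]
  simp

lemma θ_reeb : θ z (reebL θ z) = 1 := by
  obtain ⟨T, hT1, hT2⟩ := H.exists_reeb hz
  rw [← H.eq_reebL hz hT1 hT2]; exact hT1

lemma levi_reeb (w : V) : levi θ z (reebL θ z) w = 0 := by
  obtain ⟨T, hT1, hT2⟩ := H.exists_reeb hz
  rw [← H.eq_reebL hz hT1 hT2]; exact hT2 w

lemma levi_reeb' (w : V) : levi θ z w (reebL θ z) = 0 := by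
  rw [levi_swap, H.levi_reeb hz, neg_zero]

lemma J_reeb : J z (reebL θ z) = 0 := H.J_radical z hz _ (H.levi_reeb hz)

/-- The decomposition of a vector into its horizontal part and its Reeb part. -/
lemma exists_decomp (v : V) : ∃ h, θ z h = 0 ∧ v = h + θ z v • reebL θ z :=
  ⟨v - θ z v • reebL θ z, by simp [H.θ_reeb hz], by simp⟩

lemma θ_J (v : V) : θ z (J z v) = 0 := by
  obtain ⟨h, h0, hv⟩ := H.exists_decomp hz v
  rw [hv, map_add, map_smul, H.J_reeb hz]
  simpa using H.J_mem z hz h h0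

lemma J_J (v : V) : J z (J z v) = -v + θ z v • reebL θ z := by
  obtain ⟨h, h0, hv⟩ := H.exists_decomp hz v
  have : J z v = J z h := by conv_lhs => rw [hv, map_add, map_smul, H.J_reeb hz]; simp
  rw [this, H.J_sq z hz h h0]
  conv_rhs => rw [hv]
  simp [h0, H.θ_reeb hz]

omit hz in
lemma smooth_levi : ContDiffOn ℝ ∞ (levi θ) U := by
  have h1 := smoothOn_fderiv H.isOpen H.smooth_θ
  exact h1.sub (smoothOn_flip h1)

omit hz [FiniteDimensional ℝ V] in
lemma smooth_smulRight : ContDiffOn ℝ ∞ (fun z => (θ z).smulRight (θ z)) U :=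
  H.smooth_θ.smulRight H.smooth_θ

omit hz in
lemma smooth_reeb : ContDiffOn ℝ ∞ (reebL θ) U := by
  have h := smoothOn_inverse (H.smooth_levi.add H.smooth_smulRight)
    (fun z hz => H.reeb_spec_invertible hz)
  exact h.clm_apply H.smooth_θ

omit hz in
lemma smooth_webster : ContDiffOn ℝ ∞ (websterL θ J) U := by
  refine ContDiffOn.add ?_ H.smooth_smulRight
  exact smoothOn_flip ((smoothOn_flip H.smooth_levi).clm_comp H.smooth_J)

lemma dω : DifferentiableAt ℝ (levi θ) z := differentiableAt_of_smoothOn H.isOpen H.smooth_levi hz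
lemma dT : DifferentiableAt ℝ (reebL θ) z :=
  differentiableAt_of_smoothOn H.isOpen H.smooth_reeb hz
lemma dg : DifferentiableAt ℝ (websterL θ J) z :=
  differentiableAt_of_smoothOn H.isOpen H.smooth_webster hz

omit hz in
lemma smooth_proj (a : V) : ContDiffOn ℝ ∞ (fun y => a - θ y a • reebL θ y) U :=
  contDiffOn_const.sub ((H.smooth_θ.clm_apply contDiffOn_const).smul H.smooth_reeb)

-- Differentiating θ(X) = 0 along Y and θ(Y) = 0 along X trades the derivatives of the fields for
-- derivatives of θ.
omit hz [FiniteDimensional ℝ V] in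
lemma θ_lieBracket {X Y : V → V} (hX : ∀ y ∈ U, θ y (X y) = 0) (hY : ∀ y ∈ U, θ y (Y y) = 0)
    {z : V} (hz : z ∈ U) (dX : DifferentiableAt ℝ X z) (dY : DifferentiableAt ℝ Y z) :
    θ z (VectorField.lieBracket ℝ X Y z) = -levi θ z (X z) (Y z) := by
  have e1 := congrArg (· (X z)) (fderiv_eq_zero_of_eqOn H.isOpen hY hz)
  have e2 := congrArg (· (Y z)) (fderiv_eq_zero_of_eqOn H.isOpen hX hz)
  simp only [fderiv_clm_app (H.dθ hz) dX, fderiv_clm_app (H.dθ hz) dY,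
    zero_apply] at e1 e2
  rw [VectorField.lieBracket, map_sub, levi_apply]
  linarith

/-- `dθ(JX, JY) = dθ(X, Y)`. -/
lemma levi_J_J (u v : V) : levi θ z (J z u) (J z v) = levi θ z u v := by
  have key : ∀ a b, θ z a = 0 → θ z b = 0 → levi θ z (J z a) (J z b) = levi θ z a b := by
    intro a b ha hb
    -- For the horizontal extensions c - θ(c)T, the first half of integrability says that θ kills
    -- [X, Y] - [JX, JY], which compares dθ(X, Y) with dθ(JX, JY).
    have hX0 : ∀ c, ∀ y ∈ U, θ y (c - θ y c • reebL θ y) = 0 := fun c y hy => by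
      simp [H.θ_reeb hy]
    have h := (H.integrable _ _ (H.smooth_proj a) (H.smooth_proj b) (hX0 a) (hX0 b) z hz).1
    have d : ∀ c, DifferentiableAt ℝ (fun y => c - θ y c • reebL θ y) z := fun c =>
      differentiableAt_of_smoothOn H.isOpen (H.smooth_proj c) hz
    rw [map_sub, H.θ_lieBracket (hX0 a) (hX0 b) hz (d a) (d b),
      H.θ_lieBracket (fun y hy => H.θ_J hy _) (fun y hy => H.θ_J hy _) hz
        ((H.dJ hz).clm_apply (d a)) ((H.dJ hz).clm_apply (d b))] at h
    simp only [ha, hb, zero_smul, sub_zero] at h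
    linarith
  obtain ⟨a, ha, hu⟩ := H.exists_decomp hz u
  obtain ⟨b, hb, hv⟩ := H.exists_decomp hz v
  rw [hu, hv]
  simp [H.J_reeb hz, H.levi_reeb hz, H.levi_reeb' hz, key a b ha hb]

lemma levi_eq (u v : V) : levi θ z u v = websterL θ J z (J z u) v := by
  rw [websterL_apply, H.levi_J_J hz, H.θ_J hz]; simp

lemma levi_J (u v : V) : levi θ z (J z u) v = -levi θ z u (J z v) := by
  have := H.levi_J_J hz u (J z v)
  rw [H.J_J hz v] at this
  simp only [map_add, map_neg, map_smul, H.levi_reeb' hz, smul_zero, add_zero] at this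
  linarith

lemma g_symm (u v : V) : websterL θ J z u v = websterL θ J z v u := by
  rw [websterL_apply, websterL_apply, levi_swap, H.levi_J hz, neg_neg, mul_comm]

lemma g_J (u v : V) : websterL θ J z (J z u) v = -websterL θ J z u (J z v) := by
  rw [← H.levi_eq hz, websterL_apply, H.J_J hz, H.θ_J hz]
  simp [H.levi_reeb' hz]

lemma g_reeb (v : V) : websterL θ J z (reebL θ z) v = θ z v := by
  rw [websterL_apply, H.levi_reeb hz, H.θ_reeb hz]; simp

lemma g_pos {v : V} (hv : v ≠ 0) : 0 < websterL θ J z v v := by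
  obtain ⟨h, h0, hd⟩ := H.exists_decomp hz v
  have e : websterL θ J z v v = levi θ z h (J z h) + θ z v * θ z v := by
    rw [websterL_apply]
    congr 1
    conv_lhs => rw [hd]
    simp [H.J_reeb hz, H.levi_reeb hz]
  rw [e]
  by_cases hh : h = 0
  · have : θ z v ≠ 0 := by
      intro h'
      rw [h', hh] at hd
      simp at hd
      exact hv hd
    have := mul_self_pos.2 this
    simpa [hh] using this
  · have := H.pos z hz h h0 hh
    nlinarith [mul_self_nonneg (θ z v)]

lemma g_invertible : (websterL θ J z).IsInvertible :=
  isInvertible_of_injective fun v hv => by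
    by_contra h
    exact (H.g_pos hz h).ne' (hv v)

lemma g_ext {u v : V} (h : ∀ w, websterL θ J z u w = websterL θ J z v w) : u = v := by
  by_contra hne
  have := H.g_pos hz (sub_ne_zero.2 hne)
  rw [map_sub (websterL θ J z), sub_apply, h, sub_self] at this
  exact this.false

end LocalCR

end LocalCR

/-! ### Metric connections with prescribed torsion -/

section Koszul

variable {V : Type*} [NormedAddCommGroup V] [NormedSpace ℝ V]

/-- The right-hand side of the Koszul formula for the metric `g` and the torsion `τ`, where `A` is
the derivative of `g`. -/
def koszulForm (A : V →L[ℝ] V →L[ℝ] V →L[ℝ] ℝ) (g : V →L[ℝ] V →L[ℝ] ℝ) (τ : V →L[ℝ] V →L[ℝ] V)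
    (u v : V) : V →L[ℝ] ℝ :=
  A u v + A v u - (A.flip u).flip v + g (τ u v) - (g.flip u).comp (τ v)
    + (g.flip v).comp (τ.flip u)

lemma koszulForm_apply (A : V →L[ℝ] V →L[ℝ] V →L[ℝ] ℝ) (g : V →L[ℝ] V →L[ℝ] ℝ)
    (τ : V →L[ℝ] V →L[ℝ] V) (u v w : V) :
    koszulForm A g τ u v w = A u v w + A v u w - A w u v + g (τ u v) w - g (τ v w) u
      + g (τ w u) v := rfl

variable [FiniteDimensional ℝ V]

/-- The Christoffel symbols `Γ_u v` of the metric connection with torsion `τ`. -/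
def christ (A : V →L[ℝ] V →L[ℝ] V →L[ℝ] ℝ) (g : V →L[ℝ] V →L[ℝ] ℝ) (τ : V →L[ℝ] V →L[ℝ] V) :
    V →L[ℝ] V →L[ℝ] V :=
  LinearMap.toContinuousBilinearMap <|
    LinearMap.mk₂ ℝ (fun u v => (1 / 2 : ℝ) • g.inverse (koszulForm A g τ u v))
      (fun u u' v => by
        rw [← smul_add, ← map_add]; congr 2; ext w; simp [koszulForm_apply]; ring)
      (fun c u v => by
        have : koszulForm A g τ (c • u) v = c • koszulForm A g τ u v := by
          ext w; simp [koszulForm_apply]; ring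
        rw [this, map_smul, smul_comm])
      (fun u v v' => by
        rw [← smul_add, ← map_add]; congr 2; ext w; simp [koszulForm_apply]; ring)
      (fun c u v => by
        have : koszulForm A g τ u (c • v) = c • koszulForm A g τ u v := by
          ext w; simp [koszulForm_apply]; ring
        rw [this, map_smul, smul_comm])

lemma christ_apply (A : V →L[ℝ] V →L[ℝ] V →L[ℝ] ℝ) (g : V →L[ℝ] V →L[ℝ] ℝ)
    (τ : V →L[ℝ] V →L[ℝ] V) (u v : V) :
    christ A g τ u v = (1 / 2 : ℝ) • g.inverse (koszulForm A g τ u v) := rfl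

variable {A : V →L[ℝ] V →L[ℝ] V →L[ℝ] ℝ} {g : V →L[ℝ] V →L[ℝ] ℝ} {τ : V →L[ℝ] V →L[ℝ] V}

lemma inner_christ (hg : g.IsInvertible) (u v w : V) :
    g (christ A g τ u v) w = (1 / 2) * koszulForm A g τ u v w := by
  rw [christ_apply, map_smul, apply_inverse_apply hg]; rfl

lemma christ_metric (hg : g.IsInvertible) (hs : ∀ u v, g u v = g v u)
    (hA : ∀ u v w, A u v w = A u w v) (hτ : ∀ u v, τ u v = -τ v u) (u v w : V) :
    A u v w = g (christ A g τ u v) w + g v (christ A g τ u w) := by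
  rw [hs v, inner_christ hg, inner_christ hg, koszulForm_apply, koszulForm_apply, hA u w v,
    hA w u v, hA v u w, hτ w v, hτ w u, hτ v u]
  simp only [map_neg, neg_apply]
  ring

lemma christ_torsion (hg : g.IsInvertible) (hA : ∀ u v w, A u v w = A u w v)
    (hτ : ∀ u v, τ u v = -τ v u) (hext : ∀ u v, (∀ w, g u w = g v w) → u = v) (u v : V) :
    christ A g τ u v - christ A g τ v u = τ u v := by
  refine hext _ _ fun w => ?_
  rw [map_sub, sub_apply, inner_christ hg, inner_christ hg, koszulForm_apply, koszulForm_apply,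
    hA w v u, hτ v u, hτ v w, hτ w u]
  simp only [map_neg, neg_apply]
  ring

-- The cyclic combination of the metric equations, in which the torsion exchanges the two arguments
-- of Γ; everything but 2 g(Γ_u v, w) cancels. This is the uniqueness half of the Koszul argument.
omit [FiniteDimensional ℝ V] in
lemma inner_of_metric_of_torsion (hs : ∀ u v, g u v = g v u) {Γ : V → V → V}
    (hm : ∀ u v w, A u v w = g (Γ u v) w + g v (Γ u w)) (ht : ∀ u v, Γ u v - Γ v u = τ u v)
    (u v w : V) : g (Γ u v) w = (1 / 2) * koszulForm A g τ u v w := by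
  rw [koszulForm_apply, hm u v w, hm v u w, hm w u v, ← ht, ← ht, ← ht, hs v, hs u, hs u]
  simp only [map_sub, sub_apply]
  ring

lemma eq_christ (hg : g.IsInvertible) (hs : ∀ u v, g u v = g v u)
    (hext : ∀ u v, (∀ w, g u w = g v w) → u = v) {Γ : V → V → V}
    (hm : ∀ u v w, A u v w = g (Γ u v) w + g v (Γ u w)) (ht : ∀ u v, Γ u v - Γ v u = τ u v)
    (u v : V) : Γ u v = christ A g τ u v :=
  hext _ _ fun w => by rw [inner_christ hg, inner_of_metric_of_torsion hs hm ht]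

variable {E : Type*} [NormedAddCommGroup E] [NormedSpace ℝ E] {U : Set E}

lemma smoothOn_christ {A : E → V →L[ℝ] V →L[ℝ] V →L[ℝ] ℝ} {g : E → V →L[ℝ] V →L[ℝ] ℝ}
    {τ : E → V →L[ℝ] V →L[ℝ] V} (hA : ContDiffOn ℝ ∞ A U) (hg : ContDiffOn ℝ ∞ g U)
    (hτ : ContDiffOn ℝ ∞ τ U) (hi : ∀ z ∈ U, (g z).IsInvertible) :
    ContDiffOn ℝ ∞ (fun z => christ (A z) (g z) (τ z)) U := by
  refine smoothOn_clm_iff.2 fun u => smoothOn_clm_iff.2 fun v => ?_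
  refine contDiffOn_const.smul ((smoothOn_inverse hg hi).clm_apply ?_)
  refine smoothOn_clm_iff.2 fun w => ?_
  simp only [koszulForm_apply]
  have hA' : ∀ a b c, ContDiffOn ℝ ∞ (fun z => A z a b c) U := fun a b c =>
    ((hA.clm_apply contDiffOn_const).clm_apply contDiffOn_const).clm_apply contDiffOn_const
  have hg' : ∀ a b c, ContDiffOn ℝ ∞ (fun z => g z (τ z a b) c) U := fun a b c =>
    (hg.clm_apply ((hτ.clm_apply contDiffOn_const).clm_apply contDiffOn_const)).clm_apply
      contDiffOn_const
  exact (((((hA' _ _ _).add (hA' _ _ _)).sub (hA' _ _ _)).add (hg' _ _ _)).sub (hg' _ _ _)).add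
    (hg' _ _ _)

end Koszul

/-! ### The Tanaka-Webster connection on an open set: construction, and parallelism of T and θ. -/

section LocalTW

variable {V : Type*} [NormedAddCommGroup V] [NormedSpace ℝ V]

/-- The Lie derivative `L_T J` of `J` along the Reeb field. -/
def lieJ (θ : V → V →L[ℝ] ℝ) (J : V → V →L[ℝ] V) (z : V) : V →L[ℝ] V :=
  fderiv ℝ J z (reebL θ z) - (fderiv ℝ (reebL θ) z).comp (J z)
    + (J z).comp (fderiv ℝ (reebL θ) z)

lemma lieJ_apply (θ : V → V →L[ℝ] ℝ) (J : V → V →L[ℝ] V) (z u : V) :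
    lieJ θ J z u = fderiv ℝ J z (reebL θ z) u - fderiv ℝ (reebL θ) z (J z u)
      + J z (fderiv ℝ (reebL θ) z u) := rfl

/-- The pseudo-Hermitian torsion `τ = -½ J (L_T J)`. -/
def tauL (θ : V → V →L[ℝ] ℝ) (J : V → V →L[ℝ] V) (z : V) : V →L[ℝ] V :=
  (-(1 / 2 : ℝ)) • (J z).comp (lieJ θ J z)

lemma tauL_apply (θ : V → V →L[ℝ] ℝ) (J : V → V →L[ℝ] V) (z u : V) :
    tauL θ J z u = (-(1 / 2 : ℝ)) • J z (lieJ θ J z u) := rfl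

variable [FiniteDimensional ℝ V]

/-- The torsion of the Tanaka-Webster connection. -/
def torL (θ : V → V →L[ℝ] ℝ) (J : V → V →L[ℝ] V) (z : V) : V →L[ℝ] V →L[ℝ] V :=
  LinearMap.toContinuousBilinearMap <|
    LinearMap.mk₂ ℝ (fun u v => levi θ z u v • reebL θ z + θ z u • tauL θ J z v
        - θ z v • tauL θ J z u)
      (fun u u' v => by simp only [map_add, add_apply]; module)
      (fun c u v => by simp only [map_smul, smul_apply, smul_eq_mul]; module)
      (fun u v v' => by simp only [map_add]; module)
      (fun c u v => by simp only [map_smul, smul_eq_mul]; module)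

lemma torL_apply (θ : V → V →L[ℝ] ℝ) (J : V → V →L[ℝ] V) (z u v : V) :
    torL θ J z u v = levi θ z u v • reebL θ z + θ z u • tauL θ J z v - θ z v • tauL θ J z u := rfl

/-- The Christoffel symbols of the Tanaka-Webster connection. -/
def gammaL (θ : V → V →L[ℝ] ℝ) (J : V → V →L[ℝ] V) (z : V) : V →L[ℝ] V →L[ℝ] V :=
  christ (fderiv ℝ (websterL θ J) z) (websterL θ J z) (torL θ J z)

namespace LocalCR

variable {U : Set V} {θ : V → V →L[ℝ] ℝ} {J : V → V →L[ℝ] V} (H : LocalCR U θ J)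
include H

lemma smooth_tau : ContDiffOn ℝ ∞ (tauL θ J) U := by
  have hJ := smoothOn_fderiv H.isOpen H.smooth_J
  have hT := smoothOn_fderiv H.isOpen H.smooth_reeb
  have hL : ContDiffOn ℝ ∞ (lieJ θ J) U :=
    ((hJ.clm_apply H.smooth_reeb).sub (hT.clm_comp H.smooth_J)).add (H.smooth_J.clm_comp hT)
  exact (H.smooth_J.clm_comp hL).const_smul (-(1 / 2 : ℝ))

lemma smooth_tor : ContDiffOn ℝ ∞ (torL θ J) U := by
  refine smoothOn_clm_iff.2 fun u => smoothOn_clm_iff.2 fun v => ?_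
  simp only [torL_apply]
  exact ((((H.smooth_levi.clm_apply contDiffOn_const).clm_apply contDiffOn_const).smul
    H.smooth_reeb).add ((H.smooth_θ.clm_apply contDiffOn_const).smul
      (H.smooth_tau.clm_apply contDiffOn_const))).sub
    ((H.smooth_θ.clm_apply contDiffOn_const).smul (H.smooth_tau.clm_apply contDiffOn_const))

lemma smooth_gamma : ContDiffOn ℝ ∞ (gammaL θ J) U :=
  smoothOn_christ (smoothOn_fderiv H.isOpen H.smooth_webster) H.smooth_webster H.smooth_tor
    fun _ hz => H.g_invertible hz

omit H in
lemma tor_swap (z u v : V) : torL θ J z u v = -torL θ J z v u := by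
  rw [torL_apply, torL_apply, levi_swap]; module

variable {z : V} (hz : z ∈ U)
include hz

lemma fderiv_g_symm (u v w : V) : fderiv ℝ (websterL θ J) z u v w
    = fderiv ℝ (websterL θ J) z u w v := by
  have h := fderiv_congr_of_eqOn H.isOpen (fun y hy => H.g_symm hy v w) hz
  have := congrArg (· u) h
  have d : ∀ a, DifferentiableAt ℝ (fun y => websterL θ J y a) z := fun a =>
    (H.dg hz).clm_apply (differentiableAt_const a)
  simpa only [fderiv_clm_app_const (d _), fderiv_clm_app_const (H.dg hz)] using this

lemma gamma_metric (u v w : V) : fderiv ℝ (websterL θ J) z u v w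
    = websterL θ J z (gammaL θ J z u v) w + websterL θ J z v (gammaL θ J z u w) :=
  christ_metric (H.g_invertible hz) (H.g_symm hz) (H.fderiv_g_symm hz) (tor_swap z) u v w

lemma gamma_torsion (u v : V) : gammaL θ J z u v - gammaL θ J z v u = torL θ J z u v :=
  christ_torsion (H.g_invertible hz) (H.fderiv_g_symm hz) (tor_swap z)
    (fun _ _ => H.g_ext hz) u v

/-- `L_T θ = 0`. -/
lemma fderiv_θ_reeb (u : V) : fderiv ℝ θ z (reebL θ z) u + θ z (fderiv ℝ (reebL θ) z u) = 0 := by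
  have h1 := H.levi_reeb hz u
  have h2 := congrArg (· u) (fderiv_eq_zero_of_eqOn H.isOpen (fun y hy => H.θ_reeb hy) hz)
  simp only [fderiv_clm_app (H.dθ hz) (H.dT hz), zero_apply] at h2
  rw [levi_apply] at h1
  linarith

lemma fderiv_levi (u v w : V) : fderiv ℝ (levi θ) z u v w
    = fderiv ℝ (fderiv ℝ θ) z u v w - fderiv ℝ (fderiv ℝ θ) z u w v := by
  have h2 := smoothOn_fderiv H.isOpen H.smooth_θ
  have d2 := differentiableAt_of_smoothOn H.isOpen h2 hz
  have d3 : ∀ a, DifferentiableAt ℝ (fun y => fderiv ℝ θ y a) z := fun a =>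
    d2.clm_apply (differentiableAt_const a)
  have e : fderiv ℝ (fun y => levi θ y v w) z u
      = fderiv ℝ (fun y => fderiv ℝ θ y v w - fderiv ℝ θ y w v) z u := rfl
  have d : ∀ a, DifferentiableAt ℝ (fun y => levi θ y a) z := fun a =>
    (H.dω hz).clm_apply (differentiableAt_const a)
  rw [fderiv_clm_app_const (d _), fderiv_clm_app_const (H.dω hz),
    fderiv_fun_sub ((d3 v).clm_apply (differentiableAt_const w))
      ((d3 w).clm_apply (differentiableAt_const v)), sub_apply, fderiv_clm_app_const (d3 v),
    fderiv_clm_app_const (d3 w), fderiv_clm_app_const d2, fderiv_clm_app_const d2] at e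
  exact e

/-- `d(dθ) = 0`. -/
lemma fderiv_levi_cyclic (u v w : V) : fderiv ℝ (levi θ) z u v w + fderiv ℝ (levi θ) z v w u
    + fderiv ℝ (levi θ) z w u v = 0 := by
  have hs := sndFDeriv_symm H.isOpen H.smooth_θ hz
  rw [H.fderiv_levi hz, H.fderiv_levi hz, H.fderiv_levi hz, hs u v, hs v w, hs w u]
  ring

lemma fderiv_levi_swap (u v w : V) : fderiv ℝ (levi θ) z u v w = -fderiv ℝ (levi θ) z u w v := by
  rw [H.fderiv_levi hz, H.fderiv_levi hz]; ring

lemma fderiv_levi_reeb (u v : V) :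
    fderiv ℝ (levi θ) z u (reebL θ z) v = -levi θ z (fderiv ℝ (reebL θ) z u) v := by
  have h2 := congrArg (· u) (fderiv_eq_zero_of_eqOn H.isOpen (fun y hy => H.levi_reeb hy v) hz)
  simp only [fderiv_clm_app₂ (H.dω hz) (H.dT hz) (differentiableAt_const v), zero_apply,
    fderiv_fun_const, Pi.zero_apply, map_zero, add_zero] at h2
  linarith

/-- `L_T dθ = 0`. -/
lemma lie_levi (u v : V) : fderiv ℝ (levi θ) z (reebL θ z) u v
    + levi θ z (fderiv ℝ (reebL θ) z u) v + levi θ z u (fderiv ℝ (reebL θ) z v) = 0 := by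
  have h1 := H.fderiv_levi_cyclic hz (reebL θ z) u v
  have h2 := H.fderiv_levi_reeb hz u v
  have h3 := H.fderiv_levi_reeb hz v u
  rw [H.fderiv_levi_swap hz u v, h2, h3] at h1
  rw [levi_swap θ z u]
  linarith

lemma fderiv_g (u v w : V) : fderiv ℝ (websterL θ J) z u v w
    = fderiv ℝ (levi θ) z u v (J z w) + levi θ z v (fderiv ℝ J z u w)
      + fderiv ℝ θ z u v * θ z w + θ z v * fderiv ℝ θ z u w := by
  have d : ∀ a, DifferentiableAt ℝ (fun y => websterL θ J y a) z := fun a =>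
    (H.dg hz).clm_apply (differentiableAt_const a)
  have dθ' : ∀ a, DifferentiableAt ℝ (fun y => θ y a) z := fun a =>
    (H.dθ hz).clm_apply (differentiableAt_const a)
  have dl : ∀ a, DifferentiableAt ℝ (fun y => levi θ y a) z := fun a =>
    (H.dω hz).clm_apply (differentiableAt_const a)
  have dJw : DifferentiableAt ℝ (fun y => J y w) z := (H.dJ hz).clm_apply (differentiableAt_const w)
  have e : fderiv ℝ (fun y => websterL θ J y v w) z u
      = fderiv ℝ (fun y => levi θ y v (J y w) + θ y v * θ y w) z u := rfl
  rw [fderiv_clm_app_const (d _), fderiv_clm_app_const (H.dg hz),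
    fderiv_fun_add ((dl v).clm_apply dJw) ((dθ' v).fun_mul (dθ' w)), fderiv_fun_mul (dθ' v) (dθ' w),
    add_apply, fderiv_clm_app (dl v) dJw, fderiv_clm_app_const (H.dω hz),
    fderiv_clm_app_const (H.dJ hz), add_apply, smul_apply, smul_apply,
    fderiv_clm_app_const (H.dθ hz), fderiv_clm_app_const (H.dθ hz)] at e
  rw [e, smul_eq_mul, smul_eq_mul]
  ring

/-- `L_T g = dθ(·, (L_T J) ·)`. -/
lemma lie_g (u v : V) : fderiv ℝ (websterL θ J) z (reebL θ z) u v
    + websterL θ J z (fderiv ℝ (reebL θ) z u) v + websterL θ J z u (fderiv ℝ (reebL θ) z v)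
    = levi θ z u (lieJ θ J z v) := by
  have h1 := H.lie_levi hz u (J z v)
  have h2 := H.fderiv_θ_reeb hz u
  have h3 := H.fderiv_θ_reeb hz v
  rw [H.fderiv_g hz, websterL_apply, websterL_apply, lieJ_apply]
  simp only [map_add, map_sub]
  linear_combination h1 + θ z v * h2 + θ z u * h3

lemma fderiv_θ_J (u v : V) : fderiv ℝ θ z u (J z v) + θ z (fderiv ℝ J z u v) = 0 := by
  have h := congrArg (· u) (fderiv_eq_zero_of_eqOn H.isOpen (fun y hy => H.θ_J hy v) hz)
  simp only [fderiv_clm_app (H.dθ hz) ((H.dJ hz).clm_apply (differentiableAt_const v)),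
    fderiv_clm_app_const (H.dJ hz), zero_apply] at h
  exact h

lemma fderiv_J_reeb (u : V) : fderiv ℝ J z u (reebL θ z) + J z (fderiv ℝ (reebL θ) z u) = 0 := by
  have h := congrArg (· u) (fderiv_eq_zero_of_eqOn H.isOpen (fun y hy => H.J_reeb hy) hz)
  simp only [fderiv_clm_app (H.dJ hz) (H.dT hz), zero_apply] at h
  exact h

lemma fderiv_J_J (u v : V) : fderiv ℝ J z u (J z v) + J z (fderiv ℝ J z u v)
    = fderiv ℝ θ z u v • reebL θ z + θ z v • fderiv ℝ (reebL θ) z u := by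
  have h := congrArg (· u) (fderiv_congr_of_eqOn H.isOpen (fun y hy => H.J_J hy v) hz)
  have dJv : DifferentiableAt ℝ (fun y => J y v) z := (H.dJ hz).clm_apply (differentiableAt_const v)
  have dθ' : DifferentiableAt ℝ (fun y => θ y v) z := (H.dθ hz).clm_apply (differentiableAt_const v)
  simp only [fderiv_clm_app (H.dJ hz) dJv, fderiv_clm_app_const (H.dJ hz)] at h
  rw [h, fderiv_const_add, fderiv_fun_smul dθ' (H.dT hz)]
  simp [fderiv_clm_app_const (H.dθ hz), add_comm]

lemma θ_lieJ (u : V) : θ z (lieJ θ J z u) = 0 := by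
  have h1 := H.fderiv_θ_J hz (reebL θ z) u
  have h2 := H.fderiv_θ_reeb hz (J z u)
  rw [lieJ_apply, map_add, map_sub, H.θ_J hz]
  linarith

lemma J_tau (u : V) : J z (tauL θ J z u) = (1 / 2 : ℝ) • lieJ θ J z u := by
  rw [tauL_apply, map_smul, H.J_J hz, H.θ_lieJ hz]; simp

lemma lieJ_eq (u : V) : lieJ θ J z u = (2 : ℝ) • J z (tauL θ J z u) := by
  rw [H.J_tau hz]; simp

lemma θ_tau (u : V) : θ z (tauL θ J z u) = 0 := by
  rw [tauL_apply, map_smul, H.θ_J hz, smul_zero]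

/-- The Lie derivative along T of J² = -1 + θ ⊗ T, where both L_T θ and L_T T vanish. -/
lemma lieJ_J (u : V) : lieJ θ J z (J z u) = -J z (lieJ θ J z u) := by
  have h1 := H.fderiv_J_J hz (reebL θ z) u
  have h2 := H.fderiv_θ_reeb hz u
  rw [lieJ_apply, lieJ_apply]
  simp only [map_add, map_sub, H.J_J hz]
  have h3 : fderiv ℝ J z (reebL θ z) (J z u) = -J z (fderiv ℝ J z (reebL θ z) u)
      + fderiv ℝ θ z (reebL θ z) u • reebL θ z + θ z u • fderiv ℝ (reebL θ) z (reebL θ z) := by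
    rw [add_assoc, ← h1]; abel
  have h4 : θ z (fderiv ℝ (reebL θ) z u) = -fderiv ℝ θ z (reebL θ z) u := by linarith
  rw [h3, h4]
  simp only [map_neg, map_smul]
  module

lemma tau_J (u : V) : tauL θ J z (J z u) = -J z (tauL θ J z u) := by
  rw [tauL_apply, tauL_apply, H.lieJ_J hz, map_neg, map_smul]; simp

lemma tau_reeb : tauL θ J z (reebL θ z) = 0 := by
  have h := H.fderiv_J_reeb hz (reebL θ z)
  rw [tauL_apply, lieJ_apply, H.J_reeb hz, map_zero, sub_zero, h]
  simp

/-- The covariant derivative of the Reeb field vanishes. -/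
lemma fderiv_reeb (u : V) : fderiv ℝ (reebL θ) z u = -gammaL θ J z u (reebL θ z) := by
  set g := websterL θ J z with hg
  set T := reebL θ z with hT
  set Γ := gammaL θ J z with hΓ
  let S := fun u => fderiv ℝ (reebL θ) z u + Γ u T
  -- Here S u is ∇_u T, and g(T, ·) = θ with ∇g = 0 turns g(S u, w) into (∇_u θ)(w).
  have hθ : ∀ u w, fderiv ℝ θ z u w - θ z (Γ u w) = g (S u) w := by
    intro u w
    have h := congrArg (· u) (fderiv_congr_of_eqOn H.isOpen (fun y hy => H.g_reeb hy w) hz)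
    simp only [fderiv_clm_app₂ (H.dg hz) (H.dT hz) (differentiableAt_const w),
      fderiv_clm_app_const (H.dθ hz), fderiv_fun_const, Pi.zero_apply, zero_apply, map_zero, add_zero] at h
    rw [H.gamma_metric hz, H.g_reeb hz] at h
    simp only [S, map_add, add_apply]
    linarith
  -- The skew part of ∇θ is dθ minus the θ-component of the torsion, and the torsion was prescribed
  -- to make this zero.
  have hanti : ∀ u w, g (S u) w - g (S w) u = 0 := by
    intro u w
    have ht := congrArg (θ z) (H.gamma_torsion hz u w)
    rw [torL_apply] at ht
    simp only [map_add, map_sub, map_smul, H.θ_tau hz, H.θ_reeb hz, smul_eq_mul, mul_zero,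
      levi_apply] at ht
    have := hθ u w
    have := hθ w u
    linarith
  -- L_T g, computed in two ways. The left side is symmetric in u, w and the right side is skew, so
  -- both vanish; the g-symmetry of τ is not needed for this.
  have hsymm : ∀ u w, g (S u) w + g (S w) u = g u (tauL θ J z w) - g (tauL θ J z u) w := by
    intro u w
    have h := H.lie_g hz u w
    rw [H.gamma_metric hz, H.lieJ_eq hz, map_smul, smul_eq_mul] at h
    have e1 : levi θ z u (J z (tauL θ J z w)) = g u (tauL θ J z w) := by
      rw [hg, websterL_apply, H.θ_tau hz]; simp
    have t : ∀ v, Γ T v = Γ v T + tauL θ J z v := by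
      intro v
      have := H.gamma_torsion hz T v
      rw [torL_apply, hT, H.levi_reeb hz, H.θ_reeb hz, H.tau_reeb hz] at this
      rw [sub_eq_iff_eq_add] at this
      rw [this]; simp [hΓ, hT, add_comm]
    rw [e1, ← hT, ← hΓ, t, t] at h
    simp only [S, map_add, add_apply] at h ⊢
    have h5 := H.g_symm hz (Γ w T) u
    have h6 := H.g_symm hz (fderiv ℝ (reebL θ) z w) u
    simp only [← hg] at *
    linarith
  have hS : S u = 0 := by
    refine H.g_ext hz fun w => ?_
    have h1 := hanti u w
    have h2 := hsymm u w
    have h3 := hsymm w u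
    rw [H.g_symm hz w (tauL θ J z u), H.g_symm hz (tauL θ J z w) u] at h3
    simp only [← hg, map_zero, zero_apply] at *
    linarith
  exact eq_neg_of_add_eq_zero_left hS

/-- The covariant derivative of `θ` vanishes. -/
lemma fderiv_θ (u w : V) : fderiv ℝ θ z u w = θ z (gammaL θ J z u w) := by
  have h := congrArg (· u) (fderiv_congr_of_eqOn H.isOpen (fun y hy => H.g_reeb hy w) hz)
  simp only [fderiv_clm_app₂ (H.dg hz) (H.dT hz) (differentiableAt_const w),
    fderiv_clm_app_const (H.dθ hz), fderiv_fun_const, Pi.zero_apply, zero_apply, map_zero, add_zero] at h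
  rw [H.gamma_metric hz, H.g_reeb hz, H.fderiv_reeb hz] at h
  simp only [map_neg, neg_apply] at h
  linarith

end LocalCR

end LocalTW

/-! ### Parallelism of J, uniqueness of the connection, and its curvature identities. -/

section LocalTW

variable {V : Type*} [NormedAddCommGroup V] [NormedSpace ℝ V] [FiniteDimensional ℝ V]

/-- The covariant derivative of `J`. -/
def nablaJ (θ : V → V →L[ℝ] ℝ) (J : V → V →L[ℝ] V) (z u v : V) : V :=
  fderiv ℝ J z u v + gammaL θ J z u (J z v) - J z (gammaL θ J z u v)

/-- The curvature of a connection with Christoffel symbols `Γ`. -/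
def curvL (Γ : V → V →L[ℝ] V →L[ℝ] V) (z u v w : V) : V :=
  fderiv ℝ Γ z u v w - fderiv ℝ Γ z v u w + Γ z u (Γ z v w) - Γ z v (Γ z u w)

namespace LocalCR

variable {U : Set V} {θ : V → V →L[ℝ] ℝ} {J : V → V →L[ℝ] V} (H : LocalCR U θ J)
  {z : V} (hz : z ∈ U)
include H hz

omit H hz in
lemma tor_horizontal {u v : V} (hu : θ z u = 0) (hv : θ z v = 0) :
    torL θ J z u v = levi θ z u v • reebL θ z := by
  simp [torL_apply, hu, hv]

lemma tor_reeb (u : V) : torL θ J z (reebL θ z) u = tauL θ J z u := by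
  simp [torL_apply, H.levi_reeb hz, H.θ_reeb hz, H.tau_reeb hz]

/-- Since τ = -½ J L_T J, the symmetric form L_T g equals 2 g(·, τ·). -/
lemma g_tau (u v : V) : websterL θ J z (tauL θ J z u) v = websterL θ J z u (tauL θ J z v) := by
  have h := H.lie_g hz u v
  have h' := H.lie_g hz v u
  rw [H.lieJ_eq hz, map_smul, smul_eq_mul] at h h'
  have e : ∀ a b, levi θ z a (J z (tauL θ J z b)) = websterL θ J z a (tauL θ J z b) := by
    intro a b
    rw [websterL_apply, H.θ_tau hz]; simp
  rw [e] at h h'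
  rw [H.fderiv_g_symm hz] at h'
  rw [H.g_symm hz (tauL θ J z u) v]
  have h1 := H.g_symm hz (fderiv ℝ (reebL θ) z u) v
  have h2 := H.g_symm hz (fderiv ℝ (reebL θ) z v) u
  linarith

/-- The second half of integrability, for horizontal extensions of u and v, with ∇ in place of
partial derivatives. Horizontal torsion is a multiple of T, so its contributions cancel or are
killed by J. -/
lemma nijenhuis {u v : V} (hu : θ z u = 0) (hv : θ z v = 0) :
    nablaJ θ J z u v - nablaJ θ J z v u
      + J z (nablaJ θ J z (J z u) v - nablaJ θ J z (J z v) u) = 0 := by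
  set X : V → V := fun y => u - θ y u • reebL θ y with hX
  set Y : V → V := fun y => v - θ y v • reebL θ y with hY
  have hX0 : ∀ y ∈ U, θ y (X y) = 0 := fun y hy => by simp [hX, H.θ_reeb hy]
  have hY0 : ∀ y ∈ U, θ y (Y y) = 0 := fun y hy => by simp [hY, H.θ_reeb hy]
  have dX : DifferentiableAt ℝ X z := differentiableAt_of_smoothOn H.isOpen (H.smooth_proj u) hz
  have dY : DifferentiableAt ℝ Y z := differentiableAt_of_smoothOn H.isOpen (H.smooth_proj v) hz
  have h := (H.integrable X Y (H.smooth_proj u) (H.smooth_proj v) hX0 hY0 z hz).2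
  have eX : X z = u := by simp [hX, hu]
  have eY : Y z = v := by simp [hY, hv]
  have tX : ∀ w, θ z (fderiv ℝ X z w) = -θ z (gammaL θ J z w u) := by
    intro w
    have := congrArg (· w) (fderiv_eq_zero_of_eqOn H.isOpen hX0 hz)
    simp only [fderiv_clm_app (H.dθ hz) dX, zero_apply, eX, H.fderiv_θ hz] at this
    linarith
  have tY : ∀ w, θ z (fderiv ℝ Y z w) = -θ z (gammaL θ J z w v) := by
    intro w
    have := congrArg (· w) (fderiv_eq_zero_of_eqOn H.isOpen hY0 hz)
    simp only [fderiv_clm_app (H.dθ hz) dY, zero_apply, eY, H.fderiv_θ hz] at this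
    linarith
  simp only [VectorField.lieBracket, fderiv_clm_app (H.dJ hz) dX, fderiv_clm_app (H.dJ hz) dY,
    eX, eY] at h
  have hJ : ∀ a b, fderiv ℝ J z a b
      = nablaJ θ J z a b - gammaL θ J z a (J z b) + J z (gammaL θ J z a b) := by
    intro a b; simp only [nablaJ]; abel
  have t1 := H.gamma_torsion hz u v
  have t2 := H.gamma_torsion hz (J z u) (J z v)
  have t3 := H.gamma_torsion hz u (J z v)
  have t4 := H.gamma_torsion hz v (J z u)
  rw [tor_horizontal hu hv] at t1
  rw [tor_horizontal (H.θ_J hz u) (H.θ_J hz v)] at t2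
  rw [tor_horizontal hu (H.θ_J hz v)] at t3
  rw [tor_horizontal hv (H.θ_J hz u), levi_swap, H.levi_J hz, neg_neg] at t4
  have t1' := congrArg (J z) t1
  have t2' := congrArg (J z) t2
  rw [map_sub, map_smul, H.J_reeb hz, smul_zero, sub_eq_zero] at t1' t2'
  rw [sub_eq_iff_eq_add] at t3 t4
  simp only [hJ, map_sub, map_add, H.J_J hz, tX, tY] at h ⊢
  rw [t1', t2', t3, t4] at h
  rw [← sub_eq_zero] at h
  refine Eq.trans ?_ h
  module

lemma θ_nablaJ (u v : V) : θ z (nablaJ θ J z u v) = 0 := by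
  have := H.fderiv_θ_J hz u v
  rw [H.fderiv_θ hz] at this
  simp only [nablaJ, map_add, map_sub, H.θ_J hz]
  linarith

lemma nablaJ_reeb (u : V) : nablaJ θ J z u (reebL θ z) = 0 := by
  have h := H.fderiv_J_reeb hz u
  rw [H.fderiv_reeb hz, map_neg, ← sub_eq_add_neg] at h
  rw [nablaJ, H.J_reeb hz, map_zero, add_zero, h]

lemma nablaJ_J (u v : V) : nablaJ θ J z u (J z v) = -J z (nablaJ θ J z u v) := by
  have h := H.fderiv_J_J hz u v
  rw [H.fderiv_θ hz, H.fderiv_reeb hz] at h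
  rw [← eq_sub_iff_add_eq] at h
  simp only [nablaJ, h, map_add, map_sub, H.J_J hz, map_neg, map_smul]
  module

lemma fderiv_levi_eq (u v w : V) : fderiv ℝ (levi θ) z u v w
    = websterL θ J z (nablaJ θ J z u v) w + levi θ z (gammaL θ J z u v) w
      + levi θ z v (gammaL θ J z u w) := by
  have h := congrArg (· u) (fderiv_congr_of_eqOn H.isOpen (fun y hy => H.levi_eq hy v w) hz)
  have d : DifferentiableAt ℝ (fun y => levi θ y v) z :=
    (H.dω hz).clm_apply (differentiableAt_const v)
  simp only [fderiv_clm_app₂ (H.dg hz) ((H.dJ hz).clm_apply (differentiableAt_const v))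
    (differentiableAt_const w), fderiv_clm_app_const d, fderiv_clm_app_const (H.dω hz),
    fderiv_clm_app_const (H.dJ hz), fderiv_fun_const, Pi.zero_apply, zero_apply, map_zero,
    add_zero] at h
  rw [h, H.gamma_metric hz, H.levi_eq hz, H.levi_eq hz, nablaJ]
  simp only [map_add, map_sub, add_apply, sub_apply]
  ring

/-- Since dθ = g(J·, ·) and ∇g = 0, this form is ∇dθ, which is skew because dθ is. -/
lemma g_nablaJ_swap (u v w : V) : websterL θ J z (nablaJ θ J z u v) w
    = -websterL θ J z (nablaJ θ J z u w) v := by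
  have h1 := H.fderiv_levi_eq hz u v w
  have h2 := H.fderiv_levi_eq hz u w v
  rw [H.fderiv_levi_swap hz u w v, levi_swap θ z (gammaL θ J z u w),
    levi_swap θ z w] at h2
  linarith

lemma levi_tau (u v : V) : levi θ z (tauL θ J z u) v = levi θ z (tauL θ J z v) u := by
  rw [H.levi_eq hz, H.levi_eq hz, ← neg_inj, H.g_J hz, H.g_J hz, H.g_tau hz, H.tau_J hz,
    H.g_symm hz _ (J z u), H.g_J hz]
  simp

/-- The identity d(dθ) = 0, written with ∇. As dθ kills T, the torsion enters only through dθ(τ·,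
·), and this form is symmetric, so the torsion terms cancel in the cyclic sum. -/
lemma g_nablaJ_cyclic (u v w : V) : websterL θ J z (nablaJ θ J z u v) w
    + websterL θ J z (nablaJ θ J z v w) u + websterL θ J z (nablaJ θ J z w u) v = 0 := by
  have h := H.fderiv_levi_cyclic hz u v w
  rw [H.fderiv_levi_eq hz, H.fderiv_levi_eq hz, H.fderiv_levi_eq hz] at h
  have key : ∀ a b c, levi θ z (gammaL θ J z a b) c - levi θ z (gammaL θ J z b a) c
      = θ z a * levi θ z (tauL θ J z b) c - θ z b * levi θ z (tauL θ J z a) c := by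
    intro a b c
    rw [← sub_apply, ← map_sub, H.gamma_torsion hz, torL_apply]
    simp [H.levi_reeb hz]
  have k1 := key u v w
  have k2 := key v w u
  have k3 := key w u v
  rw [levi_swap θ z v, levi_swap θ z w (gammaL θ J z v u), levi_swap θ z u] at h
  rw [H.levi_tau hz w v] at k3
  rw [H.levi_tau hz v u, H.levi_tau hz w u] at k2
  linear_combination h - k1 - k2 - k3

/-- The covariant derivative of `J` vanishes. -/
lemma nablaJ_eq_zero (u v : V) : nablaJ θ J z u v = 0 := by
  have add₁ : ∀ a a' b, nablaJ θ J z (a + a') b = nablaJ θ J z a b + nablaJ θ J z a' b := by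
    intro a a' b; simp only [nablaJ, map_add, add_apply]; abel
  have smul₁ : ∀ (c : ℝ) a b, nablaJ θ J z (c • a) b = c • nablaJ θ J z a b := by
    intro c a b; simp only [nablaJ, map_smul, smul_apply]; module
  have add₂ : ∀ a b b', nablaJ θ J z a (b + b') = nablaJ θ J z a b + nablaJ θ J z a b' := by
    intro a a' b; simp only [nablaJ, map_add]; abel
  have smul₂ : ∀ (c : ℝ) a b, nablaJ θ J z a (c • b) = c • nablaJ θ J z a b := by
    intro c a b; simp only [nablaJ, map_smul]; module
  have gJ := H.g_J hz
  have nJ := H.nablaJ_J hz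
  -- The classical argument that an integrable almost Kähler structure is Kähler, carried out on H.
  -- For F = ∇J, the skewness and the cyclic identity of g(F·, ·), the rule F(x, Jy) = -J F(x, y)
  -- and the Nijenhuis identity form a linear system that forces F = 0. The arguments Jc and Ja are
  -- the ones for which it closes; applying J again gives all horizontal arguments.
  have key : ∀ a b c, θ z a = 0 → θ z b = 0 → θ z c = 0 →
      websterL θ J z (nablaJ θ J z (J z c) (J z a)) b = 0 := by
    intro a b c ha hb hc
    set g := websterL θ J z
    set F := nablaJ θ J z
    have n := congrArg (fun x => g x c) (H.nijenhuis hz ha hb)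
    simp only [map_sub, map_add, map_zero, zero_apply, sub_apply, add_apply, gJ] at n
    have FJ : ∀ x y w, g (F x (J z y)) w = g (F x y) (J z w) := by
      intro x y w
      rw [nJ, map_neg, neg_apply, gJ, neg_neg]
    have FJJ : ∀ x y w, θ z w = 0 → g (F x y) (J z (J z w)) = -g (F x y) w := by
      intro x y w hw
      rw [H.J_sq z hz w hw, map_neg]
    have sw := H.g_nablaJ_swap hz
    have cy := H.g_nablaJ_cyclic hz
    have c1 := cy a b c
    have c2 := cy (J z a) b (J z c)
    have c3 := cy (J z b) a (J z c)
    have s1 := sw b a c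
    have e1 : g (F b (J z c)) (J z a) = -g (F b c) a := by rw [FJ, FJJ _ _ _ ha]
    have e2 : g (F a (J z c)) (J z b) = -g (F a c) b := by rw [FJ, FJJ _ _ _ hb]
    have s2 := sw a c b
    have s3 := sw (J z c) (J z b) a
    have e3 : g (F (J z c) a) (J z b) = g (F (J z c) (J z a)) b := (FJ _ _ _).symm
    have s4 := sw (J z c) b (J z a)
    have s5 := sw (J z c) a (J z b)
    linarith
  have hor : ∀ a b, θ z a = 0 → θ z b = 0 → nablaJ θ J z a b = 0 := by
    intro a b ha hb
    refine H.g_ext hz fun w => ?_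
    obtain ⟨c, hc, hw⟩ := H.exists_decomp hz w
    have h := key (J z b) c (J z a) (H.θ_J hz b) hc (H.θ_J hz a)
    rw [H.J_sq z hz a ha, H.J_sq z hz b hb, ← neg_one_smul ℝ a, ← neg_one_smul ℝ b, smul₁,
      smul₂] at h
    rw [hw, map_add, map_smul, H.g_symm hz _ (reebL θ z), H.g_reeb hz, H.θ_nablaJ hz]
    simpa using h
  -- In the cyclic identity with one entry T the two other terms vanish, because ∇J kills T and
  -- takes horizontal values.
  have reeb : ∀ b, nablaJ θ J z (reebL θ z) b = 0 := by
    intro b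
    refine H.g_ext hz fun w => ?_
    have h := H.g_nablaJ_cyclic hz (reebL θ z) b w
    rw [H.nablaJ_reeb hz, H.g_symm hz _ (reebL θ z), H.g_reeb hz, H.θ_nablaJ hz] at h
    simpa using h
  obtain ⟨a, ha, hu⟩ := H.exists_decomp hz u
  obtain ⟨b, hb, hv⟩ := H.exists_decomp hz v
  rw [hu, hv, add₁, add₂, add₂, smul₁, smul₂, smul₂, hor a b ha hb, H.nablaJ_reeb hz]
  simp [reeb, H.nablaJ_reeb hz]

lemma fderiv_J (u v : V) : fderiv ℝ J z u v
    = J z (gammaL θ J z u v) - gammaL θ J z u (J z v) := by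
  have := H.nablaJ_eq_zero hz u v
  rw [nablaJ, sub_eq_zero, ← eq_sub_iff_add_eq] at this
  exact this

lemma fderiv_ω (u v w : V) : fderiv ℝ (levi θ) z u v w
    = levi θ z (gammaL θ J z u v) w + levi θ z v (gammaL θ J z u w) := by
  rw [H.fderiv_levi_eq hz, H.nablaJ_eq_zero hz]; simp

/-- Uniqueness of the Tanaka-Webster connection. -/
lemma eq_gamma {Γ : V →L[ℝ] V →L[ℝ] V}
    (hm : ∀ u v w, fderiv ℝ (websterL θ J) z u v w
      = websterL θ J z (Γ u v) w + websterL θ J z v (Γ u w))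
    (hθ : ∀ u w, fderiv ℝ θ z u w = θ z (Γ u w))
    (hJ : ∀ u v, fderiv ℝ J z u v + Γ u (J z v) = J z (Γ u v))
    (hH : ∀ u v, θ z u = 0 → θ z v = 0 →
      Γ u v - Γ v u = -(websterL θ J z u (J z v)) • reebL θ z)
    (hT : ∀ u, θ z u = 0 → Γ (reebL θ z) (J z u) - Γ (J z u) (reebL θ z)
      = -J z (Γ (reebL θ z) u - Γ u (reebL θ z))) :
    Γ = gammaL θ J z := by
  have hreeb : ∀ u, fderiv ℝ (reebL θ) z u = -Γ u (reebL θ z) := by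
    intro u
    refine H.g_ext hz fun w => ?_
    have h := congrArg (· u) (fderiv_congr_of_eqOn H.isOpen (fun y hy => H.g_reeb hy w) hz)
    simp only [fderiv_clm_app₂ (H.dg hz) (H.dT hz) (differentiableAt_const w),
      fderiv_clm_app_const (H.dθ hz), fderiv_fun_const, Pi.zero_apply, zero_apply, map_zero,
      add_zero] at h
    rw [hm, H.g_reeb hz, hθ] at h
    rw [map_neg, neg_apply]
    linarith
  -- With J and T parallel, L_T J is the commutator of J with u ↦ T_∇(T, u). The torsion axiom makes
  -- these two anticommute, so L_T J = 2 J T_∇(T, ·), which is solved for the torsion.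
  have hτ : ∀ u, θ z u = 0 → Γ (reebL θ z) u - Γ u (reebL θ z) = tauL θ J z u := by
    intro u hu
    have h := hT u hu
    have e := hJ (reebL θ z) u
    rw [← eq_sub_iff_add_eq'] at e
    have e2 := hreeb (J z u)
    have e3 := hreeb u
    have h0 : θ z (Γ (reebL θ z) u - Γ u (reebL θ z)) = 0 := by
      rw [map_sub, ← hθ, ← hθ, ← levi_apply, H.levi_reeb hz]
    have hl : lieJ θ J z u = (2 : ℝ) • J z (Γ (reebL θ z) u - Γ u (reebL θ z)) := by
      have : fderiv ℝ J z (reebL θ z) u = J z (Γ (reebL θ z) u) - Γ (reebL θ z) (J z u) :=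
        eq_sub_iff_add_eq.2 (hJ _ _)
      rw [lieJ_apply, this, e2, e3]
      rw [sub_eq_iff_eq_add] at h
      rw [h]
      simp only [map_sub, map_neg]
      module
    rw [tauL_apply, hl, map_smul, H.J_sq z hz _ h0]
    module
  have htor : ∀ u v, Γ u v - Γ v u = torL θ J z u v := by
    have h1 : ∀ a b, θ z a = 0 → θ z b = 0 → Γ a b - Γ b a = torL θ J z a b := by
      intro a b ha hb
      rw [hH a b ha hb, tor_horizontal ha hb]
      rw [websterL_apply, H.J_J hz, H.θ_J hz, hb]
      simp
    have h2 : ∀ b, θ z b = 0 → Γ (reebL θ z) b - Γ b (reebL θ z) = torL θ J z (reebL θ z) b := by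
      intro b hb
      rw [hτ b hb, H.tor_reeb hz]
    intro u v
    obtain ⟨a, ha, hu⟩ := H.exists_decomp hz u
    obtain ⟨b, hb, hv⟩ := H.exists_decomp hz v
    generalize θ z u = s at hu
    generalize θ z v = t at hv
    subst hu hv
    have k1 := h1 a b ha hb
    have k2 := h2 b hb
    have k3 := h2 a ha
    simp only [map_add, map_smul, add_apply, smul_apply]
    rw [tor_swap z a (reebL θ z), ← k1, ← k2, ← k3]
    have : torL θ J z (reebL θ z) (reebL θ z) = 0 := by
      rw [H.tor_reeb hz, H.tau_reeb hz]
    rw [this]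
    module
  ext u v
  exact eq_christ (H.g_invertible hz) (H.g_symm hz) (fun _ _ => H.g_ext hz) hm htor u v

end LocalCR

/-- The curvature commutes with `J`. -/
lemma LocalCR.curv_J {U : Set V} {θ : V → V →L[ℝ] ℝ} {J : V → V →L[ℝ] V} (H : LocalCR U θ J)
    {z : V} (hz : z ∈ U) (u v w : V) :
    curvL (gammaL θ J) z u v (J z w) = J z (curvL (gammaL θ J) z u v w) := by
  have hJ2 := differentiableAt_of_smoothOn H.isOpen (smoothOn_fderiv H.isOpen H.smooth_J) hz
  have dΓ : DifferentiableAt ℝ (gammaL θ J) z :=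
    differentiableAt_of_smoothOn H.isOpen H.smooth_gamma hz
  -- The derivative of ∂_a J = J Γ_a - Γ_a J. Symmetry of the second derivatives of J then leaves
  -- the commutator of J with the curvature.
  have key : ∀ a b, fderiv ℝ (fderiv ℝ J) z b a w
      = fderiv ℝ J z b (gammaL θ J z a w) + J z (fderiv ℝ (gammaL θ J) z b a w)
        - fderiv ℝ (gammaL θ J) z b a (J z w) - gammaL θ J z a (fderiv ℝ J z b w) := by
    intro a b
    have h := congrArg (· b)
      (fderiv_congr_of_eqOn H.isOpen (fun y hy => H.fderiv_J hy a w) hz)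
    have d1 : DifferentiableAt ℝ (fun y => fderiv ℝ J y a) z :=
      hJ2.clm_apply (differentiableAt_const a)
    have d2 : DifferentiableAt ℝ (fun y => gammaL θ J y a) z :=
      dΓ.clm_apply (differentiableAt_const a)
    have d3 : DifferentiableAt ℝ (fun y => gammaL θ J y a w) z :=
      d2.clm_apply (differentiableAt_const w)
    have d4 : DifferentiableAt ℝ (fun y => J y w) z :=
      (H.dJ hz).clm_apply (differentiableAt_const w)
    simp only [fderiv_clm_app_const d1, fderiv_clm_app_const hJ2] at h
    rw [h, fderiv_fun_sub ((H.dJ hz).clm_apply d3) (d2.clm_apply d4), sub_apply,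
      fderiv_clm_app (H.dJ hz) d3, fderiv_clm_app d2 d4, fderiv_clm_app_const d2,
      fderiv_clm_app_const dΓ, fderiv_clm_app_const (H.dJ hz)]
    abel
  have hs := congrArg (· w) (sndFDeriv_symm H.isOpen H.smooth_J hz u v)
  simp only [key, H.fderiv_J hz, map_sub] at hs
  rw [← sub_eq_zero] at hs ⊢
  simp only [curvL, map_add, map_sub]
  rw [← neg_eq_zero]
  refine Eq.trans ?_ hs
  abel

/-- The first Bianchi identity for horizontal vectors. -/
lemma LocalCR.bianchi {U : Set V} {θ : V → V →L[ℝ] ℝ} {J : V → V →L[ℝ] V} (H : LocalCR U θ J)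
    {z : V} (hz : z ∈ U) {u v w : V} (hu : θ z u = 0) (hv : θ z v = 0) (hw : θ z w = 0) :
    curvL (gammaL θ J) z u v w + curvL (gammaL θ J) z v w u + curvL (gammaL θ J) z w u v
      = levi θ z u v • tauL θ J z w + levi θ z v w • tauL θ J z u
        + levi θ z w u • tauL θ J z v := by
  have dΓ : DifferentiableAt ℝ (gammaL θ J) z :=
    differentiableAt_of_smoothOn H.isOpen H.smooth_gamma hz
  have dτ : DifferentiableAt ℝ (tauL θ J) z :=
    differentiableAt_of_smoothOn H.isOpen H.smooth_tau hz
  have dΓ' : ∀ a b, DifferentiableAt ℝ (fun y => gammaL θ J y a b) z := fun a b =>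
    (dΓ.clm_apply (differentiableAt_const a)).clm_apply (differentiableAt_const b)
  have dτ' : ∀ a, DifferentiableAt ℝ (fun y => tauL θ J y a) z := fun a =>
    dτ.clm_apply (differentiableAt_const a)
  have dθ' : ∀ a, DifferentiableAt ℝ (fun y => θ y a) z := fun a =>
    (H.dθ hz).clm_apply (differentiableAt_const a)
  have dω' : ∀ a b, DifferentiableAt ℝ (fun y => levi θ y a b) z := fun a b =>
    ((H.dω hz).clm_apply (differentiableAt_const a)).clm_apply (differentiableAt_const b)
  have eΓ : ∀ a b c, fderiv ℝ (fun y => gammaL θ J y a b) z c = fderiv ℝ (gammaL θ J) z c a b :=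
    fun a b c => by
      rw [fderiv_clm_app_const (dΓ.clm_apply (differentiableAt_const a)), fderiv_clm_app_const dΓ]
  have eω : ∀ a b c, fderiv ℝ (fun y => levi θ y a b) z c = fderiv ℝ (levi θ) z c a b :=
    fun a b c => by
      rw [fderiv_clm_app_const ((H.dω hz).clm_apply (differentiableAt_const a)),
        fderiv_clm_app_const (H.dω hz)]
  -- The derivative of the torsion equation for constant vectors b, c. The derivatives of τ carry
  -- the factors θ(b), θ(c) and drop out, so no covariant derivative of τ enters the Bianchi
  -- identity.
  have key : ∀ a b c, θ z b = 0 → θ z c = 0 →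
      fderiv ℝ (gammaL θ J) z a b c - fderiv ℝ (gammaL θ J) z a c b
      = (levi θ z (gammaL θ J z a b) c + levi θ z b (gammaL θ J z a c)) • reebL θ z
        - levi θ z b c • gammaL θ J z a (reebL θ z)
        + θ z (gammaL θ J z a b) • tauL θ J z c - θ z (gammaL θ J z a c) • tauL θ J z b := by
    intro a b c hb hc
    have h := congrArg (· a)
      (fderiv_congr_of_eqOn H.isOpen (fun y hy => H.gamma_torsion hy b c) hz)
    simp only [torL_apply] at h
    rw [fderiv_fun_sub (dΓ' b c) (dΓ' c b), fderiv_fun_sub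
      (((dω' b c).fun_smul (H.dT hz)).fun_add ((dθ' b).fun_smul (dτ' c)))
        ((dθ' c).fun_smul (dτ' b)), fderiv_fun_add ((dω' b c).fun_smul (H.dT hz))
      ((dθ' b).fun_smul (dτ' c)), fderiv_fun_smul (dω' b c) (H.dT hz),
      fderiv_fun_smul (dθ' b) (dτ' c), fderiv_fun_smul (dθ' c) (dτ' b)] at h
    simp only [sub_apply, add_apply, smul_apply, eΓ, ContinuousLinearMap.smulRight_apply, eω,
      fderiv_clm_app_const (H.dθ hz), H.fderiv_θ hz, H.fderiv_reeb hz, hb, hc,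
      zero_smul, zero_add, H.fderiv_ω hz] at h
    rw [h]
    module
  have t : ∀ a b, θ z a = 0 → θ z b = 0 → gammaL θ J z a b
      = gammaL θ J z b a + levi θ z a b • reebL θ z := by
    intro a b ha hb
    rw [← tor_horizontal ha hb, ← H.gamma_torsion hz]; abel
  have k1 := key u v w hv hw
  have k2 := key v w u hw hu
  have k3 := key w u v hu hv
  rw [sub_eq_iff_eq_add] at k1 k2 k3
  simp only [curvL]
  rw [k1, k2, k3, t u v hu hv, t v w hv hw, t w u hw hu]
  simp only [map_add, map_smul, add_apply, smul_apply, H.levi_reeb hz, H.θ_reeb hz, smul_eq_mul, mul_zero, add_zero, mul_one]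
  rw [levi_swap θ z w (gammaL θ J z v u), levi_swap θ z u (gammaL θ J z w v),
    levi_swap θ z v (gammaL θ J z u w)]
  module

end LocalTW

/-! ### Vector fields and connections in charts -/

section Charts

variable (k : ℕ) {M : Type*} [TopologicalSpace M] [ChartedSpace (Mod k) M]
  [IsManifold (𝓡 k) ∞ M]

omit [IsManifold (𝓡 k) ∞ M] in
/-- The chart at `p`. -/
abbrev ch (p : M) : PartialEquiv M (Mod k) := extChartAt (𝓡 k) p

/-- The frame of the chart at `p`. -/
def fr (p y : M) : Mod k →L[ℝ] TangentSpace (𝓡 k) y :=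
  (trivializationAt (Mod k) (TangentSpace (𝓡 k)) p).symmL ℝ y

/-- The components of tangent vectors in the chart at `p`. -/
def co (p y : M) : TangentSpace (𝓡 k) y →L[ℝ] Mod k :=
  (trivializationAt (Mod k) (TangentSpace (𝓡 k)) p).continuousLinearMapAt ℝ y

/-- The components of a vector field in the chart at `p`. -/
def rep (p : M) (X : (y : M) → TangentSpace (𝓡 k) y) (z : Mod k) : Mod k :=
  co k p ((ch k p).symm z) (X ((ch k p).symm z))

variable {k}

lemma mem_baseSet_of_mem_source {p y : M} (hy : y ∈ (ch k p).source) :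
    y ∈ (trivializationAt (Mod k) (TangentSpace (𝓡 k) (M := M)) p).baseSet := by
  rw [extChartAt_source] at hy
  simpa using! hy

lemma co_fr {p y : M} (hy : y ∈ (ch k p).source) (a : Mod k) : co k p y (fr k p y a) = a :=
  (trivializationAt (Mod k) (TangentSpace (𝓡 k)) p).continuousLinearMapAt_symmL
    (mem_baseSet_of_mem_source hy) a

lemma fr_co {p y : M} (hy : y ∈ (ch k p).source) (v : TangentSpace (𝓡 k) y) :
    fr k p y (co k p y v) = v :=
  (trivializationAt (Mod k) (TangentSpace (𝓡 k)) p).symmL_continuousLinearMapAt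
    (mem_baseSet_of_mem_source hy) v

lemma co_injective {p y : M} (hy : y ∈ (ch k p).source) : Function.Injective (co k p y) :=
  Function.LeftInverse.injective (fr_co hy)

omit [IsManifold (𝓡 k) ∞ M] in
lemma symm_mem {p : M} {z : Mod k} (hz : z ∈ (ch k p).target) :
    (ch k p).symm z ∈ (ch k p).source := (ch k p).map_target hz

lemma co_eq_mfderiv {p y : M} (hy : y ∈ (ch k p).source) :
    co k p y = mfderiv (𝓡 k) 𝓘(ℝ, Mod k) (ch k p) y :=
  TangentBundle.continuousLinearMapAt_trivializationAt (by rwa [extChartAt_source] at hy)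

lemma fr_eq_mfderiv {p : M} {z : Mod k} (hz : z ∈ (ch k p).target) :
    fr k p ((ch k p).symm z) = mfderiv 𝓘(ℝ, Mod k) (𝓡 k) (ch k p).symm z := by
  have h := TangentBundle.symmL_trivializationAt (I := 𝓡 k) (x₀ := p) (x := (ch k p).symm z)
    (by rw [← extChartAt_source (𝓡 k)]; exact symm_mem hz)
  rw [(ch k p).right_inv hz, (𝓡 k).range_eq_univ, mfderivWithin_univ] at h
  exact h

omit [IsManifold (𝓡 k) ∞ M] in
lemma target_open (p : M) : IsOpen (ch k p).target := isOpen_extChartAt_target p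

omit [IsManifold (𝓡 k) ∞ M] in
lemma source_open (p : M) : IsOpen (ch k p).source := isOpen_extChartAt_source p

omit [IsManifold (𝓡 k) ∞ M] in
lemma map_mem {p y : M} (hy : y ∈ (ch k p).source) : ch k p y ∈ (ch k p).target :=
  (ch k p).map_source hy

lemma contMDiffOn_symm (p : M) : ContMDiffOn 𝓘(ℝ, Mod k) (𝓡 k) ∞ (ch k p).symm (ch k p).target :=
  contMDiffOn_extChartAt_symm p

lemma mdiffAt_symm {p : M} {z : Mod k} (hz : z ∈ (ch k p).target) :
    MDifferentiableAt 𝓘(ℝ, Mod k) (𝓡 k) (ch k p).symm z :=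
  ((contMDiffOn_symm p).contMDiffAt ((target_open p).mem_nhds hz)).mdifferentiableAt (by simp)

lemma contMDiffOn_ch (p : M) : ContMDiffOn (𝓡 k) 𝓘(ℝ, Mod k) ∞ (ch k p) (ch k p).source := by
  rw [extChartAt_source]
  exact contMDiffOn_extChartAt

lemma mdiffAt_ch {p y : M} (hy : y ∈ (ch k p).source) :
    MDifferentiableAt (𝓡 k) 𝓘(ℝ, Mod k) (ch k p) y :=
  ((contMDiffOn_ch p).contMDiffAt ((source_open p).mem_nhds hy)).mdifferentiableAt (by simp)

variable {F : Type*} [NormedAddCommGroup F] [NormedSpace ℝ F]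

lemma contMDiffOn_iff_chart {p : M} {f : M → F} :
    ContMDiffOn (𝓡 k) 𝓘(ℝ, F) ∞ f (ch k p).source ↔
      ContDiffOn ℝ ∞ (fun z => f ((ch k p).symm z)) (ch k p).target := by
  rw [← contMDiffOn_iff_contDiffOn]
  constructor
  · intro h
    exact h.comp (contMDiffOn_symm p) fun z hz => symm_mem hz
  · intro h
    refine (h.comp (contMDiffOn_ch p) fun y hy => map_mem hy).congr fun y hy => ?_
    simp only [Function.comp]
    rw [(ch k p).left_inv hy]

lemma mdiffAt_iff_chart {p y : M} (hy : y ∈ (ch k p).source) {f : M → F} :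
    MDifferentiableAt (𝓡 k) 𝓘(ℝ, F) f y ↔
      DifferentiableAt ℝ (fun z => f ((ch k p).symm z)) (ch k p y) := by
  rw [← mdifferentiableAt_iff_differentiableAt]
  constructor
  · intro h
    refine MDifferentiableAt.comp (ch k p y) ?_ (mdiffAt_symm (map_mem hy))
    rwa [(ch k p).left_inv hy]
  · intro h
    have h2 := h.comp y (mdiffAt_ch hy)
    refine h2.congr_of_eventuallyEq (Filter.eventually_of_mem ((source_open p).mem_nhds hy)
      fun y' hy' => ?_)
    simp only [Function.comp]
    rw [(ch k p).left_inv hy']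

lemma mvfderiv_chart {p y : M} (hy : y ∈ (ch k p).source) {f : M → F}
    (hf : MDifferentiableAt (𝓡 k) 𝓘(ℝ, F) f y) (v : TangentSpace (𝓡 k) y) :
    mvfderiv (𝓡 k) f y v = fderiv ℝ (fun z => f ((ch k p).symm z)) (ch k p y) (co k p y v) := by
  have hd := (mdiffAt_iff_chart hy).1 hf
  have e : f =ᶠ[𝓝 y] (fun z => f ((ch k p).symm z)) ∘ ch k p :=
    Filter.eventually_of_mem ((source_open p).mem_nhds hy) fun y' hy' => by
      simp only [Function.comp]
      rw [(ch k p).left_inv hy']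
  have h1 : mfderiv (𝓡 k) 𝓘(ℝ, F) f y = _ := e.mfderiv_eq
  rw [mfderiv_comp y hd.mdifferentiableAt (mdiffAt_ch hy), ← co_eq_mfderiv hy,
    mfderiv_eq_fderiv] at h1
  exact congrArg (fun L => L v) h1

lemma diffFieldAt_iff {p y : M} (hy : y ∈ (ch k p).source)
    {X : (y : M) → TangentSpace (𝓡 k) y} :
    DiffFieldAt X y ↔ DifferentiableAt ℝ (rep k p X) (ch k p y) := by
  have h1 := (trivializationAt (Mod k) (TangentSpace (𝓡 k) (M := M)) p).mdifferentiableAt_section_iff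
    (𝓡 k) X (mem_baseSet_of_mem_source hy)
  rw [DiffFieldAt, h1, mdiffAt_iff_chart hy]
  refine Filter.EventuallyEq.differentiableAt_iff
    (Filter.eventually_of_mem ((target_open p).mem_nhds (map_mem hy)) fun z hz => ?_)
  simp only [rep, co]
  rw [Bundle.Trivialization.continuousLinearMapAt_apply_of_mem ℝ _
    (mem_baseSet_of_mem_source (symm_mem hz))]

lemma smoothFieldOn_iff {p : M} {X : (y : M) → TangentSpace (𝓡 k) y} :
    SmoothFieldOn X (ch k p).source ↔ ContDiffOn ℝ ∞ (rep k p X) (ch k p).target := by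
  have h1 : SmoothFieldOn X (ch k p).source ↔ ContMDiffOn (𝓡 k) 𝓘(ℝ, Mod k) ∞
      (fun y => (trivializationAt (Mod k) (TangentSpace (𝓡 k) (M := M)) p ⟨y, X y⟩).2)
      (ch k p).source := by
    constructor
    · intro h y hy
      exact (((trivializationAt (Mod k) (TangentSpace (𝓡 k) (M := M)) p).contMDiffAt_section_iff
        (mem_baseSet_of_mem_source hy)).1
          (h.contMDiffAt ((source_open p).mem_nhds hy))).contMDiffWithinAt
    · intro h y hy
      exact (((trivializationAt (Mod k) (TangentSpace (𝓡 k) (M := M)) p).contMDiffAt_section_iff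
        (mem_baseSet_of_mem_source hy)).2
          (h.contMDiffAt ((source_open p).mem_nhds hy))).contMDiffWithinAt
  rw [h1, contMDiffOn_iff_chart]
  refine contDiffOn_congr fun z hz => ?_
  simp only [rep, co]
  rw [Bundle.Trivialization.continuousLinearMapAt_apply_of_mem ℝ _
    (mem_baseSet_of_mem_source (symm_mem hz))]

lemma rep_fr {p : M} (X : Mod k → Mod k) {z : Mod k} (hz : z ∈ (ch k p).target) :
    rep k p (fun y => fr k p y (X (ch k p y))) z = X z := by
  rw [rep, co_fr (symm_mem hz), (ch k p).right_inv hz]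

lemma rep_fr_const {p : M} (a : Mod k) {z : Mod k} (hz : z ∈ (ch k p).target) :
    rep k p (fun y => fr k p y a) z = a := rep_fr (fun _ => a) hz

lemma rep_fr_const_eventually {p : M} (a : Mod k) {z : Mod k} (hz : z ∈ (ch k p).target) :
    rep k p (fun y => fr k p y a) =ᶠ[𝓝 z] fun _ => a :=
  Filter.eventually_of_mem ((target_open p).mem_nhds hz) fun _ hz' => rep_fr_const a hz'

lemma smoothFieldOn_fr {p : M} {X : Mod k → Mod k} (hX : ContDiffOn ℝ ∞ X (ch k p).target) :
    SmoothFieldOn (fun y => fr k p y (X (ch k p y))) (ch k p).source :=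
  smoothFieldOn_iff.2 (hX.congr fun _ hz => rep_fr X hz)

lemma diffFieldAt_fr {p y : M} (hy : y ∈ (ch k p).source) (a : Mod k) :
    DiffFieldAt (fun y => fr k p y a) y :=
  (diffFieldAt_iff hy).2 ((differentiableAt_const a).congr_of_eventuallyEq
    (rep_fr_const_eventually a (map_mem hy)))

/-- Throughout the chart at x the extension has constant components, so its derivatives and brackets
in that chart are trivial. -/
lemma extv_eq_fr {x y : M} (hy : y ∈ (ch k x).source) (u : TangentSpace (𝓡 k) x) :
    extv u y = fr k x y (co k x x u) := by
  simp only [extv, FiberBundle.extend, fr, co]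
  rw [Bundle.Trivialization.continuousLinearMapAt_apply_of_mem ℝ _
    (mem_baseSet_of_mem_source (mem_extChartAt_source (I := 𝓡 k) x))]
  exact (Bundle.Trivialization.symmₗ_apply _ (mem_baseSet_of_mem_source hy) _).symm

lemma rep_extv {x : M} (u : TangentSpace (𝓡 k) x) {z : Mod k} (hz : z ∈ (ch k x).target) :
    rep k x (extv u) z = co k x x u := by
  rw [rep, extv_eq_fr (symm_mem hz), co_fr (symm_mem hz)]

lemma extv_self {x : M} (u : TangentSpace (𝓡 k) x) : extv u x = u :=
  FiberBundle.extend_apply_self (Mod k) u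

lemma diffFieldAt_extv {x : M} (u : TangentSpace (𝓡 k) x) : DiffFieldAt (extv u) x := by
  refine (diffFieldAt_fr (mem_extChartAt_source (I := 𝓡 k) x) (co k x x u)).congr_of_eventuallyEq
    (Filter.eventually_of_mem ((source_open x).mem_nhds (mem_extChartAt_source (I := 𝓡 k) x))
      fun y hy => ?_)
  exact congrArg (Bundle.TotalSpace.mk y) (extv_eq_fr hy u)

/-- The bracket is natural under pull-back by the inverse chart, and this pull-back is the passage
to components. -/
lemma co_mlieBracket {p y : M} (hy : y ∈ (ch k p).source) {X Y : (y : M) → TangentSpace (𝓡 k) y}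
    (hX : DiffFieldAt X y) (hY : DiffFieldAt Y y) :
    co k p y (VectorField.mlieBracket (𝓡 k) X Y y)
      = VectorField.lieBracket ℝ (rep k p X) (rep k p Y) (ch k p y) := by
  have hz := map_mem hy
  have key : ∀ (Z : (y : M) → TangentSpace (𝓡 k) y) (z), z ∈ (ch k p).target →
      VectorField.mpullback 𝓘(ℝ, Mod k) (𝓡 k) (ch k p).symm Z z = rep k p Z z := by
    intro Z z hz
    rw [VectorField.mpullback_apply, ← fr_eq_mfderiv hz, rep]
    have : (fr k p ((ch k p).symm z)).inverse = co k p ((ch k p).symm z) := by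
      apply ContinuousLinearMap.inverse_eq
      · ext1 v; exact fr_co (symm_mem hz) v
      · ext1 v; exact co_fr (symm_mem hz) v
    exact congrArg (fun L => L (Z ((ch k p).symm z))) this
  have e : ∀ Z : (y : M) → TangentSpace (𝓡 k) y,
      VectorField.mpullback 𝓘(ℝ, Mod k) (𝓡 k) (ch k p).symm Z =ᶠ[𝓝 (ch k p y)] rep k p Z :=
    fun Z => Filter.eventually_of_mem ((target_open p).mem_nhds hz) (key Z)
  have hxy := (ch k p).left_inv hy
  have hm : IsManifold (𝓡 k) (minSmoothness ℝ 2) M := IsManifold.of_le (n := ∞)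
    (by simp only [minSmoothness_of_isRCLikeNormedField]
        exact WithTop.coe_le_coe.2 (le_top : (2 : ℕ∞) ≤ ⊤))
  have h := VectorField.mpullback_mlieBracket (I := 𝓘(ℝ, Mod k)) (I' := 𝓡 k) (n := ∞)
    (f := (ch k p).symm) (V := X) (W := Y) (x₀ := ch k p y) (by rwa [hxy]) (by rwa [hxy])
    ((contMDiffOn_symm p).contMDiffAt ((target_open p).mem_nhds hz))
    (by simp only [minSmoothness_of_isRCLikeNormedField]
        exact WithTop.coe_le_coe.2 (le_top : (2 : ℕ∞) ≤ ⊤))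
  rw [key _ _ hz, (e X).mlieBracket_vectorField_eq (e Y)] at h
  have h2 := congrFun (VectorField.mlieBracketWithin_eq_lieBracketWithin (𝕜 := ℝ)
    (V := rep k p X) (W := rep k p Y) (s := Set.univ)) (ch k p y)
  rw [VectorField.lieBracketWithin_univ] at h2
  rw [rep, hxy] at h
  exact h.trans h2

/-! #### Connections in charts -/

/-- The Christoffel symbols at `y` of the connection `D` in the chart at `p`. -/
def chrAt (D : Conn k M) (p y : M) : Mod k →L[ℝ] Mod k →L[ℝ] Mod k :=
  (∑ i, (EuclideanSpace.proj i : Mod k →L[ℝ] ℝ).smulRight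
    ((co k p y).comp ((D (fun y => fr k p y (EuclideanSpace.single i 1)) y).comp
      (fr k p y)))).flip

/-- The Christoffel symbols of the connection `D` in the chart at `p`. -/
def chr (D : Conn k M) (p : M) (z : Mod k) : Mod k →L[ℝ] Mod k →L[ℝ] Mod k :=
  chrAt D p ((ch k p).symm z)

variable {D : Conn k M}

/-- The definition of `chrAt` samples the standard basis only, in order to be a bilinear operator
for an arbitrary `D`; for a genuine connection, linearity in v recovers all values. -/
lemma chr_apply (hD : IsCovariantDerivativeOn (Mod k) D) {p y : M} (hy : y ∈ (ch k p).source)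
    (u v : Mod k) :
    chr D p (ch k p y) u v = co k p y (D (fun y => fr k p y v) y (fr k p y u)) := by
  let L : Mod k →ₗ[ℝ] Mod k :=
    { toFun := fun v => co k p y (D (fun y => fr k p y v) y (fr k p y u))
      map_add' := fun a b => by
        have h := hD.add (diffFieldAt_fr hy a) (diffFieldAt_fr hy b)
        have e : (fun y => fr k p y (a + b)) = (fun y => fr k p y a) + fun y => fr k p y b := by
          funext y; simp
        rw [e, h]; simp
      map_smul' := fun c a => by
        have h := hD.smul_const c (diffFieldAt_fr hy a)
        have e : (fun y => fr k p y (c • a)) = c • fun y => fr k p y a := by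
          funext y; simp
        rw [e, h]; simp }
  change _ = L v
  have hv : v = ∑ i, v i • EuclideanSpace.single i (1 : ℝ) := by
    simpa using ((EuclideanSpace.basisFun (Fin k) ℝ).sum_repr v).symm
  conv_rhs => rw [hv, map_sum]
  rw [chr, (ch k p).left_inv hy]
  simp only [map_smul, chrAt, ContinuousLinearMap.flip_apply, sum_apply,
    ContinuousLinearMap.smulRight_apply, smul_apply]
  rfl

lemma rep_smul (p : M) (f : M → ℝ) (X : (y : M) → TangentSpace (𝓡 k) y) :
    rep k p (f • X) = fun z => f ((ch k p).symm z) • rep k p X z := by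
  funext z; simp [rep]

lemma rep_add (p : M) (X Y : (y : M) → TangentSpace (𝓡 k) y) :
    rep k p (X + Y) = fun z => rep k p X z + rep k p Y z := by
  funext z; simp [rep]

lemma rep_ch {p y : M} (hy : y ∈ (ch k p).source) (X : (y : M) → TangentSpace (𝓡 k) y) :
    rep k p X (ch k p y) = co k p y (X y) := by
  rw [rep, (ch k p).left_inv hy]

/-- A connection in the chart at `p`. -/
lemma co_conn (hD : IsCovariantDerivativeOn (Mod k) D) {p y : M} (hy : y ∈ (ch k p).source)
    {X : (y : M) → TangentSpace (𝓡 k) y} (hX : DiffFieldAt X y) (v : TangentSpace (𝓡 k) y) :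
    co k p y (D X y v) = fderiv ℝ (rep k p X) (ch k p y) (co k p y v)
      + chr D p (ch k p y) (co k p y v) (co k p y (X y)) := by
  -- The difference between D and the flat derivative is tensorial in X, so X may be replaced by the
  -- field of the chart frame with the same value at y.
  let Φ : ((y : M) → TangentSpace (𝓡 k) y) → Mod k := fun X =>
    co k p y (D X y v) - fderiv ℝ (rep k p X) (ch k p y) (co k p y v)
  have hΦ : TensorialAt (𝓡 k) (Mod k) Φ y := by
    constructor
    · intro f X hf hX
      have d1 := (mdiffAt_iff_chart hy).1 hf
      have d2 := (diffFieldAt_iff hy).1 hX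
      simp only [Φ]
      rw [hD.leibniz hX hf, rep_smul, fderiv_fun_smul d1 d2]
      simp only [add_apply, smul_apply, map_add, map_smul, ContinuousLinearMap.smulRight_apply,
        mvfderiv_chart hy hf, rep_ch hy, (ch k p).left_inv hy]
      module
    · intro X Y hX hY
      have d1 := (diffFieldAt_iff hy).1 hX
      have d2 := (diffFieldAt_iff hy).1 hY
      simp only [Φ]
      rw [hD.add hX hY, rep_add, fderiv_fun_add d1 d2]
      simp only [add_apply, map_add]
      abel
  have h := hΦ.pointwise hX (diffFieldAt_fr hy (co k p y (X y))) (fr_co hy _).symm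
  simp only [Φ] at h
  rw [(rep_fr_const_eventually _ (map_mem hy)).fderiv_eq, fderiv_fun_const] at h
  rw [chr_apply hD hy, fr_co hy, sub_eq_iff_eq_add] at *
  rw [h]
  simp [add_comm]

/-- The torsion is tensorial, so it may be computed with chart frame fields at p, whose brackets
vanish. -/
lemma co_torsion (hD : IsCovariantDerivativeOn (Mod k) D) {p y : M} (hy : y ∈ (ch k p).source)
    (u v : TangentSpace (𝓡 k) y) :
    co k p y (torsion D y u v) = chr D p (ch k p y) (co k p y u) (co k p y v)
      - chr D p (ch k p y) (co k p y v) (co k p y u) := by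
  have : IsManifold (𝓡 k) 2 M := IsManifold.of_le (n := ∞)
    (WithTop.coe_le_coe.2 (le_top : (2 : ℕ∞) ≤ ⊤))
  have h1 := hD.torsion_apply_eq_extend u v
  have h2 := hD.torsion_apply (diffFieldAt_fr hy (co k p y u)) (diffFieldAt_fr hy (co k p y v))
  rw [fr_co hy, fr_co hy, h1] at h2
  rw [torsion, h2, map_sub, map_sub, co_mlieBracket hy (diffFieldAt_fr hy _) (diffFieldAt_fr hy _),
    chr_apply hD hy, chr_apply hD hy, fr_co hy, fr_co hy, VectorField.lieBracket,
    (rep_fr_const_eventually _ (map_mem hy)).fderiv_eq,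
    (rep_fr_const_eventually _ (map_mem hy)).fderiv_eq]
  simp

end Charts

/-! ### Tensors and connections in charts -/

section ChartTensors

variable {k : ℕ} {M : Type*} [TopologicalSpace M] [ChartedSpace (Mod k) M]
  [IsManifold (𝓡 k) ∞ M]

omit [IsManifold (𝓡 k) ∞ M] in
lemma contMDiffOn_of_trivial {f : M → ℝ} {s : Set M}
    (hf : ContMDiffOn (𝓡 k) ((𝓡 k).prod 𝓘(ℝ, ℝ)) ∞
      (fun y => Bundle.TotalSpace.mk' ℝ (E := Bundle.Trivial M ℝ) y (f y)) s) :
    ContMDiffOn (𝓡 k) 𝓘(ℝ, ℝ) ∞ f s := by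
  intro y hy
  have := hf y hy
  simp only [Bundle.contMDiffWithinAt_totalSpace] at this
  exact this.2

/-- A one-form in the chart at `p`. -/
def formL (ξ : (x : M) → TangentSpace (𝓡 k) x →L[ℝ] ℝ) (p : M) (z : Mod k) : Mod k →L[ℝ] ℝ :=
  (ξ ((ch k p).symm z)).comp (fr k p ((ch k p).symm z))

/-- An endomorphism field in the chart at `p`. -/
def endL (A : (x : M) → TangentSpace (𝓡 k) x →L[ℝ] TangentSpace (𝓡 k) x) (p : M) (z : Mod k) :
    Mod k →L[ℝ] Mod k :=
  (co k p ((ch k p).symm z)).comp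
    ((A ((ch k p).symm z)).comp (fr k p ((ch k p).symm z)))

lemma formL_co (ξ : (x : M) → TangentSpace (𝓡 k) x →L[ℝ] ℝ) {p y : M}
    (hy : y ∈ (ch k p).source) (u : TangentSpace (𝓡 k) y) :
    formL ξ p (ch k p y) (co k p y u) = ξ y u := by
  rw [formL, (ch k p).left_inv hy, ContinuousLinearMap.comp_apply, fr_co hy]

lemma endL_co (A : (x : M) → TangentSpace (𝓡 k) x →L[ℝ] TangentSpace (𝓡 k) x) {p y : M}
    (hy : y ∈ (ch k p).source) (u : TangentSpace (𝓡 k) y) :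
    endL A p (ch k p y) (co k p y u) = co k p y (A y u) := by
  rw [endL, (ch k p).left_inv hy, ContinuousLinearMap.comp_apply, ContinuousLinearMap.comp_apply,
    fr_co hy]

lemma formL_rep (ξ : (x : M) → TangentSpace (𝓡 k) x →L[ℝ] ℝ) {p : M}
    (X : (y : M) → TangentSpace (𝓡 k) y) {z : Mod k} (hz : z ∈ (ch k p).target) :
    ξ ((ch k p).symm z) (X ((ch k p).symm z)) = formL ξ p z (rep k p X z) := by
  rw [rep, formL, ContinuousLinearMap.comp_apply, fr_co (symm_mem hz)]

lemma endL_rep (A : (x : M) → TangentSpace (𝓡 k) x →L[ℝ] TangentSpace (𝓡 k) x) {p : M}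
    (X : (y : M) → TangentSpace (𝓡 k) y) {z : Mod k} (hz : z ∈ (ch k p).target) :
    rep k p (fun y => A y (X y)) z = endL A p z (rep k p X z) := by
  rw [rep, rep, endL, ContinuousLinearMap.comp_apply, ContinuousLinearMap.comp_apply,
    fr_co (symm_mem hz)]

lemma smoothFieldOn_fr_const (p : M) (a : Mod k) :
    SmoothFieldOn (fun y => fr k p y a) (ch k p).source :=
  smoothFieldOn_fr (X := fun _ => a) contDiffOn_const

lemma smoothOn_formL {ξ : (x : M) → TangentSpace (𝓡 k) x →L[ℝ] ℝ}
    (hξ : ContMDiff (𝓡 k) ((𝓡 k).prod 𝓘(ℝ, Mod k →L[ℝ] ℝ)) ∞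
      (fun x => Bundle.TotalSpace.mk' (Mod k →L[ℝ] ℝ)
        (E := fun x : M => TangentSpace (𝓡 k) x →L[ℝ] Bundle.Trivial M ℝ x) x (ξ x))) (p : M) :
    ContDiffOn ℝ ∞ (formL ξ p) (ch k p).target := by
  refine smoothOn_clm_iff.2 fun a => ?_
  have h : ContMDiffOn (𝓡 k) ((𝓡 k).prod 𝓘(ℝ, ℝ)) ∞
      (fun y => Bundle.TotalSpace.mk' ℝ (E := Bundle.Trivial M ℝ) y (ξ y (fr k p y a)))
      (ch k p).source :=
    ContMDiffOn.clm_bundle_apply (F₁ := Mod k) (hξ.contMDiffOn) (smoothFieldOn_fr_const p a)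
  exact contMDiffOn_iff_chart.1 (contMDiffOn_of_trivial h)

lemma smoothOn_endL {A : (x : M) → TangentSpace (𝓡 k) x →L[ℝ] TangentSpace (𝓡 k) x}
    (hA : ContMDiff (𝓡 k) ((𝓡 k).prod 𝓘(ℝ, Mod k →L[ℝ] Mod k)) ∞
      (fun x => Bundle.TotalSpace.mk' (Mod k →L[ℝ] Mod k)
        (E := fun x : M => TangentSpace (𝓡 k) x →L[ℝ] TangentSpace (𝓡 k) x) x (A x))) (p : M) :
    ContDiffOn ℝ ∞ (endL A p) (ch k p).target := by
  refine smoothOn_clm_iff.2 fun a => ?_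
  have h : SmoothFieldOn (fun y => A y (fr k p y a)) (ch k p).source :=
    ContMDiffOn.clm_bundle_apply (F₁ := Mod k) (hA.contMDiffOn) (smoothFieldOn_fr_const p a)
  exact smoothFieldOn_iff.1 h

/-- The exterior derivative of a one-form in a chart. -/
lemma extDerivOne_chart {ξ : (x : M) → TangentSpace (𝓡 k) x →L[ℝ] ℝ} {p y : M}
    (hξ : ContDiffOn ℝ ∞ (formL ξ p) (ch k p).target)
    (hy : y ∈ (ch k p).source) (u v : TangentSpace (𝓡 k) y) :
    extDerivOne ξ y u v = levi (formL ξ p) (ch k p y) (co k p y u) (co k p y v) := by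
  have hz := map_mem hy
  have dξ : DifferentiableAt ℝ (formL ξ p) (ch k p y) :=
    differentiableAt_of_smoothOn (target_open p) hξ hz
  have dX : ∀ w : TangentSpace (𝓡 k) y, DifferentiableAt ℝ (rep k p (extv w)) (ch k p y) :=
    fun w => (diffFieldAt_iff hy).1 (diffFieldAt_extv w)
  have ev : ∀ w : TangentSpace (𝓡 k) y,
      (fun z => ξ ((ch k p).symm z) (extv w ((ch k p).symm z))) =ᶠ[𝓝 (ch k p y)]
        fun z => formL ξ p z (rep k p (extv w) z) := fun w =>
    Filter.eventually_of_mem ((target_open p).mem_nhds hz) fun z hz => formL_rep ξ _ hz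
  have key : ∀ w v' : TangentSpace (𝓡 k) y, mvfderiv (𝓡 k) (fun y => ξ y (extv w y)) y v'
      = fderiv ℝ (formL ξ p) (ch k p y) (co k p y v') (co k p y w)
        + formL ξ p (ch k p y) (fderiv ℝ (rep k p (extv w)) (ch k p y) (co k p y v')) := by
    intro w v'
    have hd : MDifferentiableAt (𝓡 k) 𝓘(ℝ, ℝ) (fun y => ξ y (extv w y)) y :=
      (mdiffAt_iff_chart hy).2 ((dξ.clm_apply (dX w)).congr_of_eventuallyEq (ev w))
    rw [mvfderiv_chart hy hd, (ev w).fderiv_eq, fderiv_clm_app dξ (dX w), rep_ch hy, extv_self]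
  rw [extDerivOne, key, key, ← formL_co ξ hy, co_mlieBracket hy (diffFieldAt_extv u)
    (diffFieldAt_extv v), VectorField.lieBracket, map_sub, levi_apply, rep_ch hy, rep_ch hy,
    extv_self, extv_self]
  ring

/-- The derivative of a bilinear form evaluated at two vector fields, in a chart. -/
lemma mvfderiv_bilin {g : (x : M) → TangentSpace (𝓡 k) x → TangentSpace (𝓡 k) x → ℝ} {p y : M}
    (hy : y ∈ (ch k p).source) {G : Mod k → Mod k →L[ℝ] Mod k →L[ℝ] ℝ}
    (hG : ∀ y ∈ (ch k p).source, ∀ u v, g y u v = G (ch k p y) (co k p y u) (co k p y v))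
    (dG : DifferentiableAt ℝ G (ch k p y)) {X Y : (y : M) → TangentSpace (𝓡 k) y}
    (hX : DiffFieldAt X y) (hY : DiffFieldAt Y y) (v : TangentSpace (𝓡 k) y) :
    mvfderiv (𝓡 k) (fun y => g y (X y) (Y y)) y v
      = fderiv ℝ G (ch k p y) (co k p y v) (co k p y (X y)) (co k p y (Y y))
        + G (ch k p y) (fderiv ℝ (rep k p X) (ch k p y) (co k p y v)) (co k p y (Y y))
        + G (ch k p y) (co k p y (X y)) (fderiv ℝ (rep k p Y) (ch k p y) (co k p y v)) := by
  have dX := (diffFieldAt_iff hy).1 hX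
  have dY := (diffFieldAt_iff hy).1 hY
  have ev : (fun z => g ((ch k p).symm z) (X ((ch k p).symm z)) (Y ((ch k p).symm z)))
      =ᶠ[𝓝 (ch k p y)] fun z => G z (rep k p X z) (rep k p Y z) :=
    Filter.eventually_of_mem ((target_open p).mem_nhds (map_mem hy)) fun z hz => by
      simp only [hG _ (symm_mem hz), (ch k p).right_inv hz, rep]
  have hd : MDifferentiableAt (𝓡 k) 𝓘(ℝ, ℝ) (fun y => g y (X y) (Y y)) y :=
    (mdiffAt_iff_chart hy).2 (((dG.clm_apply dX).clm_apply dY).congr_of_eventuallyEq ev)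
  rw [mvfderiv_chart hy hd, ev.fderiv_eq, fderiv_clm_app₂ dG dX dY, rep_ch hy, rep_ch hy]

/-- The derivative of a one-form evaluated at a vector field, in a chart. -/
lemma mvfderiv_form {ξ : (x : M) → TangentSpace (𝓡 k) x →L[ℝ] ℝ} {p y : M}
    (hy : y ∈ (ch k p).source) (dξ : DifferentiableAt ℝ (formL ξ p) (ch k p y))
    {X : (y : M) → TangentSpace (𝓡 k) y} (hX : DiffFieldAt X y) (v : TangentSpace (𝓡 k) y) :
    mvfderiv (𝓡 k) (fun y => ξ y (X y)) y v
      = fderiv ℝ (formL ξ p) (ch k p y) (co k p y v) (co k p y (X y))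
        + formL ξ p (ch k p y) (fderiv ℝ (rep k p X) (ch k p y) (co k p y v)) := by
  have dX := (diffFieldAt_iff hy).1 hX
  have ev : (fun z => ξ ((ch k p).symm z) (X ((ch k p).symm z)))
      =ᶠ[𝓝 (ch k p y)] fun z => formL ξ p z (rep k p X z) :=
    Filter.eventually_of_mem ((target_open p).mem_nhds (map_mem hy)) fun z hz => formL_rep ξ X hz
  have hd : MDifferentiableAt (𝓡 k) 𝓘(ℝ, ℝ) (fun y => ξ y (X y)) y :=
    (mdiffAt_iff_chart hy).2 ((dξ.clm_apply dX).congr_of_eventuallyEq ev)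
  rw [mvfderiv_chart hy hd, ev.fderiv_eq, fderiv_clm_app dξ dX, rep_ch hy]

lemma rep_end_eventually (A : (x : M) → TangentSpace (𝓡 k) x →L[ℝ] TangentSpace (𝓡 k) x) {p : M}
    (X : (y : M) → TangentSpace (𝓡 k) y) {z : Mod k} (hz : z ∈ (ch k p).target) :
    rep k p (fun y => A y (X y)) =ᶠ[𝓝 z] fun z => endL A p z (rep k p X z) :=
  Filter.eventually_of_mem ((target_open p).mem_nhds hz) fun _ hz => endL_rep A X hz

lemma diffFieldAt_end {A : (x : M) → TangentSpace (𝓡 k) x →L[ℝ] TangentSpace (𝓡 k) x} {p y : M}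
    (hy : y ∈ (ch k p).source) (dA : DifferentiableAt ℝ (endL A p) (ch k p y))
    {X : (y : M) → TangentSpace (𝓡 k) y} (hX : DiffFieldAt X y) :
    DiffFieldAt (fun y => A y (X y)) y :=
  (diffFieldAt_iff hy).2 ((dA.clm_apply ((diffFieldAt_iff hy).1 hX)).congr_of_eventuallyEq
    (rep_end_eventually A X (map_mem hy)))

/-- The connection with given Christoffel symbols at `x` in the chart at `x`, for every `x`. -/
def jetConn (Γ : M → Mod k →L[ℝ] Mod k →L[ℝ] Mod k) : Conn k M := fun X x =>
  (fr k x x).comp ((fderiv ℝ (rep k x X) (ch k x x)).comp (co k x x)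
    + ((Γ x).flip (co k x x (X x))).comp (co k x x))

variable {Γ : M → Mod k →L[ℝ] Mod k →L[ℝ] Mod k}

lemma co_jetConn (X : (y : M) → TangentSpace (𝓡 k) y) (x : M) (v : TangentSpace (𝓡 k) x) :
    co k x x (jetConn Γ X x v) = fderiv ℝ (rep k x X) (ch k x x) (co k x x v)
      + Γ x (co k x x v) (co k x x (X x)) :=
  co_fr (mem_extChartAt_source (I := 𝓡 k) x) _

/-- The axioms of a connection are conditions at one point at a time and ask for no smooth
dependence on it. So the symbols at x may be taken in the chart at x, and existence needs no gluing.
-/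
lemma jetConn_cov : IsCovariantDerivativeOn (Mod k) (jetConn Γ) where
  add {X Y x} hX hY _ := by
    have hx := mem_extChartAt_source (I := 𝓡 k) x
    ext1 v
    apply co_injective hx
    have d1 := (diffFieldAt_iff hx).1 hX
    have d2 := (diffFieldAt_iff hx).1 hY
    rw [co_jetConn, rep_add, fderiv_fun_add d1 d2, add_apply (jetConn Γ X x), map_add (co k x x),
      co_jetConn, co_jetConn, Pi.add_apply, map_add, map_add, add_apply]
    abel
  leibniz {X f x} hX hf _ := by
    have hx := mem_extChartAt_source (I := 𝓡 k) x
    ext1 v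
    apply co_injective hx
    have d1 := (diffFieldAt_iff hx).1 hX
    have d2 := (mdiffAt_iff_chart hx).1 hf
    rw [co_jetConn, rep_smul, fderiv_fun_smul d2 d1]
    simp only [add_apply, smul_apply, map_add, map_smul, ContinuousLinearMap.smulRight_apply,
      mvfderiv_chart hx hf, rep_ch hx, (ch k x).left_inv hx, co_jetConn, Pi.smul_apply']
    module

lemma chr_jetConn (x : M) : chr (jetConn Γ) x (ch k x x) = Γ x := by
  have hx := mem_extChartAt_source (I := 𝓡 k) x
  ext1 u
  ext1 v
  rw [chr_apply jetConn_cov hx, co_jetConn,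
    (rep_fr_const_eventually v (map_mem hx)).fderiv_eq, fderiv_fun_const, co_fr hx, co_fr hx]
  simp

lemma co_torsion_jetConn (x : M) (u v : TangentSpace (𝓡 k) x) :
    co k x x (torsion (jetConn Γ) x u v)
      = Γ x (co k x x u) (co k x x v) - Γ x (co k x x v) (co k x x u) := by
  rw [co_torsion jetConn_cov (mem_extChartAt_source (I := 𝓡 k) x), chr_jetConn]

/-- The Christoffel symbols of a metric connection. -/
lemma chr_metric {D : Conn k M} (hD : IsCovariantDerivativeOn (Mod k) D)
    {g : (x : M) → TangentSpace (𝓡 k) x → TangentSpace (𝓡 k) x → ℝ} (hm : IsMetricConn D g)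
    {p y : M} (hy : y ∈ (ch k p).source) {G : Mod k → Mod k →L[ℝ] Mod k →L[ℝ] ℝ}
    (hG : ∀ y ∈ (ch k p).source, ∀ u v, g y u v = G (ch k p y) (co k p y u) (co k p y v))
    (dG : DifferentiableAt ℝ G (ch k p y)) (u v w : Mod k) :
    fderiv ℝ G (ch k p y) u v w = G (ch k p y) (chr D p (ch k p y) u v) w
      + G (ch k p y) v (chr D p (ch k p y) u w) := by
  have h := hm y _ _ (diffFieldAt_fr hy v) (diffFieldAt_fr hy w) (fr k p y u)
  rw [mvfderiv_bilin hy hG dG (diffFieldAt_fr hy v) (diffFieldAt_fr hy w),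
    (rep_fr_const_eventually _ (map_mem hy)).fderiv_eq,
    (rep_fr_const_eventually _ (map_mem hy)).fderiv_eq, hG y hy, hG y hy,
    ← chr_apply hD hy, ← chr_apply hD hy] at h
  simpa [co_fr hy] using h

lemma jetConn_metric {g : (x : M) → TangentSpace (𝓡 k) x → TangentSpace (𝓡 k) x → ℝ}
    (G : M → Mod k → Mod k →L[ℝ] Mod k →L[ℝ] ℝ)
    (hG : ∀ p, ∀ y ∈ (ch k p).source, ∀ u v, g y u v = G p (ch k p y) (co k p y u) (co k p y v))
    (dG : ∀ p, DifferentiableAt ℝ (G p) (ch k p p))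
    (hΓ : ∀ p u v w, fderiv ℝ (G p) (ch k p p) u v w = G p (ch k p p) (Γ p u v) w
      + G p (ch k p p) v (Γ p u w)) : IsMetricConn (jetConn Γ) g := by
  intro x X Y hX hY v
  have hx := mem_extChartAt_source (I := 𝓡 k) x
  rw [mvfderiv_bilin hx (hG x) (dG x) hX hY, hΓ, hG x x hx, hG x x hx, co_jetConn, co_jetConn]
  simp only [map_add, add_apply]
  ring

end ChartTensors

/-! ### The Levi-Civita connection -/

section LeviCivita

variable {n : ℕ} {N : Type*} [TopologicalSpace N] [ChartedSpace (Mod n) N]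
  [IsManifold (𝓡 n) ∞ N] (h : Metric n N)

/-- A Riemannian metric in the chart at `p`. -/
def metL (p : N) (z : Mod n) : Mod n →L[ℝ] Mod n →L[ℝ] ℝ :=
  LinearMap.toContinuousBilinearMap <|
    LinearMap.mk₂ ℝ (fun u v => h.inner ((ch n p).symm z) (fr n p ((ch n p).symm z) u)
        (fr n p ((ch n p).symm z) v))
      (fun u u' v => by simp only [map_add, add_apply])
      (fun c u v => by simp only [map_smul, smul_apply])
      (fun u v v' => by simp only [map_add])
      (fun c u v => by simp only [map_smul])

variable {h} in
lemma metL_apply {p : N} {z : Mod n} (u v : Mod n) : metL h p z u v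
    = h.inner ((ch n p).symm z) (fr n p ((ch n p).symm z) u) (fr n p ((ch n p).symm z) v) := rfl

lemma metL_co {p y : N} (hy : y ∈ (ch n p).source) (u v : TangentSpace (𝓡 n) y) :
    h.inner y u v = metL h p (ch n p y) (co n p y u) (co n p y v) := by
  rw [metL_apply, (ch n p).left_inv hy, fr_co hy, fr_co hy]

lemma smoothOn_metL (p : N) : ContDiffOn ℝ ∞ (metL h p) (ch n p).target := by
  refine smoothOn_clm_iff.2 fun a => smoothOn_clm_iff.2 fun b => ?_
  have h : ContMDiffOn (𝓡 n) ((𝓡 n).prod 𝓘(ℝ, ℝ)) ∞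
      (fun y => Bundle.TotalSpace.mk' ℝ (E := Bundle.Trivial N ℝ) y
        (h.inner y (fr n p y a) (fr n p y b))) (ch n p).source :=
    ContMDiffOn.clm_bundle_apply₂ (F₁ := Mod n) (F₂ := Mod n) (h.contMDiff.contMDiffOn)
      (smoothFieldOn_fr_const p a) (smoothFieldOn_fr_const p b)
  exact contMDiffOn_iff_chart.1 (contMDiffOn_of_trivial h)

variable {h} {p : N} {z : Mod n}

lemma metL_symm (u v : Mod n) : metL h p z u v = metL h p z v u := by
  rw [metL_apply, h.symm]; rfl

lemma metL_pos (hz : z ∈ (ch n p).target) {u : Mod n} (hu : u ≠ 0) : 0 < metL h p z u u := by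
  rw [metL_apply]
  refine h.pos _ _ fun h0 => hu ?_
  rw [← co_fr (symm_mem hz) u, h0, map_zero]

lemma metL_invertible (hz : z ∈ (ch n p).target) : (metL h p z).IsInvertible :=
  isInvertible_of_injective fun v hv => by
    by_contra h
    exact (metL_pos hz h).ne' (hv v)

lemma metL_ext (hz : z ∈ (ch n p).target) {u v : Mod n}
    (h' : ∀ w, metL h p z u w = metL h p z v w) : u = v := by
  by_contra hne
  have := metL_pos (h := h) hz (sub_ne_zero.2 hne)
  rw [map_sub (metL h p z), sub_apply, h', sub_self] at this
  exact this.false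

lemma dmetL (hz : z ∈ (ch n p).target) : DifferentiableAt ℝ (metL h p) z :=
  differentiableAt_of_smoothOn (target_open p) (smoothOn_metL h p) hz

lemma fderiv_metL_symm (hz : z ∈ (ch n p).target) (u v w : Mod n) :
    fderiv ℝ (metL h p) z u v w = fderiv ℝ (metL h p) z u w v := by
  have h1 := fderiv_congr_of_eqOn (target_open p) (fun y _ => metL_symm (h := h) (p := p) (z := y) v w) hz
  have := congrArg (· u) h1
  have d : ∀ a, DifferentiableAt ℝ (fun y => metL h p y a) z := fun a =>
    (dmetL hz).clm_apply (differentiableAt_const a)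
  simpa only [fderiv_clm_app_const (d _), fderiv_clm_app_const (dmetL hz)] using this

/-- The Christoffel symbols of the Levi-Civita connection in the chart at `p`. -/
def lcL (h : Metric n N) (p : N) (z : Mod n) : Mod n →L[ℝ] Mod n →L[ℝ] Mod n :=
  christ (fderiv ℝ (metL h p) z) (metL h p z) 0

lemma smoothOn_lcL (p : N) : ContDiffOn ℝ ∞ (lcL h p) (ch n p).target :=
  smoothOn_christ (smoothOn_fderiv (target_open p) (smoothOn_metL h p)) (smoothOn_metL h p)
    contDiffOn_const fun _ hz => metL_invertible hz

lemma lcL_metric (hz : z ∈ (ch n p).target) (u v w : Mod n) : fderiv ℝ (metL h p) z u v w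
    = metL h p z (lcL h p z u v) w + metL h p z v (lcL h p z u w) :=
  christ_metric (metL_invertible hz) metL_symm (fderiv_metL_symm hz) (by simp) u v w

lemma lcL_symm (hz : z ∈ (ch n p).target) (u v : Mod n) : lcL h p z u v = lcL h p z v u := by
  have := christ_torsion (A := fderiv ℝ (metL h p) z) (metL_invertible (h := h) hz)
    (fderiv_metL_symm hz) (τ := 0) (by simp) (fun _ _ => metL_ext hz) u v
  rw [← sub_eq_zero]
  exact this

variable (h)

lemma isLeviCivita_jetConn : IsLeviCivita h (jetConn fun p => lcL h p (ch n p p)) where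
  cov := jetConn_cov
  metric := jetConn_metric (metL h) (fun _ _ hy _ _ => metL_co h hy _ _)
    (fun p => dmetL (mem_extChartAt_target (I := 𝓡 n) p))
    fun p => lcL_metric (mem_extChartAt_target (I := 𝓡 n) p)
  torsion_free y u v := by
    apply co_injective (mem_extChartAt_source (I := 𝓡 n) y)
    rw [co_torsion_jetConn, lcL_symm (mem_extChartAt_target (I := 𝓡 n) y), sub_self, map_zero]

lemma isLeviCivita_leviCivita : IsLeviCivita h (leviCivita h) := by
  have H : ∃ D : Conn n N, IsLeviCivita h D := ⟨_, isLeviCivita_jetConn h⟩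
  rw [leviCivita, dif_pos H]
  exact H.choose_spec

/-- The chosen connection is known only through its axioms; uniqueness in the Koszul formula gives
its symbols in every chart, and with them their smoothness. -/
lemma chr_leviCivita {y : N} (hy : y ∈ (ch n p).source) :
    chr (leviCivita h) p (ch n p y) = lcL h p (ch n p y) := by
  have H := isLeviCivita_leviCivita h
  have hz := map_mem hy
  ext1 u
  ext1 v
  refine eq_christ (metL_invertible hz) metL_symm (fun _ _ => metL_ext hz)
    (chr_metric H.cov H.metric hy (fun y hy u v => metL_co h hy u v) (dmetL hz)) (fun u v => ?_) u v
  have := co_torsion H.cov hy (fr n p y u) (fr n p y v)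
  rw [H.torsion_free, map_zero, co_fr hy, co_fr hy] at this
  simpa using this.symm

end LeviCivita

/-! ### The Tanaka-Webster connection -/

namespace StrictlyPseudoconvexCR

variable {m : ℕ} {M : Type*} [TopologicalSpace M] [ChartedSpace (Mod (2 * m + 1)) M]
  [IsManifold (𝓡 (2 * m + 1)) ∞ M] (S : StrictlyPseudoconvexCR m M) (p : M)

/-- `θ` in the chart at `p`. -/
abbrev thL : Mod (2 * m + 1) → Mod (2 * m + 1) →L[ℝ] ℝ := formL S.θ p

/-- `J` in the chart at `p`. -/
abbrev JL : Mod (2 * m + 1) → Mod (2 * m + 1) →L[ℝ] Mod (2 * m + 1) := endL S.J p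

lemma smooth_thL : ContDiffOn ℝ ∞ (S.thL p) (ch _ p).target := smoothOn_formL S.smooth_θ p

lemma smooth_JL : ContDiffOn ℝ ∞ (S.JL p) (ch _ p).target := smoothOn_endL S.smooth_J p

lemma localCR : LocalCR (ch (2 * m + 1) p).target (S.thL p) (S.JL p) := by
  have key : ∀ z ∈ (ch (2 * m + 1) p).target, ∃ y ∈ (ch (2 * m + 1) p).source,
      z = ch _ p y := fun z hz => ⟨_, symm_mem hz, ((ch _ p).right_inv hz).symm⟩
  have surj : ∀ y ∈ (ch (2 * m + 1) p).source, ∀ v, ∃ u, v = co _ p y u := fun y hy v =>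
    ⟨_, (co_fr hy v).symm⟩
  refine ⟨target_open p, S.smooth_thL p, S.smooth_JL p, ?_, ?_, ?_, ?_, ?_, ?_⟩
  · intro z hz h0
    obtain ⟨y, hy, rfl⟩ := key z hz
    refine S.θ_ne_zero y (ContinuousLinearMap.ext fun u => ?_)
    rw [← formL_co S.θ hy]
    exact congrArg (fun L => L (co _ p y u)) h0
  · intro z hz v hv
    obtain ⟨y, hy, rfl⟩ := key z hz
    obtain ⟨u, rfl⟩ := surj y hy v
    rw [formL_co S.θ hy] at hv
    rw [endL_co S.J hy, formL_co S.θ hy, S.J_mem y u hv]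
  · intro z hz v hv
    obtain ⟨y, hy, rfl⟩ := key z hz
    obtain ⟨u, rfl⟩ := surj y hy v
    rw [formL_co S.θ hy] at hv
    rw [endL_co S.J hy, endL_co S.J hy, S.J_sq y u hv, map_neg]
  · intro z hz v hv
    obtain ⟨y, hy, rfl⟩ := key z hz
    obtain ⟨u, rfl⟩ := surj y hy v
    rw [endL_co S.J hy, S.J_radical y u fun w => ?_, map_zero]
    rw [extDerivOne_chart (S.smooth_thL p) hy, hv]
  · intro z hz v hv hv0
    obtain ⟨y, hy, rfl⟩ := key z hz
    obtain ⟨u, rfl⟩ := surj y hy v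
    rw [formL_co S.θ hy] at hv
    rw [endL_co S.J hy, ← extDerivOne_chart (S.smooth_thL p) hy]
    exact S.pos y u hv fun h => hv0 (by rw [h, map_zero])
  · intro X Y hX hY hX0 hY0 z hz
    obtain ⟨y, hy, rfl⟩ := key z hz
    have sX := smoothFieldOn_fr hX
    have sY := smoothFieldOn_fr hY
    have hθ : ∀ W : Mod (2 * m + 1) → Mod (2 * m + 1),
        (∀ z ∈ (ch (2 * m + 1) p).target, S.thL p z (W z) = 0) →
        ∀ x ∈ (ch (2 * m + 1) p).source, S.θ x (fr _ p x (W (ch _ p x))) = 0 := fun W hW x hx => by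
      rw [← formL_co S.θ hx, co_fr hx, hW _ (map_mem hx)]
    have h := S.integrable (ch _ p).source (source_open p) _ _ sX sY (hθ X hX0) (hθ Y hY0) y hy
    have dJ := differentiableAt_of_smoothOn (target_open p) (S.smooth_JL p) (map_mem hy)
    have dX : DiffFieldAt (fun x => fr _ p x (X (ch _ p x))) y :=
      (sX.contMDiffAt ((source_open p).mem_nhds hy)).mdifferentiableAt (by simp)
    have dY : DiffFieldAt (fun x => fr _ p x (Y (ch _ p x))) y :=
      (sY.contMDiffAt ((source_open p).mem_nhds hy)).mdifferentiableAt (by simp)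
    have dJX := diffFieldAt_end hy dJ dX
    have dJY := diffFieldAt_end hy dJ dY
    have e : ∀ W : Mod (2 * m + 1) → Mod (2 * m + 1),
        rep _ p (fun x => fr _ p x (W (ch _ p x))) =ᶠ[𝓝 (ch _ p y)] W := fun W =>
      Filter.eventually_of_mem ((target_open p).mem_nhds (map_mem hy)) fun z hz => rep_fr W hz
    have eJ : ∀ W : Mod (2 * m + 1) → Mod (2 * m + 1),
        rep _ p (fun x => S.J x (fr _ p x (W (ch _ p x)))) =ᶠ[𝓝 (ch _ p y)]
          fun z => S.JL p z (W z) := fun W =>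
      Filter.eventually_of_mem ((target_open p).mem_nhds (map_mem hy)) fun z hz => by
        rw [endL_rep S.J _ hz, rep_fr W hz]
    obtain ⟨h1, h2⟩ := h
    have h2' := congrArg (co _ p y) h2
    rw [← formL_co S.θ hy, map_sub, co_mlieBracket hy dX dY, co_mlieBracket hy dJX dJY,
      (e X).lieBracket_vectorField_eq (e Y), (eJ X).lieBracket_vectorField_eq (eJ Y)] at h1
    rw [← endL_co S.J hy, map_sub, map_add, co_mlieBracket hy dX dY, co_mlieBracket hy dJX dJY,
      co_mlieBracket hy dJX dY, co_mlieBracket hy dX dJY,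
      (e X).lieBracket_vectorField_eq (e Y), (eJ X).lieBracket_vectorField_eq (eJ Y),
      (eJ X).lieBracket_vectorField_eq (e Y), (e X).lieBracket_vectorField_eq (eJ Y)] at h2'
    exact ⟨h1, h2'⟩

variable {p} {y : M} (hy : y ∈ (ch (2 * m + 1) p).source)
include hy

lemma dθ_chart (u v : TangentSpace (𝓡 (2 * m + 1)) y) :
    S.dθ y u v = levi (S.thL p) (ch _ p y) (co _ p y u) (co _ p y v) :=
  extDerivOne_chart (S.smooth_thL p) hy u v

lemma co_reeb : co _ p y (S.reeb y) = reebL (S.thL p) (ch _ p y) := by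
  have H := S.localCR p
  have hz := map_mem hy
  have hex : ∃ v, S.θ y v = 1 ∧ ∀ w, S.dθ y v w = 0 := by
    refine ⟨fr _ p y (reebL (S.thL p) (ch _ p y)), ?_, fun w => ?_⟩
    · rw [← formL_co S.θ hy, co_fr hy, H.θ_reeb hz]
    · rw [S.dθ_chart hy, co_fr hy, H.levi_reeb hz]
  have hs := Classical.epsilon_spec hex
  refine H.eq_reebL hz ?_ fun w => ?_
  · rw [formL_co S.θ hy]; exact hs.1
  · rw [← co_fr hy w, ← S.dθ_chart hy]; exact hs.2 _

lemma webster_chart (u v : TangentSpace (𝓡 (2 * m + 1)) y) :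
    S.webster y u v = websterL (S.thL p) (S.JL p) (ch _ p y) (co _ p y u) (co _ p y v) := by
  have H := S.localCR p
  have hz := map_mem hy
  rw [webster, S.dθ_chart hy, ← endL_co S.J hy, projH, projH, map_sub, map_sub, map_smul, map_smul,
    websterL_apply, formL_co S.θ hy, formL_co S.θ hy, S.co_reeb hy, map_sub (co _ p y),
    map_smul (co _ p y), S.co_reeb hy, map_sub (endL S.J p _), map_smul (endL S.J p _), H.J_reeb hz]
  simp only [map_sub, map_smul, sub_apply, smul_apply, H.levi_reeb hz, smul_zero, sub_zero]

omit hy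

lemma isTanakaWebster_jetConn : S.IsTanakaWebster
    (jetConn fun p => gammaL (S.thL p) (S.JL p) (ch _ p p)) := by
  have par : ∀ (x : M) (X : (y : M) → TangentSpace (𝓡 (2 * m + 1)) y),
    DiffFieldAt X x → ∀ v, mvfderiv (𝓡 (2 * m + 1)) (fun y => S.θ y (X y)) x v
      = S.θ x (jetConn (fun p => gammaL (S.thL p) (S.JL p) (ch _ p p)) X x v) := by
    intro x X hX v
    have hx := mem_extChartAt_source (I := 𝓡 (2 * m + 1)) x
    have H := S.localCR x
    rw [mvfderiv_form hx (H.dθ (map_mem hx)) hX, ← formL_co S.θ hx (jetConn _ X x v), co_jetConn,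
      H.fderiv_θ (map_mem hx), map_add, add_comm]
  refine ⟨jetConn_cov, ?_, ?_, ?_, par, ?_, ?_⟩
  · intro x X hX h0 v
    rw [← par x X hX v]
    have : (fun y => S.θ y (X y)) = fun _ => 0 := funext h0
    rw [this]
    have hx := mem_extChartAt_source (I := 𝓡 (2 * m + 1)) x
    rw [mvfderiv_chart hx mdifferentiableAt_const]
    simp
  · exact jetConn_metric (fun p => websterL (S.thL p) (S.JL p))
      (fun _ _ hy _ _ => S.webster_chart hy _ _)
      (fun p => (S.localCR p).dg (mem_extChartAt_target (I := 𝓡 (2 * m + 1)) p))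
      fun p => (S.localCR p).gamma_metric (mem_extChartAt_target (I := 𝓡 (2 * m + 1)) p)
  · intro x X hX v
    have hx := mem_extChartAt_source (I := 𝓡 (2 * m + 1)) x
    have H := S.localCR x
    apply co_injective hx
    rw [co_jetConn, (rep_end_eventually S.J X (map_mem hx)).fderiv_eq,
      fderiv_clm_app (H.dJ (map_mem hx)) ((diffFieldAt_iff hx).1 hX), ← endL_co S.J hx,
      ← endL_co S.J hx, co_jetConn, rep_ch hx, H.fderiv_J (map_mem hx), map_add]
    abel
  · intro x u v hu hv
    have hx := mem_extChartAt_source (I := 𝓡 (2 * m + 1)) x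
    have H := S.localCR x
    rw [← formL_co S.θ hx] at hu hv
    apply co_injective hx
    rw [co_torsion_jetConn, H.gamma_torsion (map_mem hx), LocalCR.tor_horizontal hu hv, map_smul, S.co_reeb hx,
      S.webster_chart hx, ← endL_co S.J hx, websterL_apply, H.J_J (map_mem hx), H.θ_J (map_mem hx), hv]
    simp
  · intro x u hu
    have hx := mem_extChartAt_source (I := 𝓡 (2 * m + 1)) x
    have H := S.localCR x
    apply co_injective hx
    rw [map_neg, ← endL_co S.J hx, co_torsion_jetConn, co_torsion_jetConn, S.co_reeb hx,
      ← endL_co S.J hx, H.gamma_torsion (map_mem hx), H.gamma_torsion (map_mem hx),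
      H.tor_reeb (map_mem hx), H.tor_reeb (map_mem hx), H.tau_J (map_mem hx)]

lemma isTanakaWebster_tanakaWebster : S.IsTanakaWebster S.tanakaWebster := by
  have H : ∃ D : Conn (2 * m + 1) M, S.IsTanakaWebster D := ⟨_, S.isTanakaWebster_jetConn⟩
  rw [tanakaWebster, dif_pos H]
  exact H.choose_spec

include hy

/-- As for the Levi-Civita connection: the axioms, read in any chart around y and not only the one
centred there, determine the symbols by `LocalCR.eq_gamma`. -/
lemma chr_tanakaWebster :
    chr S.tanakaWebster p (ch _ p y) = gammaL (S.thL p) (S.JL p) (ch _ p y) := by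
  have W := S.isTanakaWebster_tanakaWebster
  have H := S.localCR p
  have hz := map_mem hy
  have tor : ∀ u v, chr S.tanakaWebster p (ch _ p y) u v - chr S.tanakaWebster p (ch _ p y) v u
      = co _ p y (torsion S.tanakaWebster y (fr _ p y u) (fr _ p y v)) := fun u v => by
    rw [co_torsion W.cov hy, co_fr hy, co_fr hy]
  refine H.eq_gamma hz (chr_metric W.cov W.metric hy (fun y hy u v => S.webster_chart hy u v)
    (H.dg hz)) ?_ ?_ ?_ ?_
  · intro u w
    have h := W.parallel_θ y _ (diffFieldAt_fr hy w) (fr _ p y u)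
    rw [mvfderiv_form hy (H.dθ hz) (diffFieldAt_fr hy w),
      (rep_fr_const_eventually _ hz).fderiv_eq, ← formL_co S.θ hy, ← chr_apply W.cov hy] at h
    simpa [co_fr hy] using h
  · intro u v
    have h := congrArg (co _ p y) (W.parallel_J y _ (diffFieldAt_fr hy v) (fr _ p y u))
    have e : rep _ p (fun x => S.J x (fr _ p x v)) =ᶠ[𝓝 (ch _ p y)] fun z => S.JL p z v :=
      Filter.eventually_of_mem ((target_open p).mem_nhds hz) fun z hz => by
        rw [endL_rep S.J _ hz, rep_fr_const v hz]
    rw [co_conn W.cov hy (diffFieldAt_end hy (H.dJ hz) (diffFieldAt_fr hy v)), ← endL_co S.J hy,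
      ← endL_co S.J hy, ← chr_apply W.cov hy, co_fr hy, co_fr hy, e.fderiv_eq,
      fderiv_clm_app_const (H.dJ hz)] at h
    exact h
  · intro u v hu hv
    rw [tor, W.torsion_H y _ _ (by rw [← formL_co S.θ hy, co_fr hy, hu])
      (by rw [← formL_co S.θ hy, co_fr hy, hv]), map_smul, S.co_reeb hy, S.webster_chart hy,
      ← endL_co S.J hy, co_fr hy, co_fr hy]
  · intro u hu
    have h := congrArg (co _ p y) (W.torsion_T y (fr _ p y u)
      (by rw [← formL_co S.θ hy, co_fr hy, hu]))
    rw [co_torsion W.cov hy, map_neg, ← endL_co S.J hy, ← endL_co S.J hy, co_torsion W.cov hy,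
      S.co_reeb hy, co_fr hy] at h
    exact h

lemma co_torsion_tanakaWebster (u v : TangentSpace (𝓡 (2 * m + 1)) y) :
    co _ p y (torsion S.tanakaWebster y u v)
      = torL (S.thL p) (S.JL p) (ch _ p y) (co _ p y u) (co _ p y v) := by
  rw [co_torsion S.isTanakaWebster_tanakaWebster.cov hy, S.chr_tanakaWebster hy,
    (S.localCR p).gamma_torsion (map_mem hy)]

lemma pseudoTorsion_chart (u v : TangentSpace (𝓡 (2 * m + 1)) y) : S.pseudoTorsion y u v
    = websterL (S.thL p) (S.JL p) (ch _ p y) (tauL (S.thL p) (S.JL p) (ch _ p y) (co _ p y u))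
      (co _ p y v) := by
  rw [pseudoTorsion, S.webster_chart hy, S.co_torsion_tanakaWebster hy, S.co_reeb hy,
    (S.localCR p).tor_reeb (map_mem hy)]

end StrictlyPseudoconvexCR

/-! ### Maps in charts -/

section MapsInCharts

variable {k n : ℕ} {M : Type*} [TopologicalSpace M] [ChartedSpace (Mod k) M]
  [IsManifold (𝓡 k) ∞ M] {N : Type*} [TopologicalSpace N] [ChartedSpace (Mod n) N]
  [IsManifold (𝓡 n) ∞ N] (φ : M → N)

variable (k n) in
/-- The map `φ` in the charts at `p` and `q`. -/
def lm (p : M) (q : N) (z : Mod k) : Mod n := ch n q (φ ((ch k p).symm z))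

variable (k n) in
/-- The domain of `φ` in the charts at `p` and `q`. -/
def ov (p : M) (q : N) : Set (Mod k) :=
  (ch k p).target ∩ (fun z => φ ((ch k p).symm z)) ⁻¹' (ch n q).source

/-- A section of `φ⁻¹TN` in the charts at `p` and `q`. -/
def repS (p : M) (q : N) (s : (x : M) → TangentSpace (𝓡 n) (φ x)) (z : Mod k) : Mod n :=
  co n q (φ ((ch k p).symm z)) (s ((ch k p).symm z))

variable {φ} (hφ : ContMDiff (𝓡 k) (𝓡 n) ∞ φ) {p : M} {q : N}

omit [IsManifold (𝓡 k) ∞ M] [IsManifold (𝓡 n) ∞ N] in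
include hφ in
lemma isOpen_ov : IsOpen (ov k n φ p q) :=
  (hφ.continuous.comp_continuousOn (continuousOn_extChartAt_symm p)).isOpen_inter_preimage
    (target_open p) (source_open q)

include hφ in
lemma smoothOn_lm : ContDiffOn ℝ ∞ (lm k n φ p q) (ov k n φ p q) := by
  rw [← contMDiffOn_iff_contDiffOn]
  refine (contMDiffOn_ch q).comp (hφ.comp_contMDiffOn ((contMDiffOn_symm p).mono ?_)) ?_
  · exact Set.inter_subset_left
  · exact fun z hz => hz.2

omit [IsManifold (𝓡 k) ∞ M] [IsManifold (𝓡 n) ∞ N] in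
lemma mem_ov {y : M} (hy : y ∈ (ch k p).source) (hq : φ y ∈ (ch n q).source) :
    ch k p y ∈ ov k n φ p q :=
  ⟨map_mem hy, by simpa only [Set.mem_preimage, (ch k p).left_inv hy] using hq⟩

omit [IsManifold (𝓡 k) ∞ M] [IsManifold (𝓡 n) ∞ N] in
lemma lm_ch {y : M} (hy : y ∈ (ch k p).source) : lm k n φ p q (ch k p y) = ch n q (φ y) := by
  rw [lm, (ch k p).left_inv hy]

omit [IsManifold (𝓡 k) ∞ M] in
lemma repS_ch {y : M} (hy : y ∈ (ch k p).source) (s : (x : M) → TangentSpace (𝓡 n) (φ x)) :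
    repS φ p q s (ch k p y) = co n q (φ y) (s y) := by
  rw [repS, (ch k p).left_inv hy]

include hφ

/-- The differential of `φ` in charts. -/
lemma co_mfderiv {y : M} (hy : y ∈ (ch k p).source) (hq : φ y ∈ (ch n q).source)
    (v : TangentSpace (𝓡 k) y) :
    co n q (φ y) (mfderiv (𝓡 k) (𝓡 n) φ y v) = fderiv ℝ (lm k n φ p q) (ch k p y) (co k p y v) := by
  have hd : MDifferentiableAt (𝓡 k) (𝓡 n) φ y := hφ.mdifferentiableAt (by simp)
  have hc : MDifferentiableAt (𝓡 k) 𝓘(ℝ, Mod n) (ch n q ∘ φ) y := (mdiffAt_ch hq).comp y hd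
  have h := mvfderiv_chart hy hc v
  have h2 := mfderiv_comp y (mdiffAt_ch hq) hd
  rw [co_eq_mfderiv hq]
  exact (congrArg (fun L => L v) h2).symm.trans h

/-- The change of charts for sections of `φ⁻¹TN`. -/
lemma repS_eq_fderiv_transition {q' : N} (s : (x : M) → TangentSpace (𝓡 n) (φ x)) {z : Mod k}
    (hz : z ∈ ov k n φ p q) (hz' : z ∈ ov k n φ p q') :
    repS φ p q' s z = fderiv ℝ (lm n n (id : N → N) q q') (lm k n φ p q z) (repS φ p q s z) := by
  have h := co_mfderiv (φ := (id : N → N)) contMDiff_id (p := q) (q := q')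
    (y := φ ((ch k p).symm z)) hz.2 hz'.2 (s ((ch k p).symm z))
  rw [mfderiv_id] at h
  exact h

lemma lm_mem_ov_id {q' : N} {z : Mod k} (hz : z ∈ ov k n φ p q) (hz' : z ∈ ov k n φ p q') :
    lm k n φ p q z ∈ ov n n (id : N → N) q q' :=
  mem_ov (φ := (id : N → N)) hz.2 hz'.2

lemma differentiableAt_lm {z : Mod k} (hz : z ∈ ov k n φ p q) : DifferentiableAt ℝ (lm k n φ p q) z :=
  differentiableAt_of_smoothOn (isOpen_ov hφ) (smoothOn_lm hφ) hz

lemma differentiableAt_transition {q' : N} {z : Mod k} (hz : z ∈ ov k n φ p q) (hz' : z ∈ ov k n φ p q') :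
    DifferentiableAt ℝ (fun z => fderiv ℝ (lm n n (id : N → N) q q') (lm k n φ p q z)) z :=
  (differentiableAt_of_smoothOn (isOpen_ov contMDiff_id) (smoothOn_fderiv (isOpen_ov contMDiff_id)
    (smoothOn_lm contMDiff_id)) (lm_mem_ov_id hφ hz hz')).comp z (differentiableAt_lm hφ hz)

lemma repS_eventually {q' : N} (s : (x : M) → TangentSpace (𝓡 n) (φ x)) {z : Mod k}
    (hz : z ∈ ov k n φ p q) (hz' : z ∈ ov k n φ p q') :
    repS φ p q' s =ᶠ[𝓝 z]
      fun z => fderiv ℝ (lm n n (id : N → N) q q') (lm k n φ p q z) (repS φ p q s z) :=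
  Filter.eventually_of_mem (Filter.inter_mem ((isOpen_ov hφ).mem_nhds hz)
    ((isOpen_ov hφ).mem_nhds hz')) fun _ h => repS_eq_fderiv_transition hφ s h.1 h.2

lemma differentiableAt_repS_change {q' : N} {s : (x : M) → TangentSpace (𝓡 n) (φ x)} {z : Mod k}
    (hz : z ∈ ov k n φ p q) (hz' : z ∈ ov k n φ p q') (hs : DifferentiableAt ℝ (repS φ p q s) z) :
    DifferentiableAt ℝ (repS φ p q' s) z :=
  ((differentiableAt_transition hφ hz hz').clm_apply hs).congr_of_eventuallyEq
    (repS_eventually hφ s hz hz')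

/-- The pull-back connection in charts. -/
lemma co_pullbackConn {D : Conn n N} (hD : IsCovariantDerivativeOn (Mod n) D) {y : M}
    (hy : y ∈ (ch k p).source) (hq : φ y ∈ (ch n q).source)
    {s : (x : M) → TangentSpace (𝓡 n) (φ x)} (hs : DifferentiableAt ℝ (repS φ p q s) (ch k p y))
    (v : TangentSpace (𝓡 k) y) :
    co n q (φ y) (pullbackConn D φ s y v) = fderiv ℝ (repS φ p q s) (ch k p y) (co k p y v)
      + chr D q (ch n q (φ y)) (fderiv ℝ (lm k n φ p q) (ch k p y) (co k p y v))
        (co n q (φ y) (s y)) := by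
  have h0 : φ y ∈ (ch n (φ y)).source := mem_extChartAt_source (I := 𝓡 n) (φ y)
  set q₀ := φ y with hq₀
  have hz := mem_ov hy hq
  have hz₀ : ch k p y ∈ ov k n φ p q₀ := mem_ov hy h0
  have hs₀ := differentiableAt_repS_change hφ hz hz₀ hs
  have dA := differentiableAt_transition hφ hz₀ hz
  have e1 : (fun z => (trivializationAt (Mod n) (fun y : N => TangentSpace (𝓡 n) y) q₀
      ⟨φ ((ch k p).symm z), s ((ch k p).symm z)⟩).2) =ᶠ[𝓝 (ch k p y)] repS φ p q₀ s :=
    Filter.eventually_of_mem ((isOpen_ov hφ).mem_nhds hz₀) fun z hz => by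
      rw [repS, co, Bundle.Trivialization.continuousLinearMapAt_apply_of_mem ℝ _
        (mem_baseSet_of_mem_source hz.2)]
  have e2 : mvfderiv (𝓡 k) (fun x => (trivializationAt (Mod n) (fun y : N => TangentSpace (𝓡 n) y)
      q₀ ⟨φ x, s x⟩).2) y v = fderiv ℝ (repS φ p q₀ s) (ch k p y) (co k p y v) := by
    rw [mvfderiv_chart hy ((mdiffAt_iff_chart hy).2 (hs₀.congr_of_eventuallyEq e1)),
      e1.fderiv_eq]
  have e3 : (trivializationAt (Mod n) (fun y : N => TangentSpace (𝓡 n) y) q₀).symm q₀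
      = fr n q₀ q₀ := by
    funext w
    exact (Bundle.Trivialization.symmₗ_apply _ (mem_baseSet_of_mem_source h0) _).symm
  have e4 : ∀ w, co n q q₀ (fr n q₀ q₀ w)
      = fderiv ℝ (lm n n (id : N → N) q₀ q) (lm k n φ p q₀ (ch k p y)) w := by
    intro w
    have h := co_mfderiv (φ := (id : N → N)) contMDiff_id (p := q₀) (q := q) (y := q₀) h0 hq
      (fr n q₀ q₀ w)
    rw [mfderiv_id, co_fr h0] at h
    rw [lm_ch hy]
    exact h
  -- The extension of s(y) is constant in the chart at φ(y), so in the chart at q its components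
  -- along φ are the transition matrix applied to a constant vector. Its derivative is the part of
  -- the product rule `e6` in which the matrix is differentiated; the first summand of
  -- `pullbackConn` supplies the other part.
  have e5 : fderiv ℝ (rep n q (extv (s y))) (ch n q q₀) (fderiv ℝ (lm k n φ p q) (ch k p y) (co k p y v))
      = fderiv ℝ (fun z => fderiv ℝ (lm n n (id : N → N) q₀ q) (lm k n φ p q₀ z)) (ch k p y) (co k p y v)
        (repS φ p q₀ s (ch k p y)) := by
    have ev : (fun z => rep n q (extv (s y)) (lm k n φ p q z)) =ᶠ[𝓝 (ch k p y)]
        fun z => fderiv ℝ (lm n n (id : N → N) q₀ q) (lm k n φ p q₀ z) (repS φ p q₀ s (ch k p y)) :=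
      Filter.eventually_of_mem (Filter.inter_mem ((isOpen_ov hφ).mem_nhds hz)
        ((isOpen_ov hφ).mem_nhds hz₀)) fun z hz' => by
        have h := co_mfderiv (φ := (id : N → N)) contMDiff_id (p := q₀) (q := q)
          (y := φ ((ch k p).symm z)) hz'.2.2 hz'.1.2 (fr n q₀ _ (co n q₀ q₀ (s y)))
        rw [mfderiv_id, co_fr hz'.2.2] at h
        simp only [rep]
        rw [lm, (ch n q).left_inv hz'.1.2, extv_eq_fr hz'.2.2, repS_ch hy]
        exact h
    have hX : DifferentiableAt ℝ (rep n q (extv (s y))) (lm k n φ p q (ch k p y)) := by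
      rw [lm_ch hy]; exact (diffFieldAt_iff hq).1 (diffFieldAt_extv _)
    have h := congrArg (fun L : Mod k →L[ℝ] Mod n => L (co k p y v)) (ev.fderiv_eq (𝕜 := ℝ))
    rw [fderiv_clm_app_const dA, fderiv_fun_comp _ hX (differentiableAt_lm hφ hz), lm_ch hy] at h
    exact h
  have e6 := congrArg (fun L : Mod k →L[ℝ] Mod n => L (co k p y v)) ((repS_eventually hφ s hz₀ hz).fderiv_eq (𝕜 := ℝ))
  rw [fderiv_clm_app dA hs₀] at e6
  rw [pullbackConn, map_add, co_conn hD hq (diffFieldAt_extv _), extv_self]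
  rw [e3, e2, e4, co_mfderiv hφ hy hq, e5, e6]
  abel

end MapsInCharts

/-! ### The second fundamental form in charts -/

section LocalForms

variable {V W : Type*} [NormedAddCommGroup V] [NormedSpace ℝ V] [FiniteDimensional ℝ V]
  [NormedAddCommGroup W] [NormedSpace ℝ W]

/-- The second fundamental form of a map with first derivative `a` and second derivative `b`. -/
def sffL (a : V →L[ℝ] W) (b : V →L[ℝ] V →L[ℝ] W) (Γ : V →L[ℝ] V →L[ℝ] V)
    (G : W →L[ℝ] W →L[ℝ] W) : V →L[ℝ] V →L[ℝ] W :=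
  LinearMap.toContinuousBilinearMap <|
    LinearMap.mk₂ ℝ (fun u v => b v u + G (a v) (a u) - a (Γ v u))
      (fun u u' v => by simp only [map_add]; abel)
      (fun c u v => by simp only [map_smul]; module)
      (fun u v v' => by simp only [map_add, add_apply]; abel)
      (fun c u v => by simp only [map_smul, smul_apply]; module)

/-- The second fundamental form of `f`, with Christoffel symbols `Γ`, `G` on the source and
on the target. -/
def sff (f : V → W) (Γ : V → V →L[ℝ] V →L[ℝ] V) (G : W → W →L[ℝ] W →L[ℝ] W) (z : V) :
    V →L[ℝ] V →L[ℝ] W :=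
  sffL (fderiv ℝ f z) (fderiv ℝ (fderiv ℝ f) z) (Γ z) (G (f z))

lemma sff_apply (f : V → W) (Γ : V → V →L[ℝ] V →L[ℝ] V) (G : W → W →L[ℝ] W →L[ℝ] W) (z u v : V) :
    sff f Γ G z u v = fderiv ℝ (fderiv ℝ f) z v u + G (f z) (fderiv ℝ f z v) (fderiv ℝ f z u)
      - fderiv ℝ f z (Γ z v u) := rfl

/-- The covariant derivative of the second fundamental form. -/
def tff (f : V → W) (Γ : V → V →L[ℝ] V →L[ℝ] V) (G : W → W →L[ℝ] W →L[ℝ] W) (z u v w : V) : W :=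
  fderiv ℝ (sff f Γ G) z w u v + G (f z) (fderiv ℝ f z w) (sff f Γ G z u v)
    - sff f Γ G z (Γ z w u) v - sff f Γ G z u (Γ z w v)

lemma smoothOn_sff {f : V → W} {Γ : V → V →L[ℝ] V →L[ℝ] V} {G : W → W →L[ℝ] W →L[ℝ] W} {U : Set V}
    {U' : Set W} (hU : IsOpen U) (hf : ContDiffOn ℝ ∞ f U) (hΓ : ContDiffOn ℝ ∞ Γ U)
    (hG : ContDiffOn ℝ ∞ G U') (hUU : Set.MapsTo f U U') : ContDiffOn ℝ ∞ (sff f Γ G) U := by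
  have h1 := smoothOn_fderiv hU hf
  have h2 := smoothOn_fderiv hU h1
  have hGf : ContDiffOn ℝ ∞ (fun z => G (f z)) U := hG.comp hf hUU
  refine smoothOn_clm_iff.2 fun u => smoothOn_clm_iff.2 fun v => ?_
  simp only [sff_apply]
  exact (((h2.clm_apply contDiffOn_const).clm_apply contDiffOn_const).add
    ((hGf.clm_apply (h1.clm_apply contDiffOn_const)).clm_apply (h1.clm_apply contDiffOn_const))).sub
    (h1.clm_apply ((hΓ.clm_apply contDiffOn_const).clm_apply contDiffOn_const))

end LocalForms

section FormsInCharts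

variable {m n : ℕ} {M : Type*} [TopologicalSpace M] [ChartedSpace (Mod (2 * m + 1)) M]
  [IsManifold (𝓡 (2 * m + 1)) ∞ M] (S : StrictlyPseudoconvexCR m M)
  {N : Type*} [TopologicalSpace N] [ChartedSpace (Mod n) N] [IsManifold (𝓡 n) ∞ N]
  (h : Metric n N) {φ : M → N} (hφ : ContMDiff (𝓡 (2 * m + 1)) (𝓡 n) ∞ φ) {p : M} {q : N}

/-- The Christoffel symbols of the Tanaka-Webster connection in the chart at `p`. -/
abbrev twL (p : M) := gammaL (S.thL p) (S.JL p)

include hφ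

lemma smoothOn_sff_chart : ContDiffOn ℝ ∞ (sff (lm (2 * m + 1) n φ p q) (twL S p) (lcL h q)) (ov (2 * m + 1) n φ p q) :=
  smoothOn_sff (isOpen_ov hφ) (smoothOn_lm hφ)
    ((S.localCR p).smooth_gamma.mono Set.inter_subset_left) (smoothOn_lcL q)
    fun _ hz => map_mem hz.2

lemma co_secondForm {y : M} (hy : y ∈ (ch (2 * m + 1) p).source) (hq : φ y ∈ (ch n q).source)
    (u v : TangentSpace (𝓡 (2 * m + 1)) y) :
    co n q (φ y) (secondForm S h φ y u v)
      = sff (lm (2 * m + 1) n φ p q) (twL S p) (lcL h q) (ch _ p y) (co _ p y u) (co _ p y v) := by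
  have hz := mem_ov hy hq
  have dX : DifferentiableAt ℝ (rep _ p (extv u)) (ch _ p y) :=
    (diffFieldAt_iff hy).1 (diffFieldAt_extv u)
  have df : DifferentiableAt ℝ (fderiv ℝ (lm (2 * m + 1) n φ p q)) (ch _ p y) :=
    differentiableAt_of_smoothOn (isOpen_ov hφ) (smoothOn_fderiv (isOpen_ov hφ) (smoothOn_lm hφ)) hz
  have e : repS φ p q (fun y => mfderiv (𝓡 (2 * m + 1)) (𝓡 n) φ y (extv u y)) =ᶠ[𝓝 (ch _ p y)]
      fun z => fderiv ℝ (lm (2 * m + 1) n φ p q) z (rep _ p (extv u) z) :=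
    Filter.eventually_of_mem ((isOpen_ov hφ).mem_nhds hz) fun z hz => by
      rw [repS, co_mfderiv hφ (symm_mem hz.1) hz.2, (ch _ p).right_inv hz.1]
      rfl
  rw [secondForm, map_sub, co_pullbackConn hφ (isLeviCivita_leviCivita h).cov hy hq
    ((df.clm_apply dX).congr_of_eventuallyEq e), e.fderiv_eq, fderiv_clm_app df dX,
    co_mfderiv hφ hy hq, co_mfderiv hφ hy hq, co_conn S.isTanakaWebster_tanakaWebster.cov hy
    (diffFieldAt_extv u), S.chr_tanakaWebster hy, chr_leviCivita h hq, rep_ch hy, extv_self,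
    sff_apply, lm_ch hy, map_add]
  abel

lemma co_thirdForm {y : M} (hy : y ∈ (ch (2 * m + 1) p).source) (hq : φ y ∈ (ch n q).source)
    (u v w : TangentSpace (𝓡 (2 * m + 1)) y) :
    co n q (φ y) (thirdForm S h φ y u v w)
      = tff (lm (2 * m + 1) n φ p q) (twL S p) (lcL h q) (ch _ p y) (co _ p y u) (co _ p y v) (co _ p y w) := by
  have hz := mem_ov hy hq
  have dX : ∀ u : TangentSpace (𝓡 (2 * m + 1)) y,
      DifferentiableAt ℝ (rep _ p (extv u)) (ch _ p y) := fun u =>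
    (diffFieldAt_iff hy).1 (diffFieldAt_extv u)
  have db : DifferentiableAt ℝ (sff (lm (2 * m + 1) n φ p q) (twL S p) (lcL h q)) (ch _ p y) :=
    differentiableAt_of_smoothOn (isOpen_ov hφ) (smoothOn_sff_chart S h hφ) hz
  have e : repS φ p q (fun y => secondForm S h φ y (extv u y) (extv v y)) =ᶠ[𝓝 (ch _ p y)]
      fun z => sff (lm (2 * m + 1) n φ p q) (twL S p) (lcL h q) z (rep _ p (extv u) z) (rep _ p (extv v) z) :=
    Filter.eventually_of_mem ((isOpen_ov hφ).mem_nhds hz) fun z hz => by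
      rw [repS, co_secondForm S h hφ (symm_mem hz.1) hz.2, (ch _ p).right_inv hz.1]
      rfl
  rw [thirdForm, map_sub, map_sub, co_pullbackConn hφ (isLeviCivita_leviCivita h).cov hy hq
    (((db.clm_apply (dX u)).clm_apply (dX v)).congr_of_eventuallyEq e), e.fderiv_eq,
    fderiv_clm_app₂ db (dX u) (dX v), co_secondForm S h hφ hy hq, co_secondForm S h hφ hy hq,
    co_secondForm S h hφ hy hq,
    co_conn S.isTanakaWebster_tanakaWebster.cov hy (diffFieldAt_extv u),
    co_conn S.isTanakaWebster_tanakaWebster.cov hy (diffFieldAt_extv v), S.chr_tanakaWebster hy,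
    chr_leviCivita h hq, rep_ch hy, rep_ch hy, extv_self, extv_self, tff,
    lm_ch hy, map_add, map_add, add_apply]
  abel

end FormsInCharts

/-! ### The curvature in charts -/

section Curvature

variable {k : ℕ} {M : Type*} [TopologicalSpace M] [ChartedSpace (Mod k) M]
  [IsManifold (𝓡 k) ∞ M] {D : Conn k M}

/-- The extensions used by `curvature` are constant in the chart at x, so the bracket term vanishes
and only the symbols are differentiated. -/
lemma curvature_chart (hD : IsCovariantDerivativeOn (Mod k) D) {x : M}
    {Γ : Mod k → Mod k →L[ℝ] Mod k →L[ℝ] Mod k} (hΓ : ContDiffOn ℝ ∞ Γ (ch k x).target)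
    (hDΓ : ∀ y ∈ (ch k x).source, chr D x (ch k x y) = Γ (ch k x y))
    (u v w : TangentSpace (𝓡 k) x) :
    co k x x (curvature D x u v w)
      = curvL Γ (ch k x x) (co k x x u) (co k x x v) (co k x x w) := by
  have hx := mem_extChartAt_source (I := 𝓡 k) x
  have hz := mem_extChartAt_target (I := 𝓡 k) x
  have dΓ : DifferentiableAt ℝ Γ (ch k x x) := differentiableAt_of_smoothOn (target_open x) hΓ hz
  have ec : ∀ a : TangentSpace (𝓡 k) x, rep k x (extv a) =ᶠ[𝓝 (ch k x x)] fun _ => co k x x a :=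
    fun a => Filter.eventually_of_mem ((target_open x).mem_nhds hz) fun z hz => rep_extv a hz
  have key : ∀ a b c : TangentSpace (𝓡 k) x,
      co k x x (D (fun y => D (extv c) y (extv b y)) x a)
        = fderiv ℝ Γ (ch k x x) (co k x x a) (co k x x b) (co k x x c)
          + Γ (ch k x x) (co k x x a) (Γ (ch k x x) (co k x x b) (co k x x c)) := by
    intro a b c
    have e : rep k x (fun y => D (extv c) y (extv b y)) =ᶠ[𝓝 (ch k x x)]
        fun z => Γ z (co k x x b) (co k x x c) :=
      Filter.eventually_of_mem ((target_open x).mem_nhds hz) fun z hz => by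
        have hy := symm_mem hz
        have hd : DiffFieldAt (extv c) ((ch k x).symm z) := by
          rw [diffFieldAt_iff hy]
          refine (differentiableAt_const (co k x x c)).congr_of_eventuallyEq
            (Filter.eventually_of_mem ((target_open x).mem_nhds (map_mem hy))
              fun z hz => rep_extv c hz)
        have e' : rep k x (extv c) =ᶠ[𝓝 (ch k x ((ch k x).symm z))] fun _ => co k x x c :=
          Filter.eventually_of_mem ((target_open x).mem_nhds (map_mem hy))
            fun z hz => rep_extv c hz
        have r := fun a => rep_extv (x := x) a hz
        simp only [rep] at r
        rw [rep, co_conn hD hy hd, e'.fderiv_eq, fderiv_fun_const, hDΓ _ hy, r, r,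
          (ch k x).right_inv hz]
        simp
    have dΓb : DifferentiableAt ℝ (fun z => Γ z (co k x x b)) (ch k x x) :=
      dΓ.clm_apply (differentiableAt_const _)
    have hd : DiffFieldAt (fun y => D (extv c) y (extv b y)) x :=
      (diffFieldAt_iff hx).2 ((dΓb.clm_apply (differentiableAt_const _)).congr_of_eventuallyEq e)
    rw [co_conn hD hx hd, e.fderiv_eq, fderiv_clm_app_const dΓb, fderiv_clm_app_const dΓ,
      hDΓ x hx, ← rep_ch hx (fun y => D (extv c) y (extv b y)), e.eq_of_nhds]
  have hb : VectorField.mlieBracket (𝓡 k) (extv u) (extv v) x = 0 := by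
    apply co_injective hx
    rw [co_mlieBracket hx (diffFieldAt_extv u) (diffFieldAt_extv v), VectorField.lieBracket,
      (ec u).fderiv_eq, (ec v).fderiv_eq]
    simp
  rw [curvature, hb, map_zero, sub_zero, map_sub, key, key, curvL]
  abel

end Curvature

/-! ### Covariant derivatives of sections along a map -/

section SectionsAlong

variable {V W : Type*} [NormedAddCommGroup V] [NormedSpace ℝ V] [FiniteDimensional ℝ V]
  [NormedAddCommGroup W] [NormedSpace ℝ W]

/-- The covariant derivative of a vector field. -/
def covV (Γ : V → V →L[ℝ] V →L[ℝ] V) (x : V → V) (z w : V) : V :=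
  fderiv ℝ x z w + Γ z w (x z)

/-- The covariant derivative of a section along `f`. -/
def covS (f : V → W) (G : W → W →L[ℝ] W →L[ℝ] W) (s : V → W) (z w : V) : W :=
  fderiv ℝ s z w + G (f z) (fderiv ℝ f z w) (s z)

omit [FiniteDimensional ℝ V] in
lemma covV_const (Γ : V → V →L[ℝ] V →L[ℝ] V) (u z w : V) :
    covV Γ (fun _ => u) z w = Γ z w u := by
  simp [covV]

/-- Smooth maps between open subsets of vector spaces with connections; the connection `G` of the
target is symmetric and compatible with the metric `h`. -/
structure LocalMap (U : Set V) (U' : Set W) (f : V → W) (Γ : V → V →L[ℝ] V →L[ℝ] V)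
    (h : W → W →L[ℝ] W →L[ℝ] ℝ) (G : W → W →L[ℝ] W →L[ℝ] W) : Prop where
  isOpen : IsOpen U
  isOpen' : IsOpen U'
  mapsTo : Set.MapsTo f U U'
  smooth_f : ContDiffOn ℝ ∞ f U
  smooth_Γ : ContDiffOn ℝ ∞ Γ U
  smooth_h : ContDiffOn ℝ ∞ h U'
  smooth_G : ContDiffOn ℝ ∞ G U'
  h_symm : ∀ y ∈ U', ∀ u v, h y u v = h y v u
  h_pos : ∀ y ∈ U', ∀ u, u ≠ 0 → 0 < h y u u
  metric : ∀ y ∈ U', ∀ u v w, fderiv ℝ h y u v w = h y (G y u v) w + h y v (G y u w)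
  symm : ∀ y ∈ U', ∀ u v, G y u v = G y v u

namespace LocalMap

variable {U : Set V} {U' : Set W} {f : V → W} {Γ : V → V →L[ℝ] V →L[ℝ] V}
  {h : W → W →L[ℝ] W →L[ℝ] ℝ} {G : W → W →L[ℝ] W →L[ℝ] W} (L : LocalMap U U' f Γ h G)
  {z : V} (hz : z ∈ U)

include L

omit [FiniteDimensional ℝ V] in
lemma smooth_df : ContDiffOn ℝ ∞ (fderiv ℝ f) U := smoothOn_fderiv L.isOpen L.smooth_f

lemma smooth_sff : ContDiffOn ℝ ∞ (sff f Γ G) U :=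
  smoothOn_sff L.isOpen L.smooth_f L.smooth_Γ L.smooth_G L.mapsTo

include hz

omit [FiniteDimensional ℝ V] in
lemma df : DifferentiableAt ℝ f z := differentiableAt_of_smoothOn L.isOpen L.smooth_f hz

omit [FiniteDimensional ℝ V] in
lemma ddf : DifferentiableAt ℝ (fderiv ℝ f) z :=
  differentiableAt_of_smoothOn L.isOpen L.smooth_df hz

omit [FiniteDimensional ℝ V] in
lemma dΓ : DifferentiableAt ℝ Γ z := differentiableAt_of_smoothOn L.isOpen L.smooth_Γ hz

lemma dsff : DifferentiableAt ℝ (sff f Γ G) z :=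
  differentiableAt_of_smoothOn L.isOpen L.smooth_sff hz

omit [FiniteDimensional ℝ V] in
lemma dGf : DifferentiableAt ℝ (fun y => G (f y)) z :=
  (differentiableAt_of_smoothOn L.isOpen' L.smooth_G (L.mapsTo hz)).comp z (L.df hz)

omit [FiniteDimensional ℝ V] in
lemma dhf : DifferentiableAt ℝ (fun y => h (f y)) z :=
  (differentiableAt_of_smoothOn L.isOpen' L.smooth_h (L.mapsTo hz)).comp z (L.df hz)

omit [FiniteDimensional ℝ V] in
lemma fderiv_inner {s t : V → W} (hs : DifferentiableAt ℝ s z) (ht : DifferentiableAt ℝ t z)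
    (w : V) : fderiv ℝ (fun y => h (f y) (s y) (t y)) z w
      = h (f z) (covS f G s z w) (t z) + h (f z) (s z) (covS f G t z w) := by
  rw [fderiv_clm_app₂ (L.dhf hz) hs ht,
    fderiv_fun_comp _ (differentiableAt_of_smoothOn L.isOpen' L.smooth_h (L.mapsTo hz)) (L.df hz),
    ContinuousLinearMap.comp_apply, L.metric _ (L.mapsTo hz), covS, covS]
  simp only [map_add, add_apply]
  ring

lemma covS_df {x : V → V} (hx : DifferentiableAt ℝ x z) (w : V) :
    covS f G (fun y => fderiv ℝ f y (x y)) z w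
      = sff f Γ G z (x z) w + fderiv ℝ f z (covV Γ x z w) := by
  rw [covS, fderiv_clm_app (L.ddf hz) hx, sff_apply, covV, map_add]
  abel

lemma covS_sff {x y : V → V} (hx : DifferentiableAt ℝ x z) (hy : DifferentiableAt ℝ y z) (w : V) :
    covS f G (fun p => sff f Γ G p (x p) (y p)) z w
      = tff f Γ G z (x z) (y z) w + sff f Γ G z (covV Γ x z w) (y z)
        + sff f Γ G z (x z) (covV Γ y z w) := by
  rw [covS, fderiv_clm_app₂ (L.dsff hz) hx hy, tff, covV, covV, map_add, map_add, add_apply]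
  abel

/-- Second derivatives commute and the target connection is torsion-free, so the asymmetry of β
comes from the torsion of the source alone. -/
lemma sff_swap (u v : V) : sff f Γ G z u v - sff f Γ G z v u
    = fderiv ℝ f z (Γ z u v - Γ z v u) := by
  rw [sff_apply, sff_apply, sndFDeriv_symm L.isOpen L.smooth_f hz, L.symm _ (L.mapsTo hz), map_sub]
  abel

lemma covS_covS_swap {s : V → W} (hs : ContDiffOn ℝ ∞ s U) (v w : V) :
    covS f G (fun y => covS f G s y v) z w - covS f G (fun y => covS f G s y w) z v
      = curvL G (f z) (fderiv ℝ f z w) (fderiv ℝ f z v) (s z) := by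
  have ds := differentiableAt_of_smoothOn L.isOpen hs hz
  have dds := differentiableAt_of_smoothOn L.isOpen (smoothOn_fderiv L.isOpen hs) hz
  have dds' : ∀ v, DifferentiableAt ℝ (fun y => fderiv ℝ s y v) z := fun v =>
    dds.clm_apply (differentiableAt_const v)
  have da : ∀ v, DifferentiableAt ℝ (fun y => fderiv ℝ f y v) z := fun v =>
    (L.ddf hz).clm_apply (differentiableAt_const v)
  have key : ∀ v w, covS f G (fun y => covS f G s y v) z w
      = fderiv ℝ (fderiv ℝ s) z w v
        + (fderiv ℝ G (f z) (fderiv ℝ f z w) (fderiv ℝ f z v) (s z)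
          + G (f z) (fderiv ℝ (fderiv ℝ f) z w v) (s z) + G (f z) (fderiv ℝ f z v) (fderiv ℝ s z w))
        + G (f z) (fderiv ℝ f z w) (fderiv ℝ s z v + G (f z) (fderiv ℝ f z v) (s z)) := by
    intro v w
    simp only [covS]
    rw [fderiv_fun_add (dds' v) (((L.dGf hz).clm_apply (da v)).clm_apply ds), add_apply,
      fderiv_clm_app₂ (L.dGf hz) (da v) ds, fderiv_clm_app_const dds,
      fderiv_clm_app_const (L.ddf hz),
      fderiv_fun_comp _ (differentiableAt_of_smoothOn L.isOpen' L.smooth_G (L.mapsTo hz)) (L.df hz),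
      ContinuousLinearMap.comp_apply]
  rw [key, key, sndFDeriv_symm L.isOpen hs hz w v, sndFDeriv_symm L.isOpen L.smooth_f hz w v, curvL]
  simp only [map_add]
  abel

/-- The Ricci identity for the second fundamental form. -/
lemma tff_swap (u v w : V) : tff f Γ G z u v w - tff f Γ G z u w v
    = curvL G (f z) (fderiv ℝ f z w) (fderiv ℝ f z v) (fderiv ℝ f z u)
      - fderiv ℝ f z (curvL Γ z w v u) - sff f Γ G z u (Γ z w v - Γ z v w) := by
  have hs : ContDiffOn ℝ ∞ (fun y => fderiv ℝ f y u) U := L.smooth_df.clm_apply contDiffOn_const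
  have dΓ' : ∀ v, DifferentiableAt ℝ (fun y => Γ y v) z := fun v =>
    (L.dΓ hz).clm_apply (differentiableAt_const v)
  have dΓ'' : ∀ v, DifferentiableAt ℝ (fun y => Γ y v u) z := fun v =>
    (dΓ' v).clm_apply (differentiableAt_const u)
  have hcs : ∀ v, DifferentiableAt ℝ (fun y => covS f G (fun y => fderiv ℝ f y u) y v) z := by
    intro v
    have : ContDiffOn ℝ ∞ (fun y => covS f G (fun y => fderiv ℝ f y u) y v) U :=
      ((smoothOn_fderiv L.isOpen hs).clm_apply contDiffOn_const).add
        (((L.smooth_G.comp L.smooth_f L.mapsTo).clm_apply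
          (L.smooth_df.clm_apply contDiffOn_const)).clm_apply hs)
    exact differentiableAt_of_smoothOn L.isOpen this hz
  have hda : ∀ v, DifferentiableAt ℝ (fun y => fderiv ℝ f y (Γ y v u)) z := fun v =>
    (L.ddf hz).clm_apply (dΓ'' v)
  -- For constant u, v one has β(u, v) = ∇_v(df u) - df(Γ_v u). One more differentiation expresses
  -- ∇β through second covariant derivatives of the section df u, whose commutator is the curvature
  -- of the target.
  have key : ∀ v w, tff f Γ G z u v w = covS f G (fun y => covS f G (fun y => fderiv ℝ f y u) y v) z w
      - (sff f Γ G z (Γ z v u) w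
        + fderiv ℝ f z (fderiv ℝ Γ z w v u + Γ z w (Γ z v u)))
      - sff f Γ G z (Γ z w u) v - sff f Γ G z u (Γ z w v) := by
    intro v w
    have e : ∀ y ∈ U, sff f Γ G y u v
        = covS f G (fun y => fderiv ℝ f y u) y v - fderiv ℝ f y (Γ y v u) := by
      intro y hy
      rw [L.covS_df hy (differentiableAt_const u), covV_const]
      abel
    have h1 := L.covS_sff hz (differentiableAt_const u) (differentiableAt_const v) w
    rw [covV_const, covV_const] at h1
    have h2 : covS f G (fun p => sff f Γ G p u v) z w
        = covS f G (fun y => covS f G (fun y => fderiv ℝ f y u) y v) z w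
          - covS f G (fun y => fderiv ℝ f y (Γ y v u)) z w := by
      rw [covS, fderiv_congr_of_eqOn L.isOpen e hz, fderiv_fun_sub (hcs v) (hda v), e z hz, map_sub,
        sub_apply]
      simp only [covS]
      abel
    rw [L.covS_df hz (dΓ'' v), covV, fderiv_clm_app_const (dΓ' v),
      fderiv_clm_app_const (L.dΓ hz)] at h2
    rw [h1] at h2
    rw [← h2]
    abel
  rw [key, key, ← L.covS_covS_swap hz hs, curvL]
  simp only [map_add, map_sub]
  abel

end LocalMap

end SectionsAlong

/-! ### The horizontal trace -/

section HorizontalTrace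

variable {V : Type*} [NormedAddCommGroup V] [NormedSpace ℝ V] [FiniteDimensional ℝ V]

/-- The inverse of the Webster metric on the horizontal space: `ξ ↦ ∑ ξ(ε_A) ε_A`. -/
def cog (θ : V → V →L[ℝ] ℝ) (J : V → V →L[ℝ] V) (z : V) : (V →L[ℝ] ℝ) →L[ℝ] V :=
  (websterL θ J z).inverse
    - (ContinuousLinearMap.apply ℝ ℝ (reebL θ z)).smulRight (reebL θ z)

lemma cog_apply (θ : V → V →L[ℝ] ℝ) (J : V → V →L[ℝ] V) (z : V) (ξ : V →L[ℝ] ℝ) :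
    cog θ J z ξ = (websterL θ J z).inverse ξ - ξ (reebL θ z) • reebL θ z := rfl

/-- The frame `e₁, …, e_m, J e₁, …, J e_m`. -/
def frm {m : ℕ} (J : V →L[ℝ] V) (e : Fin m → V) : Fin m ⊕ Fin m → V :=
  Sum.elim e fun α => J (e α)

/-- `e₁, …, e_m, J e₁, …, J e_m` is an orthonormal basis of the horizontal space at `z`. -/
structure FrameL {m : ℕ} (θ : V → V →L[ℝ] ℝ) (J : V → V →L[ℝ] V) (z : V) (e : Fin m → V) :
    Prop where
  horizontal : ∀ A, θ z (frm (J z) e A) = 0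
  norm : ∀ A, websterL θ J z (frm (J z) e A) (frm (J z) e A) = 1
  expand : ∀ v, θ z v = 0 → v = ∑ A, websterL θ J z (frm (J z) e A) v • frm (J z) e A
  J_e : ∀ α, J z (J z (e α)) = -e α

variable {m : ℕ} {U : Set V} {θ : V → V →L[ℝ] ℝ} {J : V → V →L[ℝ] V} {z : V} {e : Fin m → V}

namespace FrameL

variable (E : FrameL θ J z e)
include E

/-- J sends the frame (e, Je) to (Je, -e). -/
lemma sum_J {F : Type*} [AddCommGroup F] (X : V → V → F) (hX : ∀ u v, X (-u) (-v) = X u v) :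
    ∑ A, X (J z (frm (J z) e A)) (J z (frm (J z) e A)) = ∑ A, X (frm (J z) e A) (frm (J z) e A) := by
  rw [Fintype.sum_sum_type, Fintype.sum_sum_type, add_comm]
  simp only [frm, Sum.elim_inl, Sum.elim_inr, E.J_e, hX]

/-- J is skew: it moves from one slot of a contracted pair to the other with a sign. -/
lemma sum_J_left {F : Type*} [AddCommGroup F] (X : V → V → F) (h1 : ∀ u v, X (-u) v = -X u v)
    (h2 : ∀ u v, X u (-v) = -X u v) :
    ∑ A, X (J z (frm (J z) e A)) (frm (J z) e A) = -∑ A, X (frm (J z) e A) (J z (frm (J z) e A)) := by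
  rw [Fintype.sum_sum_type, Fintype.sum_sum_type, add_comm, neg_add]
  simp only [frm, Sum.elim_inl, Sum.elim_inr, E.J_e, h1, h2, Finset.sum_neg_distrib, neg_neg]

variable (H : LocalCR U θ J) (hz : z ∈ U)
include H hz

lemma norm_J (A) : websterL θ J z (J z (frm (J z) e A)) (J z (frm (J z) e A)) = 1 := by
  rw [H.g_J hz, H.J_sq z hz _ (E.horizontal A), map_neg, neg_neg, E.norm]

end FrameL

namespace LocalCR

variable (H : LocalCR U θ J)
include H

lemma smooth_cog : ContDiffOn ℝ ∞ (cog θ J) U := by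
  refine smoothOn_clm_iff.2 fun ξ => ?_
  simp only [cog_apply]
  exact ((smoothOn_inverse H.smooth_webster fun _ hz => H.g_invertible hz).clm_apply
    contDiffOn_const).sub ((contDiffOn_const.clm_apply H.smooth_reeb).smul H.smooth_reeb)

variable (hz : z ∈ U)
include hz

lemma g_cog (ξ : V →L[ℝ] ℝ) (w : V) :
    websterL θ J z (cog θ J z ξ) w = ξ w - ξ (reebL θ z) * θ z w := by
  rw [cog_apply, map_sub, map_smul, sub_apply, smul_apply, apply_inverse_apply (H.g_invertible hz),
    H.g_reeb hz, smul_eq_mul]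

lemma cog_frame (E : FrameL θ J z e) (ξ : V →L[ℝ] ℝ) :
    cog θ J z ξ = ∑ A, ξ (frm (J z) e A) • frm (J z) e A := by
  refine H.g_ext hz fun w => ?_
  obtain ⟨w', hw', hw⟩ := H.exists_decomp hz w
  have h1 : ξ w' = ∑ A, websterL θ J z (frm (J z) e A) w' * ξ (frm (J z) e A) := by
    conv_lhs => rw [E.expand w' hw', map_sum]
    simp only [map_smul, smul_eq_mul]
  have h2 : ∀ A, websterL θ J z (frm (J z) e A) w = websterL θ J z (frm (J z) e A) w' := by
    intro A
    conv_lhs => rw [hw]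
    rw [map_add, map_smul, H.g_symm hz _ (reebL θ z), H.g_reeb hz, E.horizontal]
    simp
  have h3 : ξ w - ξ (reebL θ z) * θ z w = ξ w' := by
    have := congrArg ξ hw
    rw [map_add, map_smul, smul_eq_mul] at this
    linarith
  rw [H.g_cog hz, h3, h1]
  simp only [map_sum, sum_apply, map_smul, smul_apply, smul_eq_mul, h2]
  exact Finset.sum_congr rfl fun _ _ => mul_comm _ _

/-- Obtained by differentiating `g_cog` with g, T and θ parallel. It expresses that the horizontal
cometric is parallel. -/
lemma fderiv_cog (ξ : V →L[ℝ] ℝ) (a : V) :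
    fderiv ℝ (fun y => cog θ J y ξ) z a
      = -gammaL θ J z a (cog θ J z ξ) - cog θ J z (ξ.comp (gammaL θ J z a)) := by
  refine H.g_ext hz fun w => ?_
  have dc : DifferentiableAt ℝ (fun y => cog θ J y ξ) z :=
    (differentiableAt_of_smoothOn H.isOpen H.smooth_cog hz).clm_apply (differentiableAt_const ξ)
  have dξT : DifferentiableAt ℝ (fun y => ξ (reebL θ y)) z :=
    (differentiableAt_const ξ).clm_apply (H.dT hz)
  have dθw : DifferentiableAt ℝ (fun y => θ y w) z :=
    (H.dθ hz).clm_apply (differentiableAt_const w)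
  have h := congrArg (· a) (fderiv_congr_of_eqOn H.isOpen (fun y hy => H.g_cog hy ξ w) hz)
  simp only [fderiv_clm_app₂ (H.dg hz) dc (differentiableAt_const w)] at h
  rw [fderiv_const_sub, fderiv_fun_mul dξT dθw, H.gamma_metric hz, H.g_cog hz] at h
  simp only [neg_apply, add_apply, smul_apply, fderiv_clm_app_const (H.dθ hz), H.fderiv_θ hz,
    fderiv_clm_app (differentiableAt_const ξ) (H.dT hz), fderiv_fun_const, Pi.zero_apply, zero_apply,
    H.fderiv_reeb hz, map_neg, map_zero, smul_eq_mul] at h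
  rw [map_sub, sub_apply, map_neg, neg_apply, H.g_cog hz]
  simp only [ContinuousLinearMap.comp_apply]
  linarith

end LocalCR

variable {ι : Type*} [Fintype ι] (b : Module.Basis ι ℝ V)

/-- The dual basis. -/
def cf (i : ι) : V →L[ℝ] ℝ := LinearMap.toContinuousLinearMap (b.coord i)

lemma sum_cf (v : V) : ∑ i, cf b i v • b i = v := b.sum_repr v

variable {F : Type*} [AddCommGroup F] [Module ℝ F]

lemma sum_cf_map (X : V →ₗ[ℝ] F) (v : V) : ∑ i, cf b i v • X (b i) = X v := by
  conv_rhs => rw [← sum_cf b v, map_sum]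
  simp

/-- Replaces the trace over a frame at one point by a trace over a fixed basis and `cog`. Only the
latter can be differentiated, since frames at different points are unrelated. -/
lemma FrameL.sum_cog_left (E : FrameL θ J z e) (H : LocalCR U θ J) (hz : z ∈ U)
    (X : V →ₗ[ℝ] V →ₗ[ℝ] F) (Q : V →L[ℝ] V) :
    ∑ i, X (Q (b i)) (cog θ J z (cf b i)) = ∑ A, X (Q (frm (J z) e A)) (frm (J z) e A) := by
  simp only [H.cog_frame hz E, map_sum, map_smul]
  rw [Finset.sum_comm]
  refine Finset.sum_congr rfl fun A _ => ?_
  exact sum_cf_map b ((X.flip (frm (J z) e A)).comp Q.toLinearMap) (frm (J z) e A)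

lemma FrameL.sum_cog_right (E : FrameL θ J z e) (H : LocalCR U θ J) (hz : z ∈ U)
    (X : V →ₗ[ℝ] V →ₗ[ℝ] F) (Q : V →L[ℝ] V) :
    ∑ i, X (b i) (cog θ J z ((cf b i).comp Q)) = ∑ A, X (Q (frm (J z) e A)) (frm (J z) e A) := by
  simp only [H.cog_frame hz E, map_sum, map_smul]
  rw [Finset.sum_comm]
  refine Finset.sum_congr rfl fun A _ => ?_
  exact sum_cf_map b (X.flip (frm (J z) e A)) (Q (frm (J z) e A))

end HorizontalTrace

/-! ### The divergence of the Bochner vector field -/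

section Bochner

variable {V W : Type*} [NormedAddCommGroup V] [NormedSpace ℝ V] [FiniteDimensional ℝ V]
  [NormedAddCommGroup W] [NormedSpace ℝ W]

/-- `Θ(u, v, v') = ⟨β(u, v), a v'⟩ - ⟨β(Ju, v), a J v'⟩ - c (⟨β(v, v'), a u⟩ + ⟨β(v, Jv'), a J u⟩)`. -/
def bform (h : W →L[ℝ] W →L[ℝ] ℝ) (a : V →L[ℝ] W) (β : V →L[ℝ] V →L[ℝ] W) (J : V →L[ℝ] V)
    (c : ℝ) (u v v' : V) : ℝ :=
  h (β u v) (a v') - h (β (J u) v) (a (J v'))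
    - c * (h (β v v') (a u) + h (β v (J v')) (a (J u)))

/-- The covariant derivative of `bform` in the direction `w`. -/
def bformD (h : W →L[ℝ] W →L[ℝ] ℝ) (a : V →L[ℝ] W) (β : V →L[ℝ] V →L[ℝ] W) (C : V → V → V → W)
    (J : V →L[ℝ] V) (c : ℝ) (w u v v' : V) : ℝ :=
  h (C u v w) (a v') + h (β u v) (β v' w) - (h (C (J u) v w) (a (J v')) + h (β (J u) v) (β (J v') w))
    - c * (h (C v v' w) (a u) + h (β v v') (β u w)
      + (h (C v (J v') w) (a (J u)) + h (β v (J v')) (β (J u) w)))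

variable (f : V → W) (Γ : V → V →L[ℝ] V →L[ℝ] V) (G : W → W →L[ℝ] W →L[ℝ] W) (z : V)

lemma tff_add₁ (u u' v w : V) : tff f Γ G z (u + u') v w = tff f Γ G z u v w + tff f Γ G z u' v w := by
  simp only [tff, map_add, add_apply]; abel

lemma tff_add₂ (u v v' w : V) : tff f Γ G z u (v + v') w = tff f Γ G z u v w + tff f Γ G z u v' w := by
  simp only [tff, map_add]; abel

lemma tff_add₃ (u v w w' : V) : tff f Γ G z u v (w + w') = tff f Γ G z u v w + tff f Γ G z u v w' := by
  simp only [tff, map_add, add_apply]; abel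

lemma tff_smul₁ (c : ℝ) (u v w : V) : tff f Γ G z (c • u) v w = c • tff f Γ G z u v w := by
  simp only [tff, map_smul, smul_apply]; module

lemma tff_smul₂ (c : ℝ) (u v w : V) : tff f Γ G z u (c • v) w = c • tff f Γ G z u v w := by
  simp only [tff, map_smul]; module

lemma tff_smul₃ (c : ℝ) (u v w : V) : tff f Γ G z u v (c • w) = c • tff f Γ G z u v w := by
  simp only [tff, map_smul, smul_apply]; module

lemma tff_neg₁ (u v w : V) : tff f Γ G z (-u) v w = -tff f Γ G z u v w := by
  rw [← neg_one_smul ℝ, tff_smul₁, neg_one_smul]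

lemma tff_neg₃ (u v w : V) : tff f Γ G z u v (-w) = -tff f Γ G z u v w := by
  rw [← neg_one_smul ℝ, tff_smul₃, neg_one_smul]

variable (h : W → W →L[ℝ] W →L[ℝ] ℝ) (J : V → V →L[ℝ] V) (c : ℝ)

/-- `bform` for the second fundamental form of `f`. -/
def bf (z : V) : V → V → V → ℝ := bform (h (f z)) (fderiv ℝ f z) (sff f Γ G z) (J z) c

/-- `bformD` for the second fundamental form of `f`. -/
def bfD (z : V) : V → V → V → V → ℝ :=
  bformD (h (f z)) (fderiv ℝ f z) (sff f Γ G z) (tff f Γ G z) (J z) c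

/-- `bf` as a bilinear form in the last two arguments. -/
def bf₂₃ (z u : V) : V →ₗ[ℝ] V →ₗ[ℝ] ℝ :=
  LinearMap.mk₂ ℝ (bf f Γ G h J c z u)
    (fun v v' x => by simp only [bf, bform, map_add, add_apply]; ring)
    (fun s v x => by simp only [bf, bform, map_smul, smul_apply, smul_eq_mul]; ring)
    (fun v x x' => by simp only [bf, bform, map_add, add_apply]; ring)
    (fun s v x => by simp only [bf, bform, map_smul, smul_apply, smul_eq_mul]; ring)

/-- `bfD` as a bilinear form in the last two arguments. -/
def bfD₃₄ (z w u : V) : V →ₗ[ℝ] V →ₗ[ℝ] ℝ :=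
  LinearMap.mk₂ ℝ (bfD f Γ G h J c z w u)
    (fun v v' x => by
      simp only [bfD, bformD, map_add, add_apply, tff_add₁, tff_add₂]; ring)
    (fun s v x => by
      simp only [bfD, bformD, map_smul, smul_apply, tff_smul₁, tff_smul₂, smul_eq_mul]; ring)
    (fun v x x' => by simp only [bfD, bformD, map_add, add_apply, tff_add₂]; ring)
    (fun s v x => by
      simp only [bfD, bformD, map_smul, smul_apply, tff_smul₂, smul_eq_mul]; ring)

/-- `bfD` as a bilinear form in the first two arguments. -/
def bfD₁₂ (z v v' : V) : V →ₗ[ℝ] V →ₗ[ℝ] ℝ :=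
  LinearMap.mk₂ ℝ (fun w u => bfD f Γ G h J c z w u v v')
    (fun v v' x => by
      simp only [bfD, bformD, map_add, add_apply, tff_add₃]; ring)
    (fun s v x => by
      simp only [bfD, bformD, map_smul, smul_apply, tff_smul₃, smul_eq_mul]; ring)
    (fun v x x' => by simp only [bfD, bformD, map_add, add_apply, tff_add₁]; ring)
    (fun s v x => by
      simp only [bfD, bformD, map_smul, smul_apply, tff_smul₁, smul_eq_mul]; ring)

variable {ι : Type*} [Fintype ι] (b : Module.Basis ι ℝ V) (θ : V → V →L[ℝ] ℝ)

/-- The trace `u ↦ ∑_B Θ(u, ε_B, ε_B)`. -/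
def bocF (z u : V) : ℝ := ∑ i, bf f Γ G h J c z u (b i) (cog θ J z (cf b i))

/-- The vector field `∑_{A, B} Θ(ε_A, ε_B, ε_B) ε_A`. -/
def bocV (z : V) : V := ∑ i, bocF f Γ G h J c b θ z (b i) • cog θ J z (cf b i)

/-- `bocF` as a linear form. -/
def bocL (z : V) : V →ₗ[ℝ] ℝ where
  toFun := bocF f Γ G h J c b θ z
  map_add' u u' := by
    simp only [bocF, bf, bform, ← Finset.sum_add_distrib]
    refine Finset.sum_congr rfl fun i _ => ?_
    simp only [map_add, add_apply]; ring
  map_smul' s u := by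
    simp only [bocF, bf, bform, smul_eq_mul, Finset.mul_sum, RingHom.id_apply]
    refine Finset.sum_congr rfl fun i _ => ?_
    simp only [map_smul, smul_apply, smul_eq_mul]; ring

/-- `(u, v) ↦ (∑_B Θ(u, ε_B, ε_B)) v`. -/
def bocT (z : V) : V →ₗ[ℝ] V →ₗ[ℝ] V :=
  LinearMap.mk₂ ℝ (fun u v => bocL f Γ G h J c b θ z u • v)
    (fun u u' v => by rw [map_add]; module) (fun s u v => by rw [map_smul, smul_eq_mul]; module)
    (fun u v v' => by module) (fun s u v => by module)

variable {f Γ G h J c b θ z}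
variable {U U₀ : Set V} {U' : Set W} {m : ℕ} {e : Fin m → V}
  (L : LocalMap U U' f (gammaL θ J) h G) (H : LocalCR U₀ θ J) (hU : U ⊆ U₀) (hz : z ∈ U)

include H hU hz in
lemma covV_J {x : V → V} (hx : DifferentiableAt ℝ x z) (w : V) :
    covV (gammaL θ J) (fun y => J y (x y)) z w = J z (covV (gammaL θ J) x z w) := by
  rw [covV, fderiv_clm_app (H.dJ (hU hz)) hx, H.fderiv_J (hU hz), covV, map_add]
  abel

include H hU hz in
lemma covV_cog (ξ : V →L[ℝ] ℝ) (w : V) :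
    covV (gammaL θ J) (fun y => cog θ J y ξ) z w = -cog θ J z (ξ.comp (gammaL θ J z w)) := by
  rw [covV, H.fderiv_cog (hU hz)]
  abel

include H hU hz in
lemma differentiableAt_cog (ξ : V →L[ℝ] ℝ) : DifferentiableAt ℝ (fun y => cog θ J y ξ) z :=
  (differentiableAt_of_smoothOn H.isOpen H.smooth_cog (hU hz)).clm_apply (differentiableAt_const ξ)

include L H hU hz

lemma differentiableAt_bf {x y y' : V → V} (hx : DifferentiableAt ℝ x z)
    (hy : DifferentiableAt ℝ y z) (hy' : DifferentiableAt ℝ y' z) :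
    DifferentiableAt ℝ (fun p => bf f (gammaL θ J) G h J c p (x p) (y p) (y' p)) z := by
  have hJ := H.dJ (hU hz)
  have hh := L.dhf hz
  have ha := L.ddf hz
  have hβ := L.dsff hz
  exact ((((hh.clm_apply ((hβ.clm_apply hx).clm_apply hy)).clm_apply (ha.clm_apply hy'))).fun_sub
    ((hh.clm_apply ((hβ.clm_apply (hJ.clm_apply hx)).clm_apply hy)).clm_apply
      (ha.clm_apply (hJ.clm_apply hy')))).fun_sub
    (((((hh.clm_apply ((hβ.clm_apply hy).clm_apply hy')).clm_apply (ha.clm_apply hx))).fun_add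
    ((hh.clm_apply ((hβ.clm_apply hy).clm_apply (hJ.clm_apply hy'))).clm_apply
      (ha.clm_apply (hJ.clm_apply hx)))).const_mul c)

lemma fderiv_bf {x y y' : V → V} (hx : DifferentiableAt ℝ x z) (hy : DifferentiableAt ℝ y z)
    (hy' : DifferentiableAt ℝ y' z) (w : V) :
    fderiv ℝ (fun p => bf f (gammaL θ J) G h J c p (x p) (y p) (y' p)) z w
      = bfD f (gammaL θ J) G h J c z w (x z) (y z) (y' z)
        + bf f (gammaL θ J) G h J c z (covV (gammaL θ J) x z w) (y z) (y' z)
        + bf f (gammaL θ J) G h J c z (x z) (covV (gammaL θ J) y z w) (y' z)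
        + bf f (gammaL θ J) G h J c z (x z) (y z) (covV (gammaL θ J) y' z w) := by
  have dJ : ∀ {x : V → V}, DifferentiableAt ℝ x z → DifferentiableAt ℝ (fun y => J y (x y)) z :=
    fun hx => (H.dJ (hU hz)).clm_apply hx
  have da : ∀ {x : V → V}, DifferentiableAt ℝ x z →
      DifferentiableAt ℝ (fun y => fderiv ℝ f y (x y)) z := fun hx => (L.ddf hz).clm_apply hx
  have dβ : ∀ {x y : V → V}, DifferentiableAt ℝ x z → DifferentiableAt ℝ y z →
      DifferentiableAt ℝ (fun p => sff f (gammaL θ J) G p (x p) (y p)) z :=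
    fun hx hy => ((L.dsff hz).clm_apply hx).clm_apply hy
  have dh : ∀ {s t : V → W}, DifferentiableAt ℝ s z → DifferentiableAt ℝ t z →
      DifferentiableAt ℝ (fun p => h (f p) (s p) (t p)) z :=
    fun hx hy => ((L.dhf hz).clm_apply hx).clm_apply hy
  have key : ∀ {x y x' : V → V}, DifferentiableAt ℝ x z → DifferentiableAt ℝ y z →
      DifferentiableAt ℝ x' z → fderiv ℝ (fun p => h (f p) (sff f (gammaL θ J) G p (x p) (y p))
        (fderiv ℝ f p (x' p))) z w
      = h (f z) (tff f (gammaL θ J) G z (x z) (y z) w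
          + sff f (gammaL θ J) G z (covV (gammaL θ J) x z w) (y z)
          + sff f (gammaL θ J) G z (x z) (covV (gammaL θ J) y z w)) (fderiv ℝ f z (x' z))
        + h (f z) (sff f (gammaL θ J) G z (x z) (y z))
          (sff f (gammaL θ J) G z (x' z) w + fderiv ℝ f z (covV (gammaL θ J) x' z w)) := by
    intro x y x' hx hy hx'
    rw [L.fderiv_inner hz (dβ hx hy) (da hx'), L.covS_sff hz hx hy, L.covS_df hz hx']
  simp only [bf, bform]
  rw [fderiv_fun_sub ((dh (dβ hx hy) (da hy')).fun_sub (dh (dβ (dJ hx) hy) (da (dJ hy'))))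
      (((dh (dβ hy hy') (da hx)).fun_add (dh (dβ hy (dJ hy')) (da (dJ hx)))).const_mul c),
    fderiv_fun_sub (dh (dβ hx hy) (da hy')) (dh (dβ (dJ hx) hy) (da (dJ hy'))),
    fderiv_const_mul ((dh (dβ hy hy') (da hx)).fun_add (dh (dβ hy (dJ hy')) (da (dJ hx)))),
    fderiv_fun_add (dh (dβ hy hy') (da hx)) (dh (dβ hy (dJ hy')) (da (dJ hx)))]
  simp only [sub_apply, add_apply, smul_apply, smul_eq_mul, key hx hy hy', key (dJ hx) hy (dJ hy'),
    key hy hy' hx, key hy (dJ hy') (dJ hx), covV_J H hU hz hx, covV_J H hU hz hy', bfD, bformD,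
    map_add]
  ring

variable (E : FrameL θ J z e)

lemma differentiableAt_bocF {x : V → V} (hx : DifferentiableAt ℝ x z) :
    DifferentiableAt ℝ (fun p => bocF f (gammaL θ J) G h J c b θ p (x p)) z :=
  DifferentiableAt.fun_sum fun _ _ => differentiableAt_bf L H hU hz hx (differentiableAt_const _)
    (differentiableAt_cog H hU hz _)

include E

omit L in
lemma bocF_frame (u : V) : bocF f (gammaL θ J) G h J c b θ z u
    = ∑ B, bf f (gammaL θ J) G h J c z u (frm (J z) e B) (frm (J z) e B) :=
  E.sum_cog_left b H (hU hz) (bf₂₃ f (gammaL θ J) G h J c z u) (.id ℝ V)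

/-- Neither the fixed basis nor `cog` of its dual is parallel, but their Christoffel contributions
are opposite: `FrameL.sum_cog_left` and `FrameL.sum_cog_right` give the same frame trace. So the
trace commutes with ∇. -/
lemma fderiv_bocF {x : V → V} (hx : DifferentiableAt ℝ x z) (w : V) :
    fderiv ℝ (fun p => bocF f (gammaL θ J) G h J c b θ p (x p)) z w
      = ∑ B, bfD f (gammaL θ J) G h J c z w (x z) (frm (J z) e B) (frm (J z) e B)
        + bocF f (gammaL θ J) G h J c b θ z (covV (gammaL θ J) x z w) := by
  have dc := fun i => differentiableAt_cog H hU hz (cf b i)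
  have db := fun i => differentiableAt_bf (c := c) L H hU hz hx (differentiableAt_const (b i)) (dc i)
  have h1 := E.sum_cog_left b H (hU hz) (bf₂₃ f (gammaL θ J) G h J c z (x z)) (gammaL θ J z w)
  have h2 := E.sum_cog_right b H (hU hz) (bf₂₃ f (gammaL θ J) G h J c z (x z)) (gammaL θ J z w)
  have h3 := E.sum_cog_left b H (hU hz) (bfD₃₄ f (gammaL θ J) G h J c z w (x z)) (.id ℝ V)
  have h4 : ∀ i, bf f (gammaL θ J) G h J c z (x z) (b i)
        (-cog θ J z ((cf b i).comp (gammaL θ J z w)))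
      = -(bf₂₃ f (gammaL θ J) G h J c z (x z)) (b i) (cog θ J z ((cf b i).comp (gammaL θ J z w))) :=
    fun i => map_neg (bf₂₃ f (gammaL θ J) G h J c z (x z) (b i)) _
  simp only [bocF]
  rw [fderiv_fun_sum fun i _ => db i, sum_apply]
  simp only [fderiv_bf L H hU hz hx (differentiableAt_const _) (dc _), covV_const,
    covV_cog H hU hz, h4, Finset.sum_add_distrib, Finset.sum_neg_distrib, h2]
  rw [← h1, ← sub_eq_add_neg, add_sub_assoc]
  have h5 : ∑ i, bf f (gammaL θ J) G h J c z (x z) (gammaL θ J z w (b i)) (cog θ J z (cf b i))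
    = ∑ i, bf₂₃ f (gammaL θ J) G h J c z (x z) (gammaL θ J z w (b i)) (cog θ J z (cf b i)) := rfl
  rw [h5, sub_self, add_zero]
  congr 1

omit L in
lemma bocV_frame : bocV f (gammaL θ J) G h J c b θ z
    = ∑ A, bocF f (gammaL θ J) G h J c b θ z (frm (J z) e A) • frm (J z) e A :=
  E.sum_cog_left b H (hU hz) (bocT f (gammaL θ J) G h J c b θ z) (.id ℝ V)

omit L in
lemma θ_bocV : θ z (bocV f (gammaL θ J) G h J c b θ z) = 0 := by
  rw [bocV_frame H hU hz E, map_sum]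
  exact Finset.sum_eq_zero fun A _ => by rw [map_smul, E.horizontal, smul_zero]

lemma covV_bocV (w : V) : covV (gammaL θ J) (bocV f (gammaL θ J) G h J c b θ) z w
    = ∑ A, (∑ B, bfD f (gammaL θ J) G h J c z w (frm (J z) e A) (frm (J z) e B) (frm (J z) e B))
      • frm (J z) e A := by
  have dc := fun i => differentiableAt_cog H hU hz (cf b i)
  have dF := fun i => differentiableAt_bocF (c := c) (b := b) L H hU hz (differentiableAt_const (b i))
  have h1 := E.sum_cog_left b H (hU hz) (bocT f (gammaL θ J) G h J c b θ z) (gammaL θ J z w)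
  have h2 := E.sum_cog_right b H (hU hz) (bocT f (gammaL θ J) G h J c b θ z) (gammaL θ J z w)
  let T : V →ₗ[ℝ] V →ₗ[ℝ] V :=
    ∑ B, ((bfD₁₂ f (gammaL θ J) G h J c z (frm (J z) e B) (frm (J z) e B) w).smulRight
      (LinearMap.id : V →ₗ[ℝ] V))
  have hT : ∀ u v, T u v
      = (∑ B, bfD f (gammaL θ J) G h J c z w u (frm (J z) e B) (frm (J z) e B)) • v := by
    intro u v
    simp only [T, LinearMap.sum_apply, LinearMap.smulRight_apply, LinearMap.smul_apply,
      LinearMap.id_apply, Finset.sum_smul]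
    rfl
  have h3 := E.sum_cog_left b H (hU hz) T (.id ℝ V)
  simp only [hT, ContinuousLinearMap.id_apply] at h3
  have e1 : fderiv ℝ (bocV f (gammaL θ J) G h J c b θ) z
      = fderiv ℝ (fun p => ∑ i, bocF f (gammaL θ J) G h J c b θ p (b i) • cog θ J p (cf b i)) z := rfl
  have hcov : ∀ i, fderiv ℝ (fun y => cog θ J y (cf b i)) z w
      = -gammaL θ J z w (cog θ J z (cf b i)) - cog θ J z ((cf b i).comp (gammaL θ J z w)) := fun i =>
    H.fderiv_cog (hU hz) _ _
  rw [covV, e1, fderiv_fun_sum fun i _ => (dF i).fun_smul (dc i), sum_apply]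
  simp only [fderiv_fun_smul (dF _) (dc _), add_apply, smul_apply, ContinuousLinearMap.smulRight_apply,
    fderiv_bocF L H hU hz E (differentiableAt_const _), covV_const, hcov, smul_sub, smul_neg, bocV,
    map_sum, map_smul]
  rw [← h3, ← sub_eq_zero, ← Finset.sum_add_distrib, ← Finset.sum_sub_distrib]
  have h4 : ∑ i, (bocF f (gammaL θ J) G h J c b θ z (gammaL θ J z w (b i)) • cog θ J z (cf b i)
      - bocF f (gammaL θ J) G h J c b θ z (b i) • cog θ J z ((cf b i).comp (gammaL θ J z w))) = 0 := by
    rw [Finset.sum_sub_distrib, sub_eq_zero]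
    exact h1.trans h2.symm
  refine Eq.trans (Finset.sum_congr rfl fun i _ => ?_) h4
  module

-- The difference of the two sides is the trace of v ↦ T_∇(v, X), namely dθ(T, X) + θ(τX) = 0.
omit L E in
lemma trace_gamma {X : V} (hX : θ z X = 0) :
    ∑ k, cf b k (gammaL θ J z (b k) X) = ∑ k, cf b k (gammaL θ J z X (b k)) := by
  rw [← sub_eq_zero, ← Finset.sum_sub_distrib]
  have h1 := sum_cf_map b ((levi θ z).flip X).toLinearMap (reebL θ z)
  have h2 := sum_cf_map b (θ z).toLinearMap (tauL θ J z X)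
  have e1 : ((levi θ z).flip X).toLinearMap (reebL θ z) = 0 := H.levi_reeb (hU hz) X
  have e2 : (θ z).toLinearMap (tauL θ J z X) = 0 := H.θ_tau (hU hz) X
  rw [e1] at h1
  rw [e2] at h2
  refine Eq.trans (Finset.sum_congr rfl fun k _ => ?_)
    ((Finset.sum_add_distrib.trans (congrArg₂ (· + ·) h1 h2)).trans (add_zero 0))
  rw [← map_sub, H.gamma_torsion (hU hz), torL_apply, hX]
  simp only [map_add, map_smul, zero_smul, sub_zero, smul_eq_mul]
  simp only [ContinuousLinearMap.coe_coe, ContinuousLinearMap.flip_apply]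
  ring

/-- The divergence of `bocV`. -/
lemma div_bocV :
    ∑ k, cf b k (fderiv ℝ (bocV f (gammaL θ J) G h J c b θ) z (b k))
      + ∑ k, cf b k (gammaL θ J z (bocV f (gammaL θ J) G h J c b θ z) (b k))
    = ∑ A, ∑ B, bfD f (gammaL θ J) G h J c z (frm (J z) e A) (frm (J z) e A) (frm (J z) e B)
        (frm (J z) e B) := by
  -- The traces of Γ_X, which come from the volume density, become traces of v ↦ Γ_v X, so that the
  -- left side is the trace of ∇X for X = `bocV`.
  rw [← trace_gamma H hU hz (θ_bocV H hU hz E), ← Finset.sum_add_distrib]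
  have : ∀ k, cf b k (fderiv ℝ (bocV f (gammaL θ J) G h J c b θ) z (b k))
      + cf b k (gammaL θ J z (b k) (bocV f (gammaL θ J) G h J c b θ z))
      = ∑ A, cf b k (frm (J z) e A) * ∑ B, bfD f (gammaL θ J) G h J c z (b k) (frm (J z) e A)
        (frm (J z) e B) (frm (J z) e B) := by
    intro k
    rw [← map_add]
    have := covV_bocV (c := c) (b := b) L H hU hz E (b k)
    rw [covV] at this
    rw [this, map_sum]
    exact Finset.sum_congr rfl fun A _ => by rw [map_smul, smul_eq_mul, mul_comm]
  simp only [this]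
  rw [Finset.sum_comm]
  refine Finset.sum_congr rfl fun A _ => ?_
  simp only [Finset.mul_sum]
  rw [Finset.sum_comm]
  refine Finset.sum_congr rfl fun B _ => ?_
  exact sum_cf_map b ((bfD₁₂ f (gammaL θ J) G h J c z (frm (J z) e B) (frm (J z) e B)).flip
    (frm (J z) e A)) (frm (J z) e A)

end Bochner

/-! ### The Bochner formula -/

section Curvature

variable {V : Type*} [NormedAddCommGroup V] [NormedSpace ℝ V]

lemma curvL_swap (Γ : V → V →L[ℝ] V →L[ℝ] V) (z u v w : V) :
    curvL Γ z u v w = -curvL Γ z v u w := by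
  simp only [curvL]; abel

lemma curvL_neg₁ (Γ : V → V →L[ℝ] V →L[ℝ] V) (z u v w : V) :
    curvL Γ z (-u) v w = -curvL Γ z u v w := by
  simp only [curvL, map_neg, neg_apply]; abel

lemma curvL_neg₂ (Γ : V → V →L[ℝ] V →L[ℝ] V) (z u v w : V) :
    curvL Γ z u (-v) w = -curvL Γ z u v w := by
  simp only [curvL, map_neg, neg_apply]; abel

lemma curvL_neg₃ (Γ : V → V →L[ℝ] V →L[ℝ] V) (z u v w : V) :
    curvL Γ z u v (-w) = -curvL Γ z u v w := by
  simp only [curvL, map_neg]; abel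

variable [FiniteDimensional ℝ V] {m : ℕ} {U : Set V} {θ : V → V →L[ℝ] ℝ} {J : V → V →L[ℝ] V}
  {z : V} {e : Fin m → V}

/-- `∑_A R(ε_A, v) ε_A`. -/
def ricL (θ : V → V →L[ℝ] ℝ) (J : V → V →L[ℝ] V) (e : Fin m → V) (z v : V) : V :=
  ∑ A, curvL (gammaL θ J) z (frm (J z) e A) v (frm (J z) e A)

variable (E : FrameL θ J z e)

include E in
lemma FrameL.J_J (A) : J z (J z (frm (J z) e A)) = -frm (J z) e A := by
  rcases A with α | α
  · exact E.J_e α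
  · simp only [frm, Sum.elim_inr]
    rw [E.J_e, map_neg]

include E in
lemma FrameL.sum_map {F : Type*} [AddCommGroup F] [Module ℝ F] (X : V →ₗ[ℝ] F) {v : V}
    (hv : θ z v = 0) : ∑ A, websterL θ J z (frm (J z) e A) v • X (frm (J z) e A) = X v := by
  conv_rhs => rw [E.expand v hv, map_sum]
  simp only [map_smul]

variable (H : LocalCR U θ J) (hz : z ∈ U)
include E H hz

lemma FrameL.levi_left {A} {v : V} :
    levi θ z (frm (J z) e A) v = -websterL θ J z (frm (J z) e A) (J z v) := by
  rw [H.levi_eq hz, H.g_J hz]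

lemma FrameL.levi_left_J {A} {v : V} :
    levi θ z (J z (frm (J z) e A)) v = -websterL θ J z (frm (J z) e A) v := by
  rw [H.levi_eq hz, E.J_J, map_neg, neg_apply]

/-- Contract the Bianchi identity for (ε_A, Jε_A, v). As R commutes with J, this gives ∑ R(ε_A,
Jε_A)v - 2 J Ric v = 2(m - 1) τv, where Ric v is `ricL`: the term 2m comes from ∑ dθ(ε_A, Jε_A), and
the two others contribute -1 each. Comparing J times this identity with the one for Jv eliminates
the first sum, and τJ = -Jτ makes the torsion terms add up. -/
lemma ricL_add {v : V} (hv : θ z v = 0) : ricL θ J e z v + J z (ricL θ J e z (J z v))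
    = (2 * (1 - (m : ℝ))) • tauL θ J z (J z v) := by
  set ε := frm (J z) e with hε
  set R := curvL (gammaL θ J) z with hR
  have base : ∀ v, θ z v = 0 → ∑ A, R (ε A) (J z (ε A)) v - (2 : ℝ) • J z (ricL θ J e z v)
      = (2 * ((m : ℝ) - 1)) • tauL θ J z v := by
    intro v hv
    have hB := fun A => H.bianchi hz (E.horizontal A) (H.θ_J hz (ε A)) hv
    have hsum := Finset.sum_congr (rfl : (Finset.univ : Finset (Fin m ⊕ Fin m)) = _)
      (fun A _ => hB A)
    simp only [Finset.sum_add_distrib] at hsum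
    have s1 : ∑ A, R (J z (ε A)) v (ε A) = -∑ A, R (ε A) v (J z (ε A)) :=
      E.sum_J_left (fun u w => R u v w) (fun u w => curvL_neg₁ _ z u v w)
        fun u w => curvL_neg₃ _ z u v w
    have s2 : ∑ A, R v (ε A) (J z (ε A)) = -∑ A, R (ε A) v (J z (ε A)) := by
      rw [← Finset.sum_neg_distrib]
      exact Finset.sum_congr rfl fun A _ => curvL_swap _ z _ _ _
    have s3 : ∑ A, R (ε A) v (J z (ε A)) = J z (ricL θ J e z v) := by
      rw [ricL, map_sum]
      exact Finset.sum_congr rfl fun A _ => H.curv_J hz _ _ _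
    have t1 : ∑ A, levi θ z (ε A) (J z (ε A)) • tauL θ J z v = (2 * (m : ℝ)) • tauL θ J z v := by
      have : ∀ A, levi θ z (ε A) (J z (ε A)) = 1 := fun A => by
        rw [H.levi_eq hz, E.norm_J H hz]
      simp only [this, one_smul, Finset.sum_const, Finset.card_univ, Fintype.card_sum,
        Fintype.card_fin]
      rw [← Nat.cast_smul_eq_nsmul ℝ]
      push_cast
      congr 1
      ring
    have t2 : ∑ A, levi θ z (J z (ε A)) v • tauL θ J z (ε A) = -tauL θ J z v := by
      have : ∀ A, levi θ z (J z (ε A)) v • tauL θ J z (ε A)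
          = -(websterL θ J z (ε A) v • (tauL θ J z).toLinearMap (ε A)) := fun A => by
        rw [E.levi_left_J H hz, neg_smul]; rfl
      simp only [this]
      rw [Finset.sum_neg_distrib, E.sum_map _ hv]
      rfl
    have t3 : ∑ A, levi θ z v (ε A) • tauL θ J z (J z (ε A)) = -tauL θ J z v := by
      have : ∀ A, levi θ z v (ε A) • tauL θ J z (J z (ε A))
          = websterL θ J z (ε A) (J z v) • ((tauL θ J z).comp (J z)).toLinearMap (ε A) := fun A => by
        rw [levi_swap, E.levi_left H hz, neg_neg]; rfl
      simp only [this]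
      rw [E.sum_map _ (H.θ_J hz v)]
      change tauL θ J z (J z (J z v)) = _
      rw [H.J_sq z hz v hv, map_neg]
    simp only [← hε, ← hR] at hsum
    rw [s1, s2, s3, t1, t2, t3, ← sub_eq_zero] at hsum
    rw [← sub_eq_zero]
    refine Eq.trans ?_ hsum
    module
  have h1 := base v hv
  have h2 := base (J z v) (H.θ_J hz v)
  have h3 : ∑ A, R (ε A) (J z (ε A)) (J z v) = J z (∑ A, R (ε A) (J z (ε A)) v) := by
    rw [map_sum]
    exact Finset.sum_congr rfl fun A _ => H.curv_J hz _ _ _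
  -- J² = -1 holds only on H. The contraction is horizontal because each ε_A is -J(Jε_A) and J
  -- passes through the curvature.
  have h4 : J z (J z (ricL θ J e z v)) = -ricL θ J e z v := by
    refine H.J_sq z hz _ ?_
    rw [ricL, map_sum]
    refine Finset.sum_eq_zero fun A _ => ?_
    have : frm (J z) e A = -J z (J z (frm (J z) e A)) := by rw [E.J_J, neg_neg]
    conv_lhs => arg 2; rw [this, curvL_neg₃, H.curv_J hz]
    rw [map_neg, H.θ_J hz, neg_zero]
  have h5 := congrArg (J z) h1
  rw [map_sub, map_smul, map_smul, h4, ← neg_eq_iff_eq_neg.2 (H.tau_J hz v)] at h5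
  rw [h3] at h2
  have h6 := congrArg₂ (· - ·) h5 h2
  rw [← sub_eq_zero] at h6 ⊢
  have h7 := congrArg (fun x => (1 / 2 : ℝ) • x) h6
  simp only [smul_zero] at h7
  refine Eq.trans ?_ h7
  module

end Curvature

/-! ### Commutation of third derivatives and sign of the quadratic terms. -/

section BochnerFormula

variable {V W : Type*} [NormedAddCommGroup V] [NormedSpace ℝ V] [FiniteDimensional ℝ V]
  [NormedAddCommGroup W] [NormedSpace ℝ W]

/-- `∑_{A, B} ⟨C(A, A, B), a B⟩ + ⟨C(A, JA, B), a J B⟩ + 2m ∑_B ⟨a τ J B, a B⟩`. -/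
def pairL {m : ℕ} (h : W →L[ℝ] W →L[ℝ] ℝ) (a : V →L[ℝ] W) (C : V → V → V → W) (J τ : V →L[ℝ] V)
    (e : Fin m → V) : ℝ :=
  ∑ A, ∑ B, h (C (frm J e A) (frm J e A) (frm J e B)) (a (frm J e B))
    + ∑ A, ∑ B, h (C (frm J e A) (J (frm J e A)) (frm J e B)) (a (J (frm J e B)))
    + 2 * m * ∑ B, h (a (τ (J (frm J e B)))) (a (frm J e B))

/-- `∑_{A, B} ⟨R(aA, aB) aA, aB⟩ + ⟨R(a J A, aB) aA, a J B⟩`. -/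
def hermL {m : ℕ} (h : W →L[ℝ] W →L[ℝ] ℝ) (a : V →L[ℝ] W) (R : W → W → W → W) (J : V →L[ℝ] V)
    (e : Fin m → V) : ℝ :=
  ∑ A, ∑ B, h (R (a (frm J e A)) (a (frm J e B)) (a (frm J e A))) (a (frm J e B))
    + ∑ A, ∑ B, h (R (a (J (frm J e A))) (a (frm J e B)) (a (frm J e A))) (a (J (frm J e B)))

/-- The quadratic terms of the Bochner formula. -/
def quadL {m : ℕ} (h : W →L[ℝ] W →L[ℝ] ℝ) (β : V →L[ℝ] V →L[ℝ] W) (J : V →L[ℝ] V)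
    (c : ℝ) (e : Fin m → V) : ℝ :=
  ∑ A, ∑ B, h (β (frm J e A) (frm J e B)) (β (frm J e B) (frm J e A))
    - ∑ A, ∑ B, h (β (J (frm J e A)) (frm J e B)) (β (J (frm J e B)) (frm J e A))
    - c * (h (∑ A, β (frm J e A) (frm J e A)) (∑ A, β (frm J e A) (frm J e A))
      - h (∑ A, β (frm J e A) (J (frm J e A))) (∑ A, β (frm J e A) (J (frm J e A))))

variable {f : V → W} {G : W → W →L[ℝ] W →L[ℝ] W} {z : V}
  {h : W → W →L[ℝ] W →L[ℝ] ℝ} {J : V → V →L[ℝ] V} {c : ℝ} {θ : V → V →L[ℝ] ℝ}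
  {U U₀ : Set V} {U' : Set W} {m : ℕ} {e : Fin m → V}
  (L : LocalMap U U' f (gammaL θ J) h G) (H : LocalCR U₀ θ J) (hU : U ⊆ U₀) (hz : z ∈ U)
  (E : FrameL θ J z e)

include L H hU hz E

/-- The Ricci identity in the last two slots. The curvature of M contracts to `ricL`, and since
horizontal torsion is dθ ⊗ T, the contraction over A turns the torsion term into a second derivative
in the direction T. -/
lemma sum_tff₁ : ∑ A, ∑ B, h (f z) (tff f (gammaL θ J) G z (frm (J z) e A) (frm (J z) e B)
        (frm (J z) e A)) (fderiv ℝ f z (frm (J z) e B))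
    = ∑ A, ∑ B, h (f z) (tff f (gammaL θ J) G z (frm (J z) e A) (frm (J z) e A)
        (frm (J z) e B)) (fderiv ℝ f z (frm (J z) e B))
      + ∑ A, ∑ B, h (f z) (curvL G (f z) (fderiv ℝ f z (frm (J z) e A))
        (fderiv ℝ f z (frm (J z) e B)) (fderiv ℝ f z (frm (J z) e A)))
          (fderiv ℝ f z (frm (J z) e B))
      - ∑ B, h (f z) (fderiv ℝ f z (ricL θ J e z (frm (J z) e B))) (fderiv ℝ f z (frm (J z) e B))
      + ∑ B, h (f z) (sff f (gammaL θ J) G z (J z (frm (J z) e B)) (reebL θ z))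
          (fderiv ℝ f z (frm (J z) e B)) := by
  have hz₀ := hU hz
  have e1 : ∀ A B, tff f (gammaL θ J) G z (frm (J z) e A) (frm (J z) e B) (frm (J z) e A)
      = tff f (gammaL θ J) G z (frm (J z) e A) (frm (J z) e A) (frm (J z) e B)
        + curvL G (f z) (fderiv ℝ f z (frm (J z) e A))
          (fderiv ℝ f z (frm (J z) e B)) (fderiv ℝ f z (frm (J z) e A))
        - fderiv ℝ f z (curvL (gammaL θ J) z (frm (J z) e A) (frm (J z) e B) (frm (J z) e A))
        + websterL θ J z (frm (J z) e A) (J z (frm (J z) e B)) •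
          ((sff f (gammaL θ J) G z).flip (reebL θ z)).toLinearMap (frm (J z) e A) := by
    intro A B
    have := L.tff_swap hz (frm (J z) e A) (frm (J z) e B) (frm (J z) e A)
    rw [H.gamma_torsion hz₀, LocalCR.tor_horizontal (E.horizontal A) (E.horizontal B), map_smul,
      E.levi_left H hz₀, neg_smul, sub_neg_eq_add, sub_eq_iff_eq_add] at this
    rw [this]
    simp only [ContinuousLinearMap.coe_coe, ContinuousLinearMap.flip_apply]
    abel
  simp only [e1, map_add, map_sub, add_apply, sub_apply, Finset.sum_add_distrib,
    Finset.sum_sub_distrib]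
  congr 1
  · congr 1
    rw [Finset.sum_comm]
    refine Finset.sum_congr rfl fun B _ => ?_
    rw [ricL, map_sum, map_sum, sum_apply]
  · rw [Finset.sum_comm]
    refine Finset.sum_congr rfl fun B _ => ?_
    rw [← sum_apply, ← map_sum, E.sum_map _ (H.θ_J hz₀ _)]
    rfl

/-- First J moves from the first slot to the third by `FrameL.sum_J_left`, so that the Ricci
identity carries it into the second slot, as `pairL` requires. The curvature of M appears with one
more J, pulled out because R commutes with J. -/
lemma sum_tff₂ : ∑ A, ∑ B, h (f z) (tff f (gammaL θ J) G z (J z (frm (J z) e A)) (frm (J z) e B)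
        (frm (J z) e A)) (fderiv ℝ f z (J z (frm (J z) e B)))
    = -(∑ A, ∑ B, h (f z) (tff f (gammaL θ J) G z (frm (J z) e A) (J z (frm (J z) e A))
        (frm (J z) e B)) (fderiv ℝ f z (J z (frm (J z) e B)))
      + ∑ A, ∑ B, h (f z) (curvL G (f z) (fderiv ℝ f z (J z (frm (J z) e A)))
        (fderiv ℝ f z (frm (J z) e B)) (fderiv ℝ f z (frm (J z) e A)))
          (fderiv ℝ f z (J z (frm (J z) e B)))
      + ∑ B, h (f z) (fderiv ℝ f z (J z (ricL θ J e z (frm (J z) e B))))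
          (fderiv ℝ f z (J z (frm (J z) e B)))
      + ∑ B, h (f z) (sff f (gammaL θ J) G z (frm (J z) e B) (reebL θ z))
          (fderiv ℝ f z (J z (frm (J z) e B)))) := by
  have hz₀ := hU hz
  have e0 : ∀ B, ∑ A, tff f (gammaL θ J) G z (J z (frm (J z) e A)) (frm (J z) e B) (frm (J z) e A)
      = -∑ A, tff f (gammaL θ J) G z (frm (J z) e A) (frm (J z) e B) (J z (frm (J z) e A)) := fun B =>
    E.sum_J_left (fun u w => tff f (gammaL θ J) G z u (frm (J z) e B) w)
      (fun u w => tff_neg₁ _ _ _ _ _ _ _) fun u w => tff_neg₃ _ _ _ _ _ _ _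
  have e1 : ∀ A B, tff f (gammaL θ J) G z (frm (J z) e A) (frm (J z) e B) (J z (frm (J z) e A))
      = tff f (gammaL θ J) G z (frm (J z) e A) (J z (frm (J z) e A)) (frm (J z) e B)
        + curvL G (f z) (fderiv ℝ f z (J z (frm (J z) e A)))
          (fderiv ℝ f z (frm (J z) e B)) (fderiv ℝ f z (frm (J z) e A))
        - fderiv ℝ f z (curvL (gammaL θ J) z (J z (frm (J z) e A)) (frm (J z) e B) (frm (J z) e A))
        + websterL θ J z (frm (J z) e A) (frm (J z) e B) •
          ((sff f (gammaL θ J) G z).flip (reebL θ z)).toLinearMap (frm (J z) e A) := by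
    intro A B
    have := L.tff_swap hz (frm (J z) e A) (frm (J z) e B) (J z (frm (J z) e A))
    rw [H.gamma_torsion hz₀, LocalCR.tor_horizontal (H.θ_J hz₀ _) (E.horizontal B), map_smul,
      E.levi_left_J H hz₀, neg_smul, sub_neg_eq_add, sub_eq_iff_eq_add] at this
    rw [this]
    simp only [ContinuousLinearMap.coe_coe, ContinuousLinearMap.flip_apply]
    abel
  have e2 : ∀ B, ∑ A, curvL (gammaL θ J) z (J z (frm (J z) e A)) (frm (J z) e B) (frm (J z) e A)
      = -J z (ricL θ J e z (frm (J z) e B)) := by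
    intro B
    rw [E.sum_J_left (fun u w => curvL (gammaL θ J) z u (frm (J z) e B) w)
      (fun u w => curvL_neg₁ _ _ _ _ _) fun u w => curvL_neg₃ _ _ _ _ _, ricL, map_sum]
    exact congrArg Neg.neg (Finset.sum_congr rfl fun A _ => H.curv_J hz₀ _ _ _)
  have e3 : ∀ B, ∑ A, tff f (gammaL θ J) G z (J z (frm (J z) e A)) (frm (J z) e B) (frm (J z) e A)
      = -(∑ A, tff f (gammaL θ J) G z (frm (J z) e A) (J z (frm (J z) e A)) (frm (J z) e B)
        + ∑ A, curvL G (f z) (fderiv ℝ f z (J z (frm (J z) e A)))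
          (fderiv ℝ f z (frm (J z) e B)) (fderiv ℝ f z (frm (J z) e A))
        + fderiv ℝ f z (J z (ricL θ J e z (frm (J z) e B)))
        + sff f (gammaL θ J) G z (frm (J z) e B) (reebL θ z)) := by
    intro B
    rw [e0]
    simp only [e1, Finset.sum_add_distrib, Finset.sum_sub_distrib]
    rw [E.sum_map _ (E.horizontal B), ← map_sum, e2, map_neg, sub_neg_eq_add]
    rfl
  rw [Finset.sum_comm]
  have e4 : ∀ B, ∑ A, h (f z) (tff f (gammaL θ J) G z (J z (frm (J z) e A)) (frm (J z) e B)
        (frm (J z) e A)) (fderiv ℝ f z (J z (frm (J z) e B)))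
      = h (f z) (∑ A, tff f (gammaL θ J) G z (J z (frm (J z) e A)) (frm (J z) e B)
        (frm (J z) e A)) (fderiv ℝ f z (J z (frm (J z) e B))) := fun B => by
    rw [map_sum, sum_apply]
  simp only [e4, e3, map_neg, map_add, neg_apply, add_apply, map_sum, sum_apply,
    Finset.sum_neg_distrib, Finset.sum_add_distrib]
  rw [Finset.sum_comm, Finset.sum_comm (f := fun A B => h (f z) (curvL G (f z)
    (fderiv ℝ f z (J z (frm (J z) e A))) (fderiv ℝ f z (frm (J z) e B))
    (fderiv ℝ f z (frm (J z) e A))) (fderiv ℝ f z (J z (frm (J z) e B))))]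

/-- The Bochner formula. -/
lemma sum_bfD (hm : (m : ℝ) ≠ 0) :
    ∑ A, ∑ B, bfD f (gammaL θ J) G h J (1 / m) z (frm (J z) e A) (frm (J z) e A) (frm (J z) e B)
        (frm (J z) e B)
      = ((m : ℝ) - 1) / m * pairL (h (f z)) (fderiv ℝ f z) (tff f (gammaL θ J) G z) (J z)
          (tauL θ J z) e
        + hermL (h (f z)) (fderiv ℝ f z) (curvL G (f z)) (J z) e
        + quadL (h (f z)) (sff f (gammaL θ J) G z) (J z) (1 / m) e := by
  have hz₀ := hU hz
  -- The derivatives in the direction T left by the two commutations are opposite; this is the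
  -- effect of combining the two leading terms of Θ.
  have r1 : ∑ B, h (f z) (sff f (gammaL θ J) G z (J z (frm (J z) e B)) (reebL θ z))
        (fderiv ℝ f z (frm (J z) e B))
      = -∑ B, h (f z) (sff f (gammaL θ J) G z (frm (J z) e B) (reebL θ z))
        (fderiv ℝ f z (J z (frm (J z) e B))) :=
    E.sum_J_left (fun u v => h (f z) (sff f (gammaL θ J) G z u (reebL θ z)) (fderiv ℝ f z v))
      (fun u v => by simp) fun u v => by simp
  have r2 : ∑ B, h (f z) (fderiv ℝ f z (J z (ricL θ J e z (frm (J z) e B))))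
        (fderiv ℝ f z (J z (frm (J z) e B)))
      = -∑ B, h (f z) (fderiv ℝ f z (J z (ricL θ J e z (J z (frm (J z) e B)))))
        (fderiv ℝ f z (frm (J z) e B)) := by
    have hr : ∀ v, ricL θ J e z (-v) = -ricL θ J e z v := fun v => by
      simp only [ricL, curvL_neg₂, Finset.sum_neg_distrib]
    exact E.sum_J_left (fun u v => h (f z) (fderiv ℝ f z (J z (ricL θ J e z v))) (fderiv ℝ f z u))
      (fun u v => by simp) fun u v => by simp [hr]
  -- The curvature of M occurs only in this combination. Its factor 2(1 - m) matches (m - 1)/m times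
  -- the coefficient 2m of the torsion in `pairL`.
  have r3 : ∑ B, h (f z) (fderiv ℝ f z (ricL θ J e z (frm (J z) e B))) (fderiv ℝ f z (frm (J z) e B))
      + ∑ B, h (f z) (fderiv ℝ f z (J z (ricL θ J e z (J z (frm (J z) e B)))))
        (fderiv ℝ f z (frm (J z) e B))
      = (2 * (1 - (m : ℝ))) * ∑ B, h (f z) (fderiv ℝ f z (tauL θ J z (J z (frm (J z) e B))))
        (fderiv ℝ f z (frm (J z) e B)) := by
    rw [← Finset.sum_add_distrib, Finset.mul_sum]
    refine Finset.sum_congr rfl fun B _ => ?_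
    rw [← add_apply, ← map_add, ← map_add, ricL_add E H hz₀ (E.horizontal B), map_smul, map_smul,
      smul_apply, smul_eq_mul]
  have r4 : ∑ A, sff f (gammaL θ J) G z (J z (frm (J z) e A)) (frm (J z) e A)
      = -∑ A, sff f (gammaL θ J) G z (frm (J z) e A) (J z (frm (J z) e A)) :=
    E.sum_J_left (fun u v => sff f (gammaL θ J) G z u v)
      (fun u v => by simp) fun u v => by simp
  have r5 : ∑ A, ∑ B, h (f z) (sff f (gammaL θ J) G z (frm (J z) e B) (frm (J z) e B))
        (sff f (gammaL θ J) G z (frm (J z) e A) (frm (J z) e A))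
      = h (f z) (∑ A, sff f (gammaL θ J) G z (frm (J z) e A) (frm (J z) e A))
        (∑ A, sff f (gammaL θ J) G z (frm (J z) e A) (frm (J z) e A)) := by
    simp only [map_sum, sum_apply]
  have r6 : ∑ A, ∑ B, h (f z) (sff f (gammaL θ J) G z (frm (J z) e B) (J z (frm (J z) e B)))
        (sff f (gammaL θ J) G z (J z (frm (J z) e A)) (frm (J z) e A))
      = -h (f z) (∑ A, sff f (gammaL θ J) G z (frm (J z) e A) (J z (frm (J z) e A)))
        (∑ A, sff f (gammaL θ J) G z (frm (J z) e A) (J z (frm (J z) e A))) := by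
    rw [← map_neg, ← r4]
    simp only [map_sum, sum_apply]
  have r7 : ∑ A, ∑ B, h (f z) (tff f (gammaL θ J) G z (frm (J z) e B) (frm (J z) e B)
        (frm (J z) e A)) (fderiv ℝ f z (frm (J z) e A)) = _ := Finset.sum_comm
  have r8 : ∑ A, ∑ B, h (f z) (tff f (gammaL θ J) G z (frm (J z) e B) (J z (frm (J z) e B))
        (frm (J z) e A)) (fderiv ℝ f z (J z (frm (J z) e A))) = _ := Finset.sum_comm
  have h1 := sum_tff₁ L H hU hz E
  have h2 := sum_tff₂ L H hU hz E
  simp only [bfD, bformD, Finset.sum_add_distrib, Finset.sum_sub_distrib, ← Finset.mul_sum]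
  rw [r5, r6, r7, r8, h1, h2, r1, r2]
  simp only [pairL, hermL, quadL]
  rw [eq_sub_of_add_eq r3]
  field_simp
  ring

-- Cauchy-Schwarz, from expanding ∑ |x_A - x_B|² ≥ 0.
omit H hU E in
lemma inner_sum_le {κ : Type*} [Fintype κ] (x : κ → W) :
    h (f z) (∑ A, x A) (∑ A, x A) ≤ Fintype.card κ * ∑ A, h (f z) (x A) (x A) := by
  have nn : ∀ u, 0 ≤ h (f z) u u := fun u => by
    rcases eq_or_ne u 0 with rfl | hu
    · simp
    · exact (L.h_pos _ (L.mapsTo hz) u hu).le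
  have h1 : 0 ≤ ∑ A, ∑ B, h (f z) (x A - x B) (x A - x B) :=
    Finset.sum_nonneg fun A _ => Finset.sum_nonneg fun B _ => nn _
  have h2 : ∑ A, ∑ B, h (f z) (x A - x B) (x A - x B)
      = 2 * (Fintype.card κ * ∑ A, h (f z) (x A) (x A)) - 2 * h (f z) (∑ A, x A) (∑ A, x A) := by
    have e1 : ∀ A B, h (f z) (x A - x B) (x A - x B)
        = h (f z) (x A) (x A) + h (f z) (x B) (x B) - 2 * h (f z) (x A) (x B) := fun A B => by
      simp only [map_sub, sub_apply]
      rw [L.h_symm _ (L.mapsTo hz) (x B) (x A)]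
      ring
    have e2 : h (f z) (∑ A, x A) (∑ A, x A) = ∑ A, ∑ B, h (f z) (x A) (x B) := by
      simp only [map_sum, sum_apply]
      exact Finset.sum_comm
    simp only [e1, Finset.sum_sub_distrib, Finset.sum_add_distrib, ← Finset.mul_sum, e2,
      Finset.sum_const, Finset.card_univ, nsmul_eq_mul]
    ring
  linarith

/-- Up to positive factors this is the squared norm of the trace-free part of ν, the symmetrised
J-invariant part of β. The skew part of β is a multiple of dθ ⊗ dφ(T), and its contributions,
including the one from ∑ β(ε_A, Jε_A), combine so that `quadL` is ½ ∑ |ν|² minus |tr β|² / m. -/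
lemma quadL_nonneg (hm : 0 < (m : ℝ)) :
    0 ≤ quadL (h (f z)) (sff f (gammaL θ J) G z) (J z) (1 / m) e := by
  have hz₀ := hU hz
  set ε := frm (J z) e with hε
  set β := sff f (gammaL θ J) G z with hβ
  set t₀ := fderiv ℝ f z (reebL θ z) with ht₀
  set g := h (f z) with hg
  have gs : ∀ u v, g u v = g v u := L.h_symm _ (L.mapsTo hz)
  have comm : ∀ u v, θ z u = 0 → θ z v = 0 → β v u = β u v - levi θ z u v • t₀ := by
    intro u v hu hv
    have := L.sff_swap hz u v
    rw [H.gamma_torsion hz₀, LocalCR.tor_horizontal hu hv, map_smul] at this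
    rw [← this]
    abel
  have hh := E.horizontal
  have hJ : ∀ v, θ z (J z v) = 0 := H.θ_J hz₀
  have JJ : ∀ A, J z (J z (ε A)) = -ε A := E.J_J
  have card : ((Fintype.card (Fin m ⊕ Fin m) : ℕ) : ℝ) = 2 * m := by
    simp only [Fintype.card_sum, Fintype.card_fin]; push_cast; ring
  have one : ∀ A, levi θ z (ε A) (J z (ε A)) = 1 := fun A => by
    rw [H.levi_eq hz₀, E.norm_J H hz₀]
  have s_left : ∑ A, β (J z (ε A)) (ε A) = -∑ A, β (ε A) (J z (ε A)) :=
    E.sum_J_left (fun u v => β u v) (fun u v => by simp) fun u v => by simp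
  -- The contracted commutation relation: the sum is opposite to its transpose, and the two differ
  -- by 2m copies of t₀ because dθ(ε_A, Jε_A) = 1.
  have s_eq : ∑ A, β (ε A) (J z (ε A)) = (m : ℝ) • t₀ := by
    have e1 : ∀ A, β (J z (ε A)) (ε A) = β (ε A) (J z (ε A)) - t₀ := fun A => by
      rw [comm _ _ (hh A) (hJ _), one, one_smul]
    simp only [e1, Finset.sum_sub_distrib, Finset.sum_const, Finset.card_univ] at s_left
    rw [← Nat.cast_smul_eq_nsmul ℝ, card, sub_eq_iff_eq_add] at s_left
    have h2 := congrArg (fun x => (1 / 2 : ℝ) • (x + ∑ A, β (ε A) (J z (ε A)))) s_left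
    simp only at h2
    rw [← sub_eq_zero] at h2 ⊢
    refine Eq.trans ?_ h2
    module
  set X1 := ∑ A, ∑ B, g (β (ε A) (ε B)) (β (ε A) (ε B)) with hX1
  set X2 := ∑ A, ∑ B, g (β (ε A) (ε B)) (β (J z (ε A)) (J z (ε B))) with hX2
  have X3 : ∑ A, ∑ B, levi θ z (ε A) (ε B) * g (β (ε A) (ε B)) t₀ = m * g t₀ t₀ := by
    have e1 : ∀ B, ∑ A, levi θ z (ε A) (ε B) * g (β (ε A) (ε B)) t₀
        = -g (β (J z (ε B)) (ε B)) t₀ := fun B => by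
      have := E.sum_map ((g.flip t₀).comp (β.flip (ε B))).toLinearMap (hJ (ε B))
      rw [show ((g.flip t₀).comp (β.flip (ε B))).toLinearMap (J z (ε B))
        = g (β (J z (ε B)) (ε B)) t₀ from rfl] at this
      rw [← this, ← Finset.sum_neg_distrib]
      refine Finset.sum_congr rfl fun A _ => ?_
      rw [E.levi_left H hz₀, smul_eq_mul, neg_mul]
      rfl
    rw [Finset.sum_comm]
    simp only [e1]
    rw [Finset.sum_neg_distrib, ← sum_apply, ← map_sum, s_left, s_eq, map_neg, neg_apply, neg_neg,
      map_smul, smul_apply, smul_eq_mul]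
  have X4 : ∑ A, ∑ B, levi θ z (ε A) (ε B) * levi θ z (ε A) (ε B) = 2 * m := by
    have e1 : ∀ B, ∑ A, levi θ z (ε A) (ε B) * levi θ z (ε A) (ε B) = 1 := fun B => by
      have := E.sum_map ((levi θ z).flip (ε B)).toLinearMap (hJ (ε B))
      have e2 : ((levi θ z).flip (ε B)).toLinearMap (J z (ε B)) = -1 := by
        change levi θ z (J z (ε B)) (ε B) = -1
        rw [levi_swap, one]
      rw [e2] at this
      rw [← neg_inj, ← this, ← Finset.sum_neg_distrib]
      refine Finset.sum_congr rfl fun A _ => ?_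
      change _ = websterL θ J z (ε A) (J z (ε B)) * levi θ z (ε A) (ε B)
      conv_lhs => arg 1; arg 1; rw [E.levi_left H hz₀]
      ring
    rw [Finset.sum_comm]
    simp only [e1, Finset.sum_const, Finset.card_univ, nsmul_eq_mul, card, mul_one]
  have Q1 : ∑ A, ∑ B, g (β (ε A) (ε B)) (β (ε B) (ε A)) = X1 - m * g t₀ t₀ := by
    rw [← X3, hX1, ← Finset.sum_sub_distrib]
    refine Finset.sum_congr rfl fun A _ => ?_
    rw [← Finset.sum_sub_distrib]
    refine Finset.sum_congr rfl fun B _ => ?_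
    rw [comm _ _ (hh A) (hh B), map_sub, map_smul, smul_eq_mul]
  have Q2 : ∑ A, ∑ B, g (β (J z (ε A)) (ε B)) (β (J z (ε B)) (ε A)) = -X2 + m * g t₀ t₀ := by
    have e1 : ∀ A B, g (β (J z (ε A)) (ε B)) (β (J z (ε B)) (ε A))
        = g (β (J z (ε A)) (ε B)) (β (ε A) (J z (ε B)))
          - websterL θ J z (ε A) (ε B) * g (β (J z (ε A)) (ε B)) t₀ := by
      intro A B
      rw [comm _ _ (hh A) (hJ _), E.levi_left H hz₀, JJ, map_neg, neg_neg, map_sub, map_smul,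
        smul_eq_mul]
    simp only [e1, Finset.sum_sub_distrib]
    rw [sub_eq_add_neg]
    congr 1
    · have e3 : ∀ B, ∑ A, g (β (J z (ε A)) (ε B)) (β (ε A) (J z (ε B)))
          = -∑ A, g (β (ε A) (ε B)) (β (J z (ε A)) (J z (ε B))) := by
        intro B
        rw [← E.sum_J (fun u v => g (β (J z u) (ε B)) (β v (J z (ε B)))) (fun u v => by simp),
          ← Finset.sum_neg_distrib]
        refine Finset.sum_congr rfl fun A _ => ?_
        simp only [← hε, JJ, map_neg, neg_apply]
      refine Finset.sum_comm.trans ?_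
      simp only [e3]
      rw [Finset.sum_neg_distrib, hX2]
      exact congrArg _ Finset.sum_comm
    · have e2 : ∀ B, ∑ A, websterL θ J z (ε A) (ε B) * g (β (J z (ε A)) (ε B)) t₀
          = g (β (J z (ε B)) (ε B)) t₀ := fun B =>
        E.sum_map (((g.flip t₀).comp (β.flip (ε B))).comp (J z)).toLinearMap (hh B)
      rw [Finset.sum_comm]
      simp only [e2]
      rw [← sum_apply, ← map_sum, s_left, s_eq, map_neg, neg_apply, neg_neg,
        map_smul, smul_apply, smul_eq_mul]
  -- Symmetrising each of β(u, v) and β(Ju, Jv) subtracts ½ dθ(u, v) t₀, since dθ is J-invariant.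
  let ν : V → V → W := fun u v => β u v + β (J z u) (J z v) - levi θ z u v • t₀
  have S1 : ∑ A, ∑ B, g (ν (ε A) (ε B)) (ν (ε A) (ε B))
      = 2 * X1 + 2 * X2 - 2 * m * g t₀ t₀ := by
    have e1 : ∀ A B, g (ν (ε A) (ε B)) (ν (ε A) (ε B))
        = g (β (ε A) (ε B)) (β (ε A) (ε B)) + 2 * g (β (ε A) (ε B)) (β (J z (ε A)) (J z (ε B)))
          + g (β (J z (ε A)) (J z (ε B))) (β (J z (ε A)) (J z (ε B)))
          - 2 * (levi θ z (ε A) (ε B) * g (β (ε A) (ε B)) t₀)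
          - 2 * (levi θ z (J z (ε A)) (J z (ε B)) * g (β (J z (ε A)) (J z (ε B))) t₀)
          + (levi θ z (ε A) (ε B) * levi θ z (ε A) (ε B)) * g t₀ t₀ := by
      intro A B
      simp only [ν, map_add, map_sub, map_smul, add_apply, sub_apply, smul_apply, smul_eq_mul,
        H.levi_J_J hz₀]
      rw [gs t₀, gs t₀, gs (β (J z (ε A)) (J z (ε B))) (β (ε A) (ε B))]
      ring
    have e2 : ∑ A, ∑ B, g (β (J z (ε A)) (J z (ε B))) (β (J z (ε A)) (J z (ε B))) = X1 := by
      rw [hX1, E.sum_J (fun u v => ∑ B, g (β u (J z (ε B))) (β v (J z (ε B))))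
        (fun u v => by simp)]
      refine Finset.sum_congr rfl fun A _ => ?_
      exact E.sum_J (fun u v => g (β (ε A) u) (β (ε A) v)) (fun u v => by simp)
    have e3 : ∑ A, ∑ B, levi θ z (J z (ε A)) (J z (ε B)) * g (β (J z (ε A)) (J z (ε B))) t₀
        = m * g t₀ t₀ := by
      rw [← X3, E.sum_J (fun u v => ∑ B, levi θ z u (J z (ε B)) * g (β v (J z (ε B))) t₀)
        (fun u v => by simp)]
      refine Finset.sum_congr rfl fun A _ => ?_
      exact E.sum_J (fun u v => levi θ z (ε A) u * g (β (ε A) v) t₀) (fun u v => by simp)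
    simp only [e1, Finset.sum_add_distrib, Finset.sum_sub_distrib, ← Finset.mul_sum,
      ← Finset.sum_mul]
    rw [e2, e3, X3, X4]
    ring
  have S2 : ∑ A, ν (ε A) (ε A) = (2 : ℝ) • ∑ A, β (ε A) (ε A) := by
    simp only [ν, levi_self, zero_smul, sub_zero, Finset.sum_add_distrib]
    rw [E.sum_J (fun u v => β u v) (fun u v => by simp), two_smul]
  -- Cauchy-Schwarz over the 2m diagonal entries of ν, whose trace is 2 tr β. This is the inequality
  -- that the coefficient 1/m in Θ requires.
  have S3 := inner_sum_le L hz (fun A => ν (ε A) (ε A))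
  rw [S2, card] at S3
  have S4 : ∑ A, g (ν (ε A) (ε A)) (ν (ε A) (ε A)) ≤ ∑ A, ∑ B, g (ν (ε A) (ε B)) (ν (ε A) (ε B)) := by
    refine Finset.sum_le_sum fun A _ => ?_
    refine Finset.single_le_sum (f := fun B => g (ν (ε A) (ε B)) (ν (ε A) (ε B)))
      (fun B _ => ?_) (Finset.mem_univ A)
    rcases eq_or_ne (ν (ε A) (ε B)) 0 with h0 | h0
    · simp [h0]
    · exact (L.h_pos _ (L.mapsTo hz) _ h0).le
  rw [S1] at S4
  simp only [quadL]
  simp only [← hε]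
  rw [Q1, Q2, s_eq]
  simp only [← hg, map_smul, smul_apply, smul_eq_mul] at S3 ⊢
  set T := g (∑ A, β (ε A) (ε A)) (∑ A, β (ε A) (ε A)) with hT
  have S5 : 2 * (2 * T) ≤ 2 * m * (2 * X1 + 2 * X2 - 2 * m * g t₀ t₀) :=
    S3.trans (mul_le_mul_of_nonneg_left S4 (by positivity))
  have S6 : T / m ≤ X1 + X2 - m * g t₀ t₀ := by
    rw [div_le_iff₀ hm]; nlinarith
  have S7 : X1 - m * g t₀ t₀ - (-X2 + m * g t₀ t₀) - 1 / m * (T - m * (m * g t₀ t₀))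
      = X1 + X2 - m * g t₀ t₀ - T / m := by
    field_simp; ring
  rw [S7]
  linarith

end BochnerFormula

/-! ### Frames in charts -/

section OrthonormalFamilies

variable {V : Type*} [NormedAddCommGroup V] [NormedSpace ℝ V] [FiniteDimensional ℝ V]
  {κ : Type*} [Fintype κ] [DecidableEq κ] {g : V →L[ℝ] V →L[ℝ] ℝ} {b : κ → V}

lemma expand_of_orthonormal (hb : ∀ i j, g (b i) (b j) = if i = j then 1 else 0)
    (hc : Fintype.card κ = Module.finrank ℝ V) (v : V) : v = ∑ i, g (b i) v • b i := by
  have hli : LinearIndependent ℝ b := by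
    rw [Fintype.linearIndependent_iff]
    intro c h i
    have := congrArg (g (b i)) h
    simpa [map_sum, hb] using this
  obtain ⟨c, hc⟩ : ∃ c : κ → ℝ, v = ∑ i, c i • b i :=
    ⟨fun i => (Module.Basis.mk hli (hli.span_eq_top_of_card_eq_finrank' hc).ge).repr v i, by
      have := (Module.Basis.mk hli (hli.span_eq_top_of_card_eq_finrank' hc).ge).sum_repr v
      simpa using this.symm⟩
  have : ∀ i, g (b i) v = c i := fun i => by
    rw [hc]
    simp [map_sum, hb]
  simp only [this]
  exact hc

lemma inner_eq_sum_of_orthonormal (hs : ∀ u v, g u v = g v u)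
    (hb : ∀ i j, g (b i) (b j) = if i = j then 1 else 0)
    (hc : Fintype.card κ = Module.finrank ℝ V) (u v : V) :
    g u v = ∑ i, g u (b i) * g v (b i) := by
  conv_lhs => rw [expand_of_orthonormal hb hc v]
  simp only [map_sum, map_smul, smul_eq_mul]
  exact Finset.sum_congr rfl fun i _ => by rw [hs v, mul_comm]

end OrthonormalFamilies

section FramesInCharts

variable {m : ℕ} {M : Type*} [TopologicalSpace M] [ChartedSpace (Mod (2 * m + 1)) M]
  [IsManifold (𝓡 (2 * m + 1)) ∞ M] {S : StrictlyPseudoconvexCR m M} {p y : M}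
  {e : Fin m → TangentSpace (𝓡 (2 * m + 1)) y}

lemma frm_co (hy : y ∈ (ch (2 * m + 1) p).source) (A : Fin m ⊕ Fin m) :
    frm (S.JL p (ch _ p y)) (fun α => co _ p y (e α)) A
      = co _ p y (Sum.elim e (fun α => S.J y (e α)) A) := by
  rcases A with α | α
  · rfl
  · exact endL_co S.J hy (e α)

/-- Adjoining T gives 2m + 1 orthonormal vectors, hence a basis, and a horizontal vector has no
T-component in it. -/
lemma StrictlyPseudoconvexCR.IsCRFrame.frameL (he : S.IsCRFrame y e)
    (hy : y ∈ (ch (2 * m + 1) p).source) :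
    FrameL (S.thL p) (S.JL p) (ch _ p y) (fun α => co _ p y (e α)) := by
  have H := S.localCR p
  have hz := map_mem hy
  have hor : ∀ A, S.thL p (ch _ p y) (frm (S.JL p (ch _ p y)) (fun α => co _ p y (e α)) A) = 0 := by
    intro A
    rw [frm_co hy, formL_co S.θ hy]
    rcases A with α | α
    · exact he.horizontal α
    · exact S.J_mem y _ (he.horizontal α)
  have orth : ∀ A B, websterL (S.thL p) (S.JL p) (ch _ p y)
      (frm (S.JL p (ch _ p y)) (fun α => co _ p y (e α)) A)
      (frm (S.JL p (ch _ p y)) (fun α => co _ p y (e α)) B) = if A = B then 1 else 0 := by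
    intro A B
    rw [frm_co hy, frm_co hy, ← S.webster_chart hy]
    rcases A with α | α <;> rcases B with β | β
    · exact (he.inner_e α β).trans (by simp)
    · exact (he.inner_e_Je α β).trans (by simp)
    · refine Eq.trans ?_ ((he.inner_e_Je β α).trans (by simp))
      rw [S.webster_chart hy, S.webster_chart hy, H.g_symm hz]
      rfl
    · exact (he.inner_Je α β).trans (by simp)
  refine ⟨hor, fun A => (orth A A).trans (if_pos rfl), fun v hv => ?_, fun α => ?_⟩
  · have := expand_of_orthonormal (κ := Option (Fin m ⊕ Fin m))
      (g := websterL (S.thL p) (S.JL p) (ch _ p y))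
      (b := fun o => o.elim (reebL (S.thL p) (ch _ p y))
        (frm (S.JL p (ch _ p y)) (fun α => co _ p y (e α))))
      (by
        rintro (_ | A) (_ | B)
        · exact (H.g_reeb hz _).trans (H.θ_reeb hz)
        · exact (H.g_reeb hz _).trans (hor B)
        · exact (H.g_symm hz _ _).trans ((H.g_reeb hz _).trans (hor A))
        · exact (orth A B).trans (by simp)) (by simp [two_mul]) v
    rw [Fintype.sum_option] at this
    refine this.trans ?_
    change websterL (S.thL p) (S.JL p) (ch _ p y) (reebL (S.thL p) (ch _ p y)) v • _ + _ = _
    rw [H.g_reeb hz, hv, zero_smul, zero_add]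
    rfl
  · exact H.J_sq _ hz _ (hor (Sum.inl α))

variable {n : ℕ} {N : Type*} [TopologicalSpace N] [ChartedSpace (Mod n) N] [IsManifold (𝓡 n) ∞ N]
  {h : Metric n N} {φ : M → N} {q : N}

lemma localMap_chart (hφ : ContMDiff (𝓡 (2 * m + 1)) (𝓡 n) ∞ φ) :
    LocalMap (ov (2 * m + 1) n φ p q) (ch n q).target (lm (2 * m + 1) n φ p q) (twL S p)
      (metL h q) (lcL h q) where
  isOpen := isOpen_ov hφ
  isOpen' := target_open q
  mapsTo := fun _ hz => map_mem hz.2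
  smooth_f := smoothOn_lm hφ
  smooth_Γ := (S.localCR p).smooth_gamma.mono Set.inter_subset_left
  smooth_h := smoothOn_metL h q
  smooth_G := smoothOn_lcL q
  h_symm := fun _ _ => metL_symm
  h_pos := fun _ hy _ hu => metL_pos hy hu
  metric := fun _ hy => lcL_metric hy
  symm := fun _ hy => lcL_symm hy

end FramesInCharts

/-! ### The pairing in charts -/

section Pairing

variable {V : Type*} [NormedAddCommGroup V] [NormedSpace ℝ V] [FiniteDimensional ℝ V]
  {m : ℕ} {U : Set V} {θ : V → V →L[ℝ] ℝ} {J : V → V →L[ℝ] V} {z : V} {e : Fin m → V}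

/-- The unitary vectors `T_α`. -/
def holoL (J : V →L[ℝ] V) (e : Fin m → V) (α : Fin m) : V × V :=
  ((√2)⁻¹ • e α, -((√2)⁻¹ • J (e α)))

/-- In real terms ∑_α T_ᾱ ⊗ T_α = ½ ∑_A ε_A ⊗ ε_A - (√-1/2) ∑_A ε_A ⊗ Jε_A, and its conjugate is the
contraction over β. The real part keeps the products of equal type, which gives ¼ each, doubled by
adding the complex conjugate. -/
lemma re_paneitz_pairing (H : LocalCR U θ J) (hz : z ∈ U) (E : FrameL θ J z e)
    (C : V → V → V → ℝ) (x : V →L[ℝ] ℝ)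
    (s₁ : ∀ (c : ℝ) u v w, C (c • u) v w = c * C u v w)
    (s₂ : ∀ (c : ℝ) u v w, C u (c • v) w = c * C u v w)
    (s₃ : ∀ (c : ℝ) u v w, C u v (c • w) = c * C u v w) :
    (∑ β, ((∑ α, (cx₃ C (cbar (holoL (J z) e α)) (holoL (J z) e α) (holoL (J z) e β)
        + Complex.I * m * cx₂ (fun u v => websterL θ J z (tauL θ J z u) v) (holoL (J z) e β)
            (holoL (J z) e α) * cx₁ x (cbar (holoL (J z) e α)))) * cx₁ x (cbar (holoL (J z) e β))
      + starRingEnd ℂ (∑ α, (cx₃ C (cbar (holoL (J z) e α)) (holoL (J z) e α) (holoL (J z) e β)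
        + Complex.I * m * cx₂ (fun u v => websterL θ J z (tauL θ J z u) v) (holoL (J z) e β)
            (holoL (J z) e α) * cx₁ x (cbar (holoL (J z) e α))))
        * cx₁ x (holoL (J z) e β))).re
    = 1 / 2 * (∑ A, ∑ B, C (frm (J z) e A) (frm (J z) e A) (frm (J z) e B) * x (frm (J z) e B)
      + ∑ A, ∑ B, C (frm (J z) e A) (J z (frm (J z) e A)) (frm (J z) e B)
          * x (J z (frm (J z) e B))
      + 2 * m * ∑ B, x (tauL θ J z (J z (frm (J z) e B))) * x (frm (J z) e B)) := by
  set k : ℝ := (√2)⁻¹ with hk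
  have k2 : k * k = 1 / 2 := by rw [hk, ← mul_inv, Real.mul_self_sqrt (by norm_num)]; norm_num
  have n₁ : ∀ u v w, C (-u) v w = -C u v w := fun u v w => by
    rw [← neg_one_smul ℝ, s₁, neg_one_mul]
  have n₂ : ∀ u v w, C u (-v) w = -C u v w := fun u v w => by
    rw [← neg_one_smul ℝ, s₂, neg_one_mul]
  have n₃ : ∀ u v w, C u v (-w) = -C u v w := fun u v w => by
    rw [← neg_one_smul ℝ, s₃, neg_one_mul]
  -- Because τ anticommutes and g is skew with J, the form A satisfies A(Ju, v) = A(u, Jv); hence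
  -- A_{βα} needs only e_β in its first slot.
  have tJ : ∀ u v, websterL θ J z (tauL θ J z (J z u)) v = websterL θ J z (tauL θ J z u) (J z v) := by
    intro u v
    rw [H.tau_J hz, map_neg, neg_apply, H.g_J hz, neg_neg]
  have tJJ : ∀ u β, websterL θ J z (tauL θ J z u) (J z (J z (e β)))
      = -websterL θ J z (tauL θ J z u) (e β) := by
    intro u β
    rw [E.J_e, map_neg]
  have tx : ∀ B, x (tauL θ J z (J z (frm (J z) e B)))
      = ∑ A, websterL θ J z (tauL θ J z (frm (J z) e B)) (J z (frm (J z) e A)) * x (frm (J z) e A) := by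
    intro B
    conv_lhs => rw [E.expand _ (H.θ_tau hz (J z (frm (J z) e B))), map_sum]
    refine Finset.sum_congr rfl fun A _ => ?_
    rw [map_smul, smul_eq_mul, H.g_symm hz, tJ]
  simp only [tx]
  have e1 : ∀ (P Q x y : ℝ), ((⟨P, Q⟩ : ℂ) * (⟨x, y⟩ : ℂ) + starRingEnd ℂ (⟨P, Q⟩ : ℂ) * ⟨x, -y⟩).re
      = 2 * (P * x - Q * y) := by
    intro P Q x y
    simp [Complex.mul_re]; ring
  have a1 : ∀ β, cx₁ x (cbar (holoL (J z) e β)) = ⟨k * x (e β), k * x (J z (e β))⟩ := by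
    intro β
    apply Complex.ext <;> simp [cx₁, cbar, holoL, ← hk]
  have a2 : ∀ β, cx₁ x (holoL (J z) e β) = ⟨k * x (e β), -(k * x (J z (e β)))⟩ := by
    intro β
    apply Complex.ext <;> simp [cx₁, holoL, ← hk]
  have a3 : ∀ α β, cx₂ (fun u v => websterL θ J z (tauL θ J z u) v) (holoL (J z) e β)
      (holoL (J z) e α) = ⟨websterL θ J z (tauL θ J z (e β)) (e α),
        -websterL θ J z (tauL θ J z (e β)) (J z (e α))⟩ := by
    intro α β
    apply Complex.ext
    · simp only [cx₂, cx₁, holoL, map_smul, map_neg, smul_apply, smul_eq_mul, neg_apply,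
        Complex.add_re, Complex.add_im, Complex.mul_re, Complex.mul_im, Complex.ofReal_re,
        Complex.ofReal_im, Complex.I_re, Complex.I_im, tJ, tJJ, ← hk]
      linear_combination (2 * websterL θ J z (tauL θ J z (e β)) (e α)) * k2
    · simp only [cx₂, cx₁, holoL, map_smul, map_neg, smul_apply, smul_eq_mul, neg_apply,
        Complex.add_re, Complex.add_im, Complex.mul_re, Complex.mul_im, Complex.ofReal_re,
        Complex.ofReal_im, Complex.I_re, Complex.I_im, tJ, tJJ, ← hk]
      linear_combination (-2 * websterL θ J z (tauL θ J z (e β)) (J z (e α))) * k2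
  have a4 : ∀ α β, cx₃ C (cbar (holoL (J z) e α)) (holoL (J z) e α) (holoL (J z) e β)
      = ⟨k / 2 * (C (e α) (e α) (e β) + C (J z (e α)) (J z (e α)) (e β)
          - (C (e α) (J z (e α)) (J z (e β)) - C (J z (e α)) (e α) (J z (e β)))),
        -(k / 2 * (C (e α) (J z (e α)) (e β) - C (J z (e α)) (e α) (e β)
          + (C (e α) (e α) (J z (e β)) + C (J z (e α)) (J z (e α)) (J z (e β)))))⟩ := by
    intro α β
    apply Complex.ext
    · simp only [cx₃, cx₂, cx₁, holoL, cbar, s₁, s₂, s₃, n₁, n₂, n₃,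
        Complex.add_re, Complex.add_im, Complex.mul_re, Complex.mul_im, Complex.ofReal_re,
        Complex.ofReal_im, Complex.I_re, Complex.I_im, ← hk]
      linear_combination (k * (C (e α) (e α) (e β) + C (J z (e α)) (J z (e α)) (e β)
          - (C (e α) (J z (e α)) (J z (e β)) - C (J z (e α)) (e α) (J z (e β))))) * k2
    · simp only [cx₃, cx₂, cx₁, holoL, cbar, s₁, s₂, s₃, n₁, n₂, n₃,
        Complex.add_re, Complex.add_im, Complex.mul_re, Complex.mul_im, Complex.ofReal_re,
        Complex.ofReal_im, Complex.I_re, Complex.I_im, ← hk]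
      linear_combination -(k * (C (e α) (J z (e α)) (e β) - C (J z (e α)) (e α) (e β)
          + (C (e α) (e α) (J z (e β)) + C (J z (e α)) (J z (e α)) (J z (e β))))) * k2
  have a5 : ∀ β, (∑ α, (cx₃ C (cbar (holoL (J z) e α)) (holoL (J z) e α) (holoL (J z) e β)
        + Complex.I * m * cx₂ (fun u v => websterL θ J z (tauL θ J z u) v) (holoL (J z) e β)
            (holoL (J z) e α) * cx₁ x (cbar (holoL (J z) e α))))
      = ⟨∑ α, (k / 2 * (C (e α) (e α) (e β) + C (J z (e α)) (J z (e α)) (e β)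
          - (C (e α) (J z (e α)) (J z (e β)) - C (J z (e α)) (e α) (J z (e β))))
          + m * k * (websterL θ J z (tauL θ J z (e β)) (J z (e α)) * x (e α)
            - websterL θ J z (tauL θ J z (e β)) (e α) * x (J z (e α)))),
        ∑ α, (-(k / 2 * (C (e α) (J z (e α)) (e β) - C (J z (e α)) (e α) (e β)
          + (C (e α) (e α) (J z (e β)) + C (J z (e α)) (J z (e α)) (J z (e β)))))
          + m * k * (websterL θ J z (tauL θ J z (e β)) (e α) * x (e α)
            + websterL θ J z (tauL θ J z (e β)) (J z (e α)) * x (J z (e α))))⟩ := by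
    intro β
    simp only [a1, a3, a4]
    apply Complex.ext
    · rw [Complex.re_sum]
      refine Finset.sum_congr rfl fun α _ => ?_
      simp only [Complex.add_re, Complex.mul_re, Complex.mul_im, Complex.I_re,
        Complex.I_im, Complex.natCast_re, Complex.natCast_im]
      ring
    · rw [Complex.im_sum]
      refine Finset.sum_congr rfl fun α _ => ?_
      simp only [Complex.add_im, Complex.mul_re, Complex.mul_im, Complex.I_re,
        Complex.I_im, Complex.natCast_re, Complex.natCast_im]
      ring
  simp only [a5]
  simp only [a1, a2]
  rw [Complex.re_sum]
  simp only [e1]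
  have r1 : ∑ A, ∑ B, C (frm (J z) e A) (frm (J z) e A) (frm (J z) e B) * x (frm (J z) e B)
      = ∑ β, ∑ α, ((C (e α) (e α) (e β) + C (J z (e α)) (J z (e α)) (e β)) * x (e β)
        + (C (e α) (e α) (J z (e β)) + C (J z (e α)) (J z (e α)) (J z (e β))) * x (J z (e β))) := by
    rw [Finset.sum_comm]
    simp only [Fintype.sum_sum_type, frm, Sum.elim_inl, Sum.elim_inr, ← Finset.sum_add_distrib]
    exact Finset.sum_congr rfl fun β _ => Finset.sum_congr rfl fun α _ => by ring
  have r2 : ∑ A, ∑ B, C (frm (J z) e A) (J z (frm (J z) e A)) (frm (J z) e B)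
        * x (J z (frm (J z) e B))
      = ∑ β, ∑ α, ((C (e α) (J z (e α)) (e β) - C (J z (e α)) (e α) (e β)) * x (J z (e β))
        - (C (e α) (J z (e α)) (J z (e β)) - C (J z (e α)) (e α) (J z (e β))) * x (e β)) := by
    rw [Finset.sum_comm]
    simp only [Fintype.sum_sum_type, frm, Sum.elim_inl, Sum.elim_inr, E.J_e, n₂, map_neg,
      ← Finset.sum_add_distrib]
    exact Finset.sum_congr rfl fun β _ => Finset.sum_congr rfl fun α _ => by ring
  have r3 : ∑ B, (∑ A, websterL θ J z (tauL θ J z (frm (J z) e B)) (J z (frm (J z) e A))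
        * x (frm (J z) e A)) * x (frm (J z) e B)
      = ∑ β, ∑ α, (websterL θ J z (tauL θ J z (e β)) (J z (e α)) * (x (e α) * x (e β)
            - x (J z (e α)) * x (J z (e β)))
          - websterL θ J z (tauL θ J z (e β)) (e α) * (x (J z (e α)) * x (e β)
            + x (e α) * x (J z (e β)))) := by
    simp only [Fintype.sum_sum_type, frm, Sum.elim_inl, Sum.elim_inr, tJ, E.J_e, map_neg,
      Finset.sum_mul, ← Finset.sum_add_distrib]
    exact Finset.sum_congr rfl fun β _ => Finset.sum_congr rfl fun α _ => by ring
  rw [r1, r2, r3]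
  simp only [Finset.sum_mul, Finset.mul_sum, ← Finset.sum_add_distrib, ← Finset.sum_sub_distrib]
  refine Finset.sum_congr rfl fun β _ => Finset.sum_congr rfl fun α _ => ?_
  linear_combination ((C (e α) (e α) (e β) + C (J z (e α)) (J z (e α)) (e β)
          - (C (e α) (J z (e α)) (J z (e β)) - C (J z (e α)) (e α) (J z (e β)))) * x (e β)
    + (C (e α) (J z (e α)) (e β) - C (J z (e α)) (e α) (e β)
          + (C (e α) (e α) (J z (e β)) + C (J z (e α)) (J z (e α)) (J z (e β)))) * x (J z (e β))
    + 2 * m * (websterL θ J z (tauL θ J z (e β)) (J z (e α)) * (x (e α) * x (e β)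
            - x (J z (e α)) * x (J z (e β)))
          - websterL θ J z (tauL θ J z (e β)) (e α) * (x (J z (e α)) * x (e β)
            + x (e α) * x (J z (e β))))) * k2

end Pairing

section PairingInCharts

variable {m : ℕ} {M : Type*} [TopologicalSpace M] [ChartedSpace (Mod (2 * m + 1)) M]
  [IsManifold (𝓡 (2 * m + 1)) ∞ M] {S : StrictlyPseudoconvexCR m M} {p y : M}
  {e : Fin m → TangentSpace (𝓡 (2 * m + 1)) y}
  {n : ℕ} {N : Type*} [TopologicalSpace N] [ChartedSpace (Mod n) N] [IsManifold (𝓡 n) ∞ N]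
  {h : Metric n N} {φ : M → N} {q : N}

lemma co_holo (hy : y ∈ (ch (2 * m + 1) p).source) (α : Fin m) :
    Prod.map (co _ p y) (co _ p y) (S.holo e α)
      = holoL (S.JL p (ch _ p y)) (fun α => co _ p y (e α)) α := by
  simp only [StrictlyPseudoconvexCR.holo, Prod.map_apply, map_neg, map_smul, holoL,
    ← endL_co S.J hy]

lemma co_anti (hy : y ∈ (ch (2 * m + 1) p).source) (α : Fin m) :
    Prod.map (co _ p y) (co _ p y) (S.anti e α)
      = cbar (holoL (S.JL p (ch _ p y)) (fun α => co _ p y (e α)) α) := by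
  rw [← co_holo hy]
  simp only [StrictlyPseudoconvexCR.anti, cbar, Prod.map_apply, Prod.map_fst, Prod.map_snd, map_neg]

/-- The pairing `⟨P φ + conj (P φ), d_b φ⟩` in charts. -/
lemma paneitzPairing_chart (hφ : ContMDiff (𝓡 (2 * m + 1)) (𝓡 n) ∞ φ)
    (hy : y ∈ (ch (2 * m + 1) p).source) (hq : φ y ∈ (ch n q).source) (he : S.IsCRFrame y e)
    {E : Fin n → TangentSpace (𝓡 n) (φ y)} (hE : IsOrthonormalFrame h E) :
    paneitzPairing S h φ e E = 1 / 2 * pairL (metL h q (lm (2 * m + 1) n φ p q (ch _ p y)))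
      (fderiv ℝ (lm (2 * m + 1) n φ p q) (ch _ p y))
      (tff (lm (2 * m + 1) n φ p q) (twL S p) (lcL h q) (ch _ p y)) (S.JL p (ch _ p y))
      (tauL (S.thL p) (S.JL p) (ch _ p y)) (fun α => co _ p y (e α)) := by
  set z := ch (2 * m + 1) p y with hz
  have H := S.localCR p
  have F := he.frameL (p := p) hy
  set g := metL h q (lm (2 * m + 1) n φ p q z) with hg
  set f := lm (2 * m + 1) n φ p q with hf
  have hgc : ∀ u v, h.inner (φ y) u v = g (co n q (φ y) u) (co n q (φ y) v) := fun u v => by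
    rw [hg, hf, hz, lm_ch hy, metL_co h hq]
  let x : Fin n → Mod (2 * m + 1) →L[ℝ] ℝ := fun j =>
    (g.flip (co n q (φ y) (E j))).comp (fderiv ℝ f z)
  let C : Fin n → Mod (2 * m + 1) → Mod (2 * m + 1) → Mod (2 * m + 1) → ℝ := fun j u v w =>
    g (tff f (twL S p) (lcL h q) z u v w) (co n q (φ y) (E j))
  have c1 : ∀ j t, comp₁ h φ E j t = cx₁ (x j) (Prod.map (co _ p y) (co _ p y) t) := by
    intro j t
    simp only [comp₁, cx₁, Prod.map_fst, Prod.map_snd, hgc, co_mfderiv hφ hy hq]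
    rfl
  have c3 : ∀ j t t' t'', comp₃ S h φ E j t t' t'' = cx₃ (C j) (Prod.map (co _ p y) (co _ p y) t)
      (Prod.map (co _ p y) (co _ p y) t') (Prod.map (co _ p y) (co _ p y) t'') := by
    intro j t t' t''
    simp only [comp₃, cx₃, cx₂, cx₁, Prod.map_fst, Prod.map_snd, hgc, co_thirdForm S h hφ hy hq]
    rfl
  have c2 : ∀ t t', cx₂ (S.pseudoTorsion y) t t'
      = cx₂ (fun u v => websterL (S.thL p) (S.JL p) z (tauL (S.thL p) (S.JL p) z u) v)
        (Prod.map (co _ p y) (co _ p y) t) (Prod.map (co _ p y) (co _ p y) t') := by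
    intro t t'
    simp only [cx₂, cx₁, Prod.map_fst, Prod.map_snd, S.pseudoTorsion_chart hy]
    rfl
  rw [paneitzPairing, Complex.re_sum]
  simp only [paneitz, c1, c2, c3, co_holo hy, co_anti hy]
  have key := fun j => re_paneitz_pairing H (map_mem hy) F (C j) (x j)
    (fun c u v w => by simp only [C, tff_smul₁, map_smul, smul_apply, smul_eq_mul])
    (fun c u v w => by simp only [C, tff_smul₂, map_smul, smul_apply, smul_eq_mul])
    (fun c u v w => by simp only [C, tff_smul₃, map_smul, smul_apply, smul_eq_mul])
  refine (Finset.sum_congr rfl fun j _ => key j).trans ?_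
  have hgo : ∀ u v, g u v = ∑ j, g u (co n q (φ y) (E j)) * g v (co n q (φ y) (E j)) :=
    inner_eq_sum_of_orthonormal (fun u v => metL_symm u v)
      (fun i j => by rw [← hgc]; exact hE i j) (by simp)
  rw [← Finset.mul_sum, pairL, Finset.sum_add_distrib, Finset.sum_add_distrib, ← Finset.mul_sum]
  congr 1
  have hgo₁ : ∀ u v w t, g (tff f (twL S p) (lcL h q) z u v w) (fderiv ℝ f z t)
      = ∑ j, C j u v w * x j t := fun _ _ _ _ => hgo _ _
  have hgo₂ : ∀ t t', g (fderiv ℝ f z t) (fderiv ℝ f z t') = ∑ j, x j t * x j t' :=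
    fun _ _ => hgo _ _
  simp only [hgo₁, hgo₂]
  congr 1
  · congr 1
    · rw [Finset.sum_comm]
      exact Finset.sum_congr rfl fun A _ => Finset.sum_comm
    · rw [Finset.sum_comm]
      exact Finset.sum_congr rfl fun A _ => Finset.sum_comm
  · exact congrArg _ Finset.sum_comm

end PairingInCharts

/-! ### The curvature term as a sum of Hermitian curvatures. -/

section HermitianCurvature

variable {V W : Type*} [NormedAddCommGroup V] [NormedSpace ℝ V]
  [NormedAddCommGroup W] [NormedSpace ℝ W] {m : ℕ}

/-- The complex vectors are u = dφ(e_β + √-1 Je_β) and v = dφ(e_α + √-1 Je_α). The frame sums group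
into the real parts of R(u, v, ū, v̄). The sign is the skewness of R in its plane: `hermL` has R(dφ
ε_A, dφ ε_B) dφ ε_A, while R_{ijkl} is normalised to give sectional curvatures. -/
lemma hermL_eq (h : W →L[ℝ] W →L[ℝ] ℝ) (a : V →L[ℝ] W) (G : W → W →L[ℝ] W →L[ℝ] W) (w : W)
    {J : V →L[ℝ] V} {e : Fin m → V} (hJ : ∀ α, J (J (e α)) = -e α) :
    hermL h a (curvL G w) J e = -∑ α, ∑ β, (cx₄ (fun p q r s => h (curvL G w r s q) p)
      (a (e β), a (J (e β))) (a (e α), a (J (e α))) (cbar (a (e β), a (J (e β))))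
      (cbar (a (e α), a (J (e α))))).re := by
  simp only [hermL, Fintype.sum_sum_type, frm, Sum.elim_inl, Sum.elim_inr, hJ, map_neg,
    ← Finset.sum_add_distrib, ← Finset.sum_neg_distrib]
  refine Finset.sum_congr rfl fun α _ => Finset.sum_congr rfl fun β _ => ?_
  simp only [cx₄, cx₃, cx₂, cx₁, cbar, curvL_neg₁, curvL_neg₂, map_neg, neg_apply, Complex.add_re,
    Complex.add_im, Complex.mul_re, Complex.mul_im, Complex.ofReal_re, Complex.ofReal_im,
    Complex.I_re, Complex.I_im]
  have s : ∀ r t q p, h (curvL G w r t q) p = -h (curvL G w t r q) p := fun r t q p => by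
    rw [curvL_swap, map_neg, neg_apply]
  simp only [s (a (e β)), s (a (J (e β)))]
  ring

end HermitianCurvature

section HermitianCurvatureInCharts

variable {m : ℕ} {M : Type*} [TopologicalSpace M] [ChartedSpace (Mod (2 * m + 1)) M]
  [IsManifold (𝓡 (2 * m + 1)) ∞ M] {S : StrictlyPseudoconvexCR m M} {p y : M}
  {e : Fin m → TangentSpace (𝓡 (2 * m + 1)) y}
  {n : ℕ} {N : Type*} [TopologicalSpace N] [ChartedSpace (Mod n) N] [IsManifold (𝓡 n) ∞ N]
  {h : Metric n N} {φ : M → N}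

lemma riemann_chart (y : N) (a b c d : TangentSpace (𝓡 n) y) : riemann h y a b c d
    = metL h y (ch n y y) (curvL (lcL h y) (ch n y y) (co n y y c) (co n y y d) (co n y y b))
      (co n y y a) := by
  rw [riemann, metL_co h (mem_extChartAt_source (I := 𝓡 n) y),
    curvature_chart (isLeviCivita_leviCivita h).cov (smoothOn_lcL y)
      fun y hy => chr_leviCivita h hy]

lemma hermL_nonneg (hN : NonposHermitianCurvature h) (hφ : ContMDiff (𝓡 (2 * m + 1)) (𝓡 n) ∞ φ)
    (hy : y ∈ (ch (2 * m + 1) p).source) (he : S.IsCRFrame y e) :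
    0 ≤ hermL (metL h (φ y) (lm (2 * m + 1) n φ p (φ y) (ch _ p y)))
      (fderiv ℝ (lm (2 * m + 1) n φ p (φ y)) (ch _ p y))
      (curvL (lcL h (φ y)) (lm (2 * m + 1) n φ p (φ y) (ch _ p y))) (S.JL p (ch _ p y))
      (fun α => co _ p y (e α)) := by
  have hq : φ y ∈ (ch n (φ y)).source := mem_extChartAt_source (I := 𝓡 n) (φ y)
  rw [hermL_eq _ _ _ _ (he.frameL hy).J_e, ← Finset.sum_neg_distrib]
  refine Finset.sum_nonneg fun α _ => ?_
  rw [← Finset.sum_neg_distrib]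
  refine Finset.sum_nonneg fun β _ => neg_nonneg.2 ?_
  have := hN (φ y)
    (mfderiv (𝓡 (2 * m + 1)) (𝓡 n) φ y (e β), mfderiv (𝓡 (2 * m + 1)) (𝓡 n) φ y (S.J y (e β)))
    (mfderiv (𝓡 (2 * m + 1)) (𝓡 n) φ y (e α), mfderiv (𝓡 (2 * m + 1)) (𝓡 n) φ y (S.J y (e α)))
  simp only [cx₄, cx₃, cx₂, cx₁, cbar, riemann_chart, map_neg, co_mfderiv hφ hy hq,
    ← endL_co S.J hy] at this
  rw [lm_ch hy]
  exact this

end HermitianCurvatureInCharts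

/-! ### Smoothness of traces -/

section SmoothTraces

variable {V W : Type*} [NormedAddCommGroup V] [NormedSpace ℝ V] [FiniteDimensional ℝ V]
  [NormedAddCommGroup W] [NormedSpace ℝ W] {f : V → W} {G : W → W →L[ℝ] W →L[ℝ] W}
  {h : W → W →L[ℝ] W →L[ℝ] ℝ} {J : V → V →L[ℝ] V} {c : ℝ} {θ : V → V →L[ℝ] ℝ}
  {U U₀ : Set V} {U' : Set W} {m : ℕ} {ι : Type*} [Fintype ι] (b : Module.Basis ι ℝ V)
  (L : LocalMap U U' f (gammaL θ J) h G) (H : LocalCR U₀ θ J) (hU : U ⊆ U₀)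

include L H hU

lemma smoothOn_bocV : ContDiffOn ℝ ∞ (bocV f (gammaL θ J) G h J c b θ) U := by
  have hJ := H.smooth_J.mono hU
  have hh : ContDiffOn ℝ ∞ (fun z => h (f z)) U := L.smooth_h.comp L.smooth_f L.mapsTo
  have ha := L.smooth_df
  have hβ := L.smooth_sff
  have hc := H.smooth_cog.mono hU
  have k : ∀ {u v v' : V → V}, ContDiffOn ℝ ∞ u U → ContDiffOn ℝ ∞ v U → ContDiffOn ℝ ∞ v' U →
      ContDiffOn ℝ ∞ (fun z => h (f z) (sff f (gammaL θ J) G z (u z) (v z))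
        (fderiv ℝ f z (v' z))) U := fun hu hv hv' =>
    (hh.clm_apply ((hβ.clm_apply hu).clm_apply hv)).clm_apply (ha.clm_apply hv')
  have dJ : ∀ {u : V → V}, ContDiffOn ℝ ∞ u U → ContDiffOn ℝ ∞ (fun z => J z (u z)) U :=
    fun hu => hJ.clm_apply hu
  have hk : ∀ {u v v' : V → V}, ContDiffOn ℝ ∞ u U → ContDiffOn ℝ ∞ v U → ContDiffOn ℝ ∞ v' U →
      ContDiffOn ℝ ∞ (fun z => bf f (gammaL θ J) G h J c z (u z) (v z) (v' z)) U :=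
    fun hu hv hv' => ((k hu hv hv').sub (k (dJ hu) hv (dJ hv'))).sub
      (contDiffOn_const.mul ((k hv hv' hu).add (k hv (dJ hv') (dJ hu))))
  exact ContDiffOn.sum fun i _ => (ContDiffOn.sum fun j _ => hk contDiffOn_const contDiffOn_const
    (hc.clm_apply contDiffOn_const)).smul (hc.clm_apply contDiffOn_const)

omit H hU in
lemma smoothOn_tff {u v w : V → V} (hu : ContDiffOn ℝ ∞ u U) (hv : ContDiffOn ℝ ∞ v U)
    (hw : ContDiffOn ℝ ∞ w U) :
    ContDiffOn ℝ ∞ (fun z => tff f (gammaL θ J) G z (u z) (v z) (w z)) U := by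
  have ha := L.smooth_df
  have hβ := L.smooth_sff
  have hβ' := smoothOn_fderiv L.isOpen hβ
  have hΓ := L.smooth_Γ
  exact (((((hβ'.clm_apply hw).clm_apply hu).clm_apply hv).add
    (((L.smooth_G.comp L.smooth_f L.mapsTo).clm_apply (ha.clm_apply hw)).clm_apply
      ((hβ.clm_apply hu).clm_apply hv))).sub
    ((hβ.clm_apply ((hΓ.clm_apply hw).clm_apply hu)).clm_apply hv)).sub
    ((hβ.clm_apply hu).clm_apply ((hΓ.clm_apply hw).clm_apply hv))

omit L hU in
lemma sum_cog_frame {F : Type*} [AddCommGroup F] [Module ℝ F] {z : V} (hz : z ∈ U₀)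
    {e : Fin m → V} (E : FrameL θ J z e) (X : V → V → F) (h₁ : ∀ u u' v, X (u + u') v = X u v + X u' v)
    (h₂ : ∀ (c : ℝ) u v, X (c • u) v = c • X u v) (h₃ : ∀ u v v', X u (v + v') = X u v + X u v')
    (h₄ : ∀ (c : ℝ) u v, X u (c • v) = c • X u v) :
    ∑ A, X (frm (J z) e A) (frm (J z) e A) = ∑ i, X (b i) (cog θ J z (cf b i)) :=
  (E.sum_cog_left b H hz (LinearMap.mk₂ ℝ X h₁ h₂ h₃ h₄) (.id ℝ V)).symm

include b in
/-- `pairL` depends smoothly on the point. -/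
lemma exists_smoothOn_pairL : ∃ P : V → ℝ, ContDiffOn ℝ ∞ P U ∧ ∀ z ∈ U, ∀ e : Fin m → V,
    FrameL θ J z e → pairL (h (f z)) (fderiv ℝ f z) (tff f (gammaL θ J) G z) (J z) (tauL θ J z) e
      = P z := by
  have hJ := H.smooth_J.mono hU
  have hh : ContDiffOn ℝ ∞ (fun z => h (f z)) U := L.smooth_h.comp L.smooth_f L.mapsTo
  have ha := L.smooth_df
  have hc := H.smooth_cog.mono hU
  have hτ := H.smooth_tau.mono hU
  have hci : ∀ i, ContDiffOn ℝ ∞ (fun z => cog θ J z (cf b i)) U := fun i =>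
    hc.clm_apply contDiffOn_const
  -- The witness is `pairL` with each frame trace taken over the fixed basis and `cog`; it involves
  -- no frame.
  refine ⟨fun z => ∑ j, h (f z) (∑ i, tff f (gammaL θ J) G z (b i) (cog θ J z (cf b i)) (b j))
        (fderiv ℝ f z (cog θ J z (cf b j)))
      + ∑ j, h (f z) (∑ i, tff f (gammaL θ J) G z (b i) (J z (cog θ J z (cf b i))) (b j))
        (fderiv ℝ f z (J z (cog θ J z (cf b j))))
      + 2 * m * ∑ j, h (f z) (fderiv ℝ f z (tauL θ J z (J z (b j))))
        (fderiv ℝ f z (cog θ J z (cf b j))), ?_, ?_⟩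
  · refine ((ContDiffOn.sum fun j _ => ?_).add (ContDiffOn.sum fun j _ => ?_)).add
      (contDiffOn_const.mul (ContDiffOn.sum fun j _ => ?_))
    · exact (hh.clm_apply (ContDiffOn.sum fun i _ => smoothOn_tff L contDiffOn_const (hci i)
        contDiffOn_const)).clm_apply (ha.clm_apply (hci j))
    · exact (hh.clm_apply (ContDiffOn.sum fun i _ => smoothOn_tff L contDiffOn_const
        (hJ.clm_apply (hci i)) contDiffOn_const)).clm_apply (ha.clm_apply (hJ.clm_apply (hci j)))
    · exact (hh.clm_apply (ha.clm_apply (hτ.clm_apply (hJ.clm_apply contDiffOn_const)))).clm_apply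
        (ha.clm_apply (hci j))
  · intro z hz e E
    have k₁ : ∀ w, ∑ i, tff f (gammaL θ J) G z (b i) (cog θ J z (cf b i)) w
        = ∑ A, tff f (gammaL θ J) G z (frm (J z) e A) (frm (J z) e A) w := fun w =>
      (sum_cog_frame b H (hU hz) E (fun u v => tff f (gammaL θ J) G z u v w)
        (fun _ _ _ => tff_add₁ _ _ _ _ _ _ _ _) (fun _ _ _ => tff_smul₁ _ _ _ _ _ _ _ _)
        (fun _ _ _ => tff_add₂ _ _ _ _ _ _ _ _) (fun _ _ _ => tff_smul₂ _ _ _ _ _ _ _ _)).symm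
    have k₂ : ∀ w, ∑ i, tff f (gammaL θ J) G z (b i) (J z (cog θ J z (cf b i))) w
        = ∑ A, tff f (gammaL θ J) G z (frm (J z) e A) (J z (frm (J z) e A)) w := fun w =>
      (sum_cog_frame b H (hU hz) E (fun u v => tff f (gammaL θ J) G z u (J z v) w)
        (fun _ _ _ => tff_add₁ _ _ _ _ _ _ _ _) (fun _ _ _ => tff_smul₁ _ _ _ _ _ _ _ _)
        (fun _ _ _ => by rw [map_add]; exact tff_add₂ _ _ _ _ _ _ _ _)
        (fun _ _ _ => by rw [map_smul]; exact tff_smul₂ _ _ _ _ _ _ _ _)).symm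
    simp only [k₁, k₂, pairL]
    congr 1
    · congr 1
      · rw [Finset.sum_comm, ← sum_cog_frame b H (hU hz) E (fun u v => h (f z)
          (∑ A, tff f (gammaL θ J) G z (frm (J z) e A) (frm (J z) e A) u) (fderiv ℝ f z v))
          (fun _ _ _ => by
            simp only [tff_add₃, Finset.sum_add_distrib, map_add, add_apply])
          (fun _ _ _ => by
            simp only [tff_smul₃, ← Finset.smul_sum, map_smul, smul_apply])
          (fun _ _ _ => by simp only [map_add]) (fun _ _ _ => by simp only [map_smul])]
        exact Finset.sum_congr rfl fun B _ => by rw [map_sum, sum_apply]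
      · rw [Finset.sum_comm, ← sum_cog_frame b H (hU hz) E (fun u v => h (f z)
          (∑ A, tff f (gammaL θ J) G z (frm (J z) e A) (J z (frm (J z) e A)) u)
            (fderiv ℝ f z (J z v)))
          (fun _ _ _ => by
            simp only [tff_add₃, Finset.sum_add_distrib, map_add, add_apply])
          (fun _ _ _ => by
            simp only [tff_smul₃, ← Finset.smul_sum, map_smul, smul_apply])
          (fun _ _ _ => by simp only [map_add]) (fun _ _ _ => by simp only [map_smul])]
        exact Finset.sum_congr rfl fun B _ => by rw [map_sum, sum_apply]
    · congr 1
      exact sum_cog_frame b H (hU hz) E (fun u v => h (f z) (fderiv ℝ f z (tauL θ J z (J z u)))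
          (fderiv ℝ f z v))
          (fun _ _ _ => by simp only [map_add, add_apply])
          (fun _ _ _ => by simp only [map_smul, smul_apply])
          (fun _ _ _ => by simp only [map_add]) (fun _ _ _ => by simp only [map_smul])

end SmoothTraces

/-! ### The Bochner field -/

section BochnerField

/-- The standard basis. -/
def eb (k : ℕ) : Module.Basis (Fin k) ℝ (Mod k) := (EuclideanSpace.basisFun (Fin k) ℝ).toBasis

variable {m n : ℕ} {M : Type*} [TopologicalSpace M] [ChartedSpace (Mod (2 * m + 1)) M]
  [IsManifold (𝓡 (2 * m + 1)) ∞ M] (S : StrictlyPseudoconvexCR m M)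
  {N : Type*} [TopologicalSpace N] [ChartedSpace (Mod n) N] [IsManifold (𝓡 n) ∞ N]
  (h : Metric n N) (φ : M → N)

/-- The frame `e₁, …, e_m, J e₁, …, J e_m`. -/
def realFrame {y : M} (e : Fin m → TangentSpace (𝓡 (2 * m + 1)) y) :
    Fin m ⊕ Fin m → TangentSpace (𝓡 (2 * m + 1)) y := Sum.elim e fun α => S.J y (e α)

/-- `Θ(u, v, v') = ⟨β(u, v), dφ v'⟩ - ⟨β(Ju, v), dφ J v'⟩
- (⟨β(v, v'), dφ u⟩ + ⟨β(v, Jv'), dφ J u⟩) / m`. -/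
def bochnerForm (y : M) (u v v' : TangentSpace (𝓡 (2 * m + 1)) y) : ℝ :=
  h.inner (φ y) (secondForm S h φ y u v) (mfderiv (𝓡 (2 * m + 1)) (𝓡 n) φ y v')
    - h.inner (φ y) (secondForm S h φ y (S.J y u) v) (mfderiv (𝓡 (2 * m + 1)) (𝓡 n) φ y (S.J y v'))
    - 1 / m * (h.inner (φ y) (secondForm S h φ y v v') (mfderiv (𝓡 (2 * m + 1)) (𝓡 n) φ y u)
      + h.inner (φ y) (secondForm S h φ y v (S.J y v'))
        (mfderiv (𝓡 (2 * m + 1)) (𝓡 n) φ y (S.J y u)))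

/-- The vector field `∑_{A, B} Θ(ε_A, ε_B, ε_B) ε_A`. -/
def bochnerField (e : (y : M) → Fin m → TangentSpace (𝓡 (2 * m + 1)) y) (y : M) :
    TangentSpace (𝓡 (2 * m + 1)) y :=
  ∑ A, (∑ B, bochnerForm S h φ y (realFrame S (e y) A) (realFrame S (e y) B)
    (realFrame S (e y) B)) • realFrame S (e y) A

variable {S h φ} (hφ : ContMDiff (𝓡 (2 * m + 1)) (𝓡 n) ∞ φ)
  {e : (y : M) → Fin m → TangentSpace (𝓡 (2 * m + 1)) y} (he : ∀ y, S.IsCRFrame y (e y))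
  {p y : M} {q : N}

/-- `bocV` in the charts at `p` and `q`. -/
abbrev bocC (S : StrictlyPseudoconvexCR m M) (h : Metric n N) (φ : M → N) (p : M) (q : N) :
    Mod (2 * m + 1) → Mod (2 * m + 1) :=
  bocV (lm (2 * m + 1) n φ p q) (twL S p) (lcL h q) (metL h q) (S.JL p) (1 / m) (eb _) (S.thL p)

include hφ he

/-- Traces do not depend on the frame, so the field assembled from arbitrary frames coincides with
the smooth `bocV`, whatever the chart of N. -/
lemma co_bochnerField (hy : y ∈ (ch (2 * m + 1) p).source) (hq : φ y ∈ (ch n q).source) :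
    co _ p y (bochnerField S h φ e y) = bocC S h φ p q (ch _ p y) := by
  have hz := mem_ov (φ := φ) hy hq
  have F := (he y).frameL (p := p) hy
  have e1 : ∀ A, co _ p y (realFrame S (e y) A)
      = frm (S.JL p (ch _ p y)) (fun α => co _ p y (e y α)) A := fun A => (frm_co hy A).symm
  rw [bocC, bocV_frame (S.localCR p) (Set.inter_subset_left : ov (2 * m + 1) n φ p q ⊆ _) hz F,
    bochnerField, map_sum]
  refine Finset.sum_congr rfl fun A _ => ?_
  rw [bocF_frame (S.localCR p) (Set.inter_subset_left : ov (2 * m + 1) n φ p q ⊆ _) hz F, map_smul,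
    e1]
  congr 1
  refine Finset.sum_congr rfl fun B _ => ?_
  rw [bochnerForm, bf, bform, lm_ch hy]
  simp only [metL_co h hq, co_secondForm S h hφ hy hq, co_mfderiv hφ hy hq, ← endL_co S.J hy, e1]

lemma rep_bochnerField {z : Mod (2 * m + 1)} (hz : z ∈ ov (2 * m + 1) n φ p q) :
    rep _ p (bochnerField S h φ e) z = bocC S h φ p q z := by
  rw [rep, co_bochnerField hφ he (symm_mem hz.1) hz.2, (ch _ p).right_inv hz.1]

/-- The image of a chart domain of M need not lie in one chart of N, so around each point the chart
of N is taken at the image of that point. -/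
lemma smoothOn_bochnerField :
    ContDiffOn ℝ ∞ (rep _ p (bochnerField S h φ e)) (ch (2 * m + 1) p).target := by
  intro z hz
  have hz' : z ∈ ov (2 * m + 1) n φ p (φ ((ch _ p).symm z)) :=
    ⟨hz, mem_extChartAt_source (I := 𝓡 n) _⟩
  have ho := isOpen_ov hφ (p := p) (q := φ ((ch _ p).symm z))
  refine (((smoothOn_bocV (eb _) (localMap_chart hφ) (S.localCR p) Set.inter_subset_left).contDiffAt
    (ho.mem_nhds hz')).congr_of_eventuallyEq (Filter.eventually_of_mem (ho.mem_nhds hz') fun w hw =>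
      rep_bochnerField hφ he hw)).contDiffWithinAt

/-- The divergence of the Bochner field in the chart at `p`. -/
lemma le_div_bochnerField (hm : 2 ≤ m) (hN : NonposHermitianCurvature h)
    (hy : y ∈ (ch (2 * m + 1) p).source)
    {E : Fin n → TangentSpace (𝓡 n) (φ y)} (hE : IsOrthonormalFrame h E) :
    2 * (((m : ℝ) - 1) / m) * paneitzPairing S h φ (e y) E
      ≤ ∑ k, cf (eb _) k (fderiv ℝ (rep _ p (bochnerField S h φ e)) (ch _ p y) (eb _ k))
        + ∑ k, cf (eb _) k (twL S p (ch _ p y) (rep _ p (bochnerField S h φ e) (ch _ p y))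
          (eb _ k)) := by
  have hq : φ y ∈ (ch n (φ y)).source := mem_extChartAt_source (I := 𝓡 n) (φ y)
  have hz := mem_ov (φ := φ) (p := p) hy hq
  have F := (he y).frameL (p := p) hy
  have L := localMap_chart (S := S) (h := h) (p := p) (q := φ y) hφ
  have m0 : (0 : ℝ) < m := by exact_mod_cast (by omega : 0 < m)
  have ev : rep _ p (bochnerField S h φ e) =ᶠ[𝓝 (ch _ p y)] bocC S h φ p (φ y) :=
    Filter.eventually_of_mem ((isOpen_ov hφ).mem_nhds hz) fun w hw => rep_bochnerField hφ he hw
  rw [ev.fderiv_eq, ev.eq_of_nhds, bocC, div_bocV L (S.localCR p) Set.inter_subset_left hz F,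
    sum_bfD L (S.localCR p) Set.inter_subset_left hz F m0.ne', paneitzPairing_chart hφ hy hq (he y) hE]
  -- Only the signs of these two terms remain to be used; the factor 2 in the claim arises because
  -- the pairing is half of `pairL`.
  have h1 := hermL_nonneg (p := p) hN hφ hy (he y)
  have h2 := quadL_nonneg L (S.localCR p) Set.inter_subset_left hz F m0
  linarith

-- The value is frame-independent and locally a smooth function of the point, so no regularity of
-- the frames is needed.
omit hφ in
lemma continuous_paneitzPairing (hφ : ContMDiff (𝓡 (2 * m + 1)) (𝓡 n) ∞ φ)
    {E : (y : M) → Fin n → TangentSpace (𝓡 n) (φ y)} (hE : ∀ y, IsOrthonormalFrame h (E y)) :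
    Continuous fun y => paneitzPairing S h φ (e y) (E y) := by
  refine continuous_iff_continuousAt.2 fun x => ?_
  have hx := mem_extChartAt_source (I := 𝓡 (2 * m + 1)) x
  have hqx := mem_extChartAt_source (I := 𝓡 n) (φ x)
  have ho := isOpen_ov hφ (p := x) (q := φ x)
  obtain ⟨P, hP, hP'⟩ := exists_smoothOn_pairL (m := m) (eb _)
    (localMap_chart (S := S) (h := h) (p := x) (q := φ x) hφ) (S.localCR x) Set.inter_subset_left
  have hc : ContinuousAt (fun y => 1 / 2 * P (ch _ x y)) x :=
    continuousAt_const.mul (ContinuousAt.comp (hP.continuousOn.continuousAt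
      (ho.mem_nhds (mem_ov hx hqx))) (continuousAt_extChartAt x))
  refine hc.congr_of_eventuallyEq ?_
  filter_upwards [(source_open x).mem_nhds hx,
    hφ.continuous.continuousAt.preimage_mem_nhds ((source_open (φ x)).mem_nhds hqx)] with y hy hq
  rw [paneitzPairing_chart hφ hy hq (he y) (hE y), hP' _ (mem_ov hy hq) _ ((he y).frameL hy)]

end BochnerField

/-! ### The volume form -/

section VolumeForm

variable {m : ℕ}

/-- The index `2i + 1`. -/
abbrev ixo (i : Fin m) : Fin (2 * m + 1) := ⟨2 * i + 1, by omega⟩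

/-- The index `2i + 2`. -/
abbrev ixe (i : Fin m) : Fin (2 * m + 1) := ⟨2 * i + 2, by omega⟩

/-- The coefficient of `θ ∧ ωᵐ` in terms of the components of `θ` and `η`. -/
def volPoly (c : (Fin (2 * m + 1) → ℝ) × (Fin (2 * m + 1) → Fin (2 * m + 1) → ℝ)) : ℝ :=
  (1 / 2 ^ m : ℝ) * ∑ σ : Equiv.Perm (Fin (2 * m + 1)), ((Equiv.Perm.sign σ : ℤ) : ℝ) *
    (c.1 (σ 0) * ∏ i : Fin m, c.2 (σ (ixo i)) (σ (ixe i)))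

lemma contDiff_volPoly : ContDiff ℝ ∞ (volPoly (m := m)) := by
  have h2 : ∀ i j, ContDiff ℝ ∞
      fun c : (Fin (2 * m + 1) → ℝ) × (Fin (2 * m + 1) → Fin (2 * m + 1) → ℝ) => c.2 i j :=
    fun i j => contDiff_apply_apply ℝ ℝ i j |>.comp contDiff_snd
  have h1 : ∀ i, ContDiff ℝ ∞
      fun c : (Fin (2 * m + 1) → ℝ) × (Fin (2 * m + 1) → Fin (2 * m + 1) → ℝ) => c.1 i :=
    fun i => (contDiff_apply ℝ ℝ i).comp contDiff_fst
  exact contDiff_const.mul (ContDiff.sum fun σ _ => contDiff_const.mul ((h1 _).mul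
    (contDiff_prod fun i _ => h2 _ _)))

variable {V : Type*} [AddCommGroup V] [Module ℝ V]

/-- Each index is 0, or 2i + 1 or 2i + 2 for a single i, so every vector occurs in exactly one
factor and there linearly. -/
lemma exists_linear_update (θ : V →ₗ[ℝ] ℝ) (η : V →ₗ[ℝ] V →ₗ[ℝ] ℝ) (v : Fin (2 * m + 1) → V)
    (j : Fin (2 * m + 1)) : ∃ L : V →ₗ[ℝ] ℝ, ∀ x, θ (Function.update v j x 0)
      * ∏ i : Fin m, η (Function.update v j x (ixo i)) (Function.update v j x (ixe i)) = L x := by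
  classical
  rcases eq_or_ne j 0 with rfl | hj
  · refine ⟨(∏ i : Fin m, η (v (ixo i)) (v (ixe i))) • θ, fun x => ?_⟩
    have e1 : ∀ i : Fin m, ixo i ≠ 0 := fun i h => by simp [Fin.ext_iff] at h
    have e2 : ∀ i : Fin m, ixe i ≠ 0 := fun i h => by simp [Fin.ext_iff] at h
    simp only [Function.update_self, Function.update_of_ne (e1 _), Function.update_of_ne (e2 _)]
    exact mul_comm _ _
  obtain ⟨i₀, h | h⟩ : ∃ i : Fin m, j = ixo i ∨ j = ixe i := by
    have hj' : (j : ℕ) ≠ 0 := fun h => hj (Fin.ext h)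
    refine ⟨⟨(j - 1) / 2, by omega⟩, ?_⟩
    simp only [Fin.ext_iff]
    omega
  all_goals
    have e0 : (0 : Fin (2 * m + 1)) ≠ j := hj.symm
    have e1 : ∀ i, i ≠ i₀ → ixo i ≠ j := fun i hi h' => by
      simp only [h, Fin.ext_iff] at h' hi; omega
    have e2 : ∀ i, i ≠ i₀ → ixe i ≠ j := fun i hi h' => by
      simp only [h, Fin.ext_iff] at h' hi; omega
    have key : ∀ x, θ (Function.update v j x 0) * ∏ i : Fin m, η (Function.update v j x (ixo i))
          (Function.update v j x (ixe i))
        = (θ (v 0) * ∏ i ∈ Finset.univ.erase i₀, η (v (ixo i)) (v (ixe i)))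
          * η (Function.update v j x (ixo i₀)) (Function.update v j x (ixe i₀)) := by
      intro x
      rw [← Finset.prod_erase_mul _ _ (Finset.mem_univ i₀), Function.update_of_ne e0, ← mul_assoc]
      congr 2
      refine Finset.prod_congr rfl fun i hi => ?_
      have hi' := Finset.ne_of_mem_erase hi
      rw [Function.update_of_ne (e1 i hi'), Function.update_of_ne (e2 i hi')]
  · refine ⟨(θ (v 0) * ∏ i ∈ Finset.univ.erase i₀, η (v (ixo i)) (v (ixe i)))
      • η.flip (v (ixe i₀)), fun x => ?_⟩
    have : ixe i₀ ≠ j := fun h' => by simp only [h, Fin.ext_iff] at h'; omega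
    rw [key, Function.update_of_ne this, ← h, Function.update_self]
    rfl
  · refine ⟨(θ (v 0) * ∏ i ∈ Finset.univ.erase i₀, η (v (ixo i)) (v (ixe i)))
      • η (v (ixo i₀)), fun x => ?_⟩
    have : ixo i₀ ≠ j := fun h' => by simp only [h, Fin.ext_iff] at h'; omega
    rw [key, Function.update_of_ne this, ← h, Function.update_self]
    rfl

/-- The alternating form `θ ∧ ωᵐ`. -/
def volAlt (θ : V →ₗ[ℝ] ℝ) (η : V →ₗ[ℝ] V →ₗ[ℝ] ℝ) : V [⋀^Fin (2 * m + 1)]→ₗ[ℝ] ℝ :=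
  (1 / 2 ^ m : ℝ) • MultilinearMap.alternatization
    { toFun := fun v => θ (v 0) * ∏ i : Fin m, η (v (ixo i)) (v (ixe i))
      map_update_add' := fun v j x y => by
        obtain ⟨L, hL⟩ := exists_linear_update θ η v j
        convert L.map_add x y using 1
        · convert hL (x + y)
        · congr 1
          · convert hL x
          · convert hL y
      map_update_smul' := fun v j c x => by
        obtain ⟨L, hL⟩ := exists_linear_update θ η v j
        convert L.map_smul c x using 1
        · convert hL (c • x)
        · congr 1
          convert hL x }

lemma volAlt_apply (θ : V →ₗ[ℝ] ℝ) (η : V →ₗ[ℝ] V →ₗ[ℝ] ℝ) (v : Fin (2 * m + 1) → V) :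
    volAlt θ η v = volPoly (fun i => θ (v i), fun i j => η (v i) (v j)) := by
  rw [volAlt, AlternatingMap.smul_apply, MultilinearMap.alternatization_apply, volPoly, smul_eq_mul]
  congr 1
  refine Finset.sum_congr rfl fun σ _ => ?_
  rw [MultilinearMap.domDomCongr_apply]
  simp only [Units.smul_def, zsmul_eq_mul]
  rfl

/-- The transformation of `θ ∧ ωᵐ` under linear maps. -/
lemma volPoly_det (b : Module.Basis (Fin (2 * m + 1)) ℝ V) (θ : V →ₗ[ℝ] ℝ) (η : V →ₗ[ℝ] V →ₗ[ℝ] ℝ)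
    (A : V →ₗ[ℝ] V) : volPoly (fun i => θ (A (b i)), fun i j => η (A (b i)) (A (b j)))
      = LinearMap.det A * volPoly (fun i => θ (b i), fun i j => η (b i) (b j)) := by
  -- A top-degree alternating form is a multiple of the determinant in the basis b.
  have h := congrArg (fun F => F (A ∘ b)) ((volAlt (m := m) θ η).eq_smul_basis_det b)
  simp only [AlternatingMap.smul_apply, smul_eq_mul, Module.Basis.det_comp, Module.Basis.det_self,
    mul_one, volAlt_apply] at h
  exact h.trans (mul_comm _ _)

end VolumeForm

/-! ### The logarithmic derivative of the volume density. -/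

section VolumeDerivative

variable {m : ℕ} {V : Type*} [NormedAddCommGroup V] [NormedSpace ℝ V] [FiniteDimensional ℝ V]
  {U : Set V} {θ : V → V →L[ℝ] ℝ} {J : V → V →L[ℝ] V} {z : V}
  (b : Module.Basis (Fin (2 * m + 1)) ℝ V)

/-- The coefficient of `θ ∧ (dθ)ᵐ` in the basis `b`. -/
def volL (θ : V → V →L[ℝ] ℝ) (z : V) : ℝ :=
  volPoly (fun i => θ z (b i), fun i j => levi θ z (b i) (b j))

omit [FiniteDimensional ℝ V] in
lemma hasDerivAt_det_one_add (A : V →ₗ[ℝ] V) :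
    HasDerivAt (fun t : ℝ => LinearMap.det (1 + t • A)) (∑ k, b.coord k (A (b k))) 0 := by
  have e : ∀ t : ℝ, LinearMap.det (1 + t • A) = (1 + t • LinearMap.toMatrix b b A).det := by
    intro t
    rw [← LinearMap.det_toMatrix b, map_add, map_smul]
    congr 2
    exact LinearMap.toMatrix_one b
  have e : ∀ t : ℝ, LinearMap.det (1 + t • A) = _ := fun t =>
    (e t).trans (Matrix.det_one_add_smul t _)
  have tr : (LinearMap.toMatrix b b A).trace = ∑ k, b.coord k (A (b k)) := by
    simp [Matrix.trace, LinearMap.toMatrix_apply]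
  simp only [e, tr]
  have h1 := ((hasDerivAt_const (0 : ℝ) (1 : ℝ)).add
    ((hasDerivAt_id (0 : ℝ)).const_mul (∑ k, b.coord k (A (b k)))))
  have h2 : DifferentiableAt ℝ (fun t : ℝ =>
    (Polynomial.eval t (Matrix.det (1 + (Polynomial.X : Polynomial ℝ) •
      (LinearMap.toMatrix b b A).map Polynomial.C)).divX.divX)) 0 := Polynomial.differentiableAt _
  have h3 := h1.add (h2.hasDerivAt.mul ((hasDerivAt_id (0 : ℝ)).pow 2))
  refine h3.congr_deriv ?_ |>.congr_of_eventuallyEq ?_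
  · simp
  · exact Filter.Eventually.of_forall fun t => by simp

namespace LocalCR

variable (H : LocalCR U θ J)
include H

lemma smoothOn_volL : ContDiffOn ℝ ∞ (volL b θ) U :=
  contDiff_volPoly.comp_contDiffOn (ContDiffOn.prodMk
    (contDiffOn_pi.2 fun _ => H.smooth_θ.clm_apply contDiffOn_const)
    (contDiffOn_pi.2 fun _ => contDiffOn_pi.2 fun _ =>
      (H.smooth_levi.clm_apply contDiffOn_const).clm_apply contDiffOn_const))

/-- The volume form is parallel. -/
lemma fderiv_volL (hz : z ∈ U) (a : V) :
    fderiv ℝ (volL b θ) z a = (∑ k, cf b k (gammaL θ J z a (b k))) * volL b θ z := by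
  let A : V →ₗ[ℝ] V := (gammaL θ J z a).toLinearMap
  -- Since θ and dθ are parallel, moving the point in the direction a changes their components, to
  -- first order, as pulling back by 1 + tΓ_a does. Along this second curve γ the coefficient is
  -- multiplied by det(1 + tΓ_a), whose derivative at 0 is tr Γ_a.
  let γ : ℝ → (Fin (2 * m + 1) → ℝ) × (Fin (2 * m + 1) → Fin (2 * m + 1) → ℝ) := fun t =>
    (fun i => θ z ((1 + t • A : V →ₗ[ℝ] V) (b i)), fun i j =>
      levi θ z ((1 + t • A : V →ₗ[ℝ] V) (b i)) ((1 + t • A : V →ₗ[ℝ] V) (b j)))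
  let γ' : (Fin (2 * m + 1) → ℝ) × (Fin (2 * m + 1) → Fin (2 * m + 1) → ℝ) :=
    (fun i => θ z (gammaL θ J z a (b i)), fun i j =>
      levi θ z (gammaL θ J z a (b i)) (b j) + levi θ z (b i) (gammaL θ J z a (b j)))
  let δ : V → (Fin (2 * m + 1) → ℝ) × (Fin (2 * m + 1) → Fin (2 * m + 1) → ℝ) := fun y =>
    (fun i => θ y (b i), fun i j => levi θ y (b i) (b j))
  have dv := (contDiff_volPoly (m := m)).differentiable (by simp)
  have h0 : γ 0 = δ z := by simp [γ, δ]
  have hγ : HasDerivAt γ γ' 0 := by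
    have hl : ∀ i, HasDerivAt (fun t : ℝ => (1 + t • A : V →ₗ[ℝ] V) (b i)) (A (b i)) 0 := by
      intro i
      have := ((hasDerivAt_id (0 : ℝ)).smul_const (A (b i))).const_add (b i)
      rw [one_smul] at this
      exact this
    refine HasDerivAt.prodMk (hasDerivAt_pi.2 fun i => ?_)
      (hasDerivAt_pi.2 fun i => hasDerivAt_pi.2 fun j => ?_)
    · exact (θ z).hasFDerivAt.comp_hasDerivAt (0 : ℝ) (hl i)
    · have h1 := (levi θ z).hasFDerivAt.comp_hasDerivAt (0 : ℝ) (hl i)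
      have h2 := h1.clm_apply (hl j)
      refine h2.congr_deriv ?_
      simp [A]
  have hδ : fderiv ℝ δ z a = γ' := by
    have d1 : ∀ i, HasFDerivAt (fun y => θ y (b i)) (fderiv ℝ (fun y => θ y (b i)) z) z := fun i =>
      ((H.dθ hz).clm_apply (differentiableAt_const _)).hasFDerivAt
    have d2 : ∀ i j, HasFDerivAt (fun y => levi θ y (b i) (b j))
        (fderiv ℝ (fun y => levi θ y (b i) (b j)) z) z := fun i j =>
      (((H.dω hz).clm_apply (differentiableAt_const _)).clm_apply
        (differentiableAt_const _)).hasFDerivAt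
    have hd : HasFDerivAt δ _ z := (hasFDerivAt_pi.2 d1).prodMk
      (hasFDerivAt_pi.2 fun i => hasFDerivAt_pi.2 fun j => d2 i j)
    rw [hd.fderiv]
    refine Prod.ext (funext fun i => ?_) (funext fun i => funext fun j => ?_)
    · change fderiv ℝ (fun y => θ y (b i)) z a = _
      rw [fderiv_clm_app_const (H.dθ hz), H.fderiv_θ hz]
    · change fderiv ℝ (fun y => levi θ y (b i) (b j)) z a = _
      rw [fderiv_clm_app_const ((H.dω hz).clm_apply (differentiableAt_const _)),
        fderiv_clm_app_const (H.dω hz), H.fderiv_ω hz]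
  have dδ : DifferentiableAt ℝ δ z := by
    refine DifferentiableAt.prodMk (differentiableAt_pi.2 fun i => ?_)
      (differentiableAt_pi.2 fun i => differentiableAt_pi.2 fun j => ?_)
    · exact (H.dθ hz).clm_apply (differentiableAt_const _)
    · exact ((H.dω hz).clm_apply (differentiableAt_const _)).clm_apply (differentiableAt_const _)
  have h1 : fderiv ℝ (volL b θ) z a = fderiv ℝ volPoly (δ z) γ' := by
    have : fderiv ℝ (fun y => volPoly (δ y)) z = _ := fderiv_fun_comp z (dv (δ z)) dδ
    rw [← hδ]
    exact congrArg (fun L : V →L[ℝ] ℝ => L a) this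
  have h2 : HasDerivAt (fun t => volPoly (γ t)) (fderiv ℝ volPoly (δ z) γ') 0 := by
    rw [← h0]
    exact (dv (γ 0)).hasFDerivAt.comp_hasDerivAt (0 : ℝ) hγ
  have h3 : (fun t => volPoly (γ t)) = fun t => LinearMap.det (1 + t • A) * volL b θ z :=
    funext fun t => volPoly_det b (θ z).toLinearMap
      (LinearMap.mk₂ ℝ (fun u v => levi θ z u v) (by simp) (by simp) (by simp) (by simp)) (1 + t • A)
  rw [h3] at h2
  rw [h1, h2.unique ((hasDerivAt_det_one_add b A).mul_const _)]
  rfl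

end LocalCR

omit [FiniteDimensional ℝ V] in
/-- A function that vanishes to first order at its zeros has a differentiable absolute value. -/
lemma hasFDerivAt_abs_of_logarithmic {ρ : V → ℝ} {z : V} (hd : DifferentiableAt ℝ ρ z)
    {ℓ : V → ℝ} (h : ∀ a, fderiv ℝ ρ z a = ℓ a * ρ z) :
    DifferentiableAt ℝ (fun y => |ρ y|) z ∧ ∀ a, fderiv ℝ (fun y => |ρ y|) z a = ℓ a * |ρ z| := by
  rcases lt_trichotomy (ρ z) 0 with h0 | h0 | h0
  · have ev : (fun y => |ρ y|) =ᶠ[𝓝 z] fun y => -ρ y := by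
      filter_upwards [hd.continuousAt.eventually (gt_mem_nhds h0)] with y hy
      exact abs_of_neg hy
    refine ⟨hd.fun_neg.congr_of_eventuallyEq ev, fun a => ?_⟩
    rw [ev.fderiv_eq, fderiv_fun_neg, neg_apply, h, abs_of_neg h0]
    ring
  -- At a zero of ρ the logarithmic equation makes the derivative vanish as well. So Ψ need not be
  -- known to be nowhere zero.
  · have hz : fderiv ℝ ρ z = 0 := by
      ext a
      rw [h, h0, mul_zero]
      rfl
    have hf : HasFDerivAt (fun y => |ρ y|) (0 : V →L[ℝ] ℝ) z := by
      have := hd.hasFDerivAt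
      rw [hz, hasFDerivAt_iff_isLittleO] at this
      rw [hasFDerivAt_iff_isLittleO]
      simp only [h0, sub_zero, zero_apply, abs_zero] at this ⊢
      exact this.abs_left
    refine ⟨hf.differentiableAt, fun a => ?_⟩
    rw [hf.fderiv, h0, abs_zero, mul_zero]
    rfl
  · have ev : (fun y => |ρ y|) =ᶠ[𝓝 z] ρ := by
      filter_upwards [hd.continuousAt.eventually (lt_mem_nhds h0)] with y hy
      exact abs_of_pos hy
    refine ⟨hd.congr_of_eventuallyEq ev, fun a => ?_⟩
    rw [ev.fderiv_eq, h, abs_of_pos h0]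

end VolumeDerivative

/-! ### The measure of the volume form -/

lemma measurableSet_inter_preimage_of_continuousOn {X Y : Type*} [TopologicalSpace X]
    [MeasurableSpace X] [OpensMeasurableSpace X] [TopologicalSpace Y] [MeasurableSpace Y]
    [BorelSpace Y] {f : X → Y} {U : Set X} (hU : IsOpen U) (hf : ContinuousOn f U) {s : Set Y}
    (hs : MeasurableSet s) : MeasurableSet (U ∩ f ⁻¹' s) := by
  have := (hU.measurableSet).subtype_image ((continuousOn_iff_continuous_domRestrict.1 hf).measurable hs)
  convert this using 1
  ext x
  simp [Set.domRestrict, and_comm]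

namespace StrictlyPseudoconvexCR

variable {m : ℕ} {M : Type*} [TopologicalSpace M] [ChartedSpace (Mod (2 * m + 1)) M]
  [IsManifold (𝓡 (2 * m + 1)) ∞ M] (S : StrictlyPseudoconvexCR m M) {p q : M}

/-- The coefficient of `Ψ` in the chart at `p`. -/
abbrev den (p : M) : Mod (2 * m + 1) → ℝ := volL (eb _) (S.thL p)

lemma volForm_chart {y : M} (hy : y ∈ (ch (2 * m + 1) p).source)
    (v : Fin (2 * m + 1) → TangentSpace (𝓡 (2 * m + 1)) y) :
    S.volForm y v = volPoly (fun i => S.thL p (ch _ p y) (co _ p y (v i)),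
      fun i j => levi (S.thL p) (ch _ p y) (co _ p y (v i)) (co _ p y (v j))) := by
  simp only [volForm, volPoly, S.dθ_chart hy, formL_co S.θ hy]

lemma volForm_coordinate {z : Mod (2 * m + 1)} (hz : z ∈ (ch (2 * m + 1) p).target) :
    S.volForm ((ch _ p).symm z) (fun i => mfderiv 𝓘(ℝ, Mod (2 * m + 1)) (𝓡 (2 * m + 1))
      (ch _ p).symm z (EuclideanSpace.single i 1 : Mod (2 * m + 1))) = S.den p z := by
  rw [S.volForm_chart (symm_mem hz), (ch _ p).right_inv hz, ← fr_eq_mfderiv hz]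
  have e : ∀ i, co _ p ((ch _ p).symm z) (fr _ p ((ch _ p).symm z)
      (EuclideanSpace.single i 1 : Mod (2 * m + 1))) = eb _ i := fun i => by
    rw [co_fr (symm_mem hz), eb, OrthonormalBasis.coe_toBasis, EuclideanSpace.basisFun_apply]
  rw [den, volL]
  congr 1
  exact Prod.ext (funext fun i => congrArg (S.thL p z) (e i)) (funext fun i => funext fun j =>
    congrArg₂ (fun u v => levi (S.thL p) z u v) (e i) (e j))

lemma continuousOn_den : ContinuousOn (S.den p) (ch (2 * m + 1) p).target :=
  ((S.localCR p).smoothOn_volL (eb _)).continuousOn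

/-- The change of charts for `Ψ`. -/
lemma den_transition {z : Mod (2 * m + 1)} (hz : z ∈ ov (2 * m + 1) (2 * m + 1) (id : M → M) p q) :
    S.den p z = (fderiv ℝ (lm (2 * m + 1) (2 * m + 1) (id : M → M) p q) z).det
      * S.den q (lm (2 * m + 1) (2 * m + 1) (id : M → M) p q z) := by
  set y := (ch (2 * m + 1) p).symm z with hy
  have hyp : y ∈ (ch (2 * m + 1) p).source := symm_mem hz.1
  have hyq : y ∈ (ch (2 * m + 1) q).source := hz.2
  have hzy : ch (2 * m + 1) p y = z := (ch _ p).right_inv hz.1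
  set f := lm (2 * m + 1) (2 * m + 1) (id : M → M) p q with hf
  have hfz : f z = ch (2 * m + 1) q y := rfl
  have hco : ∀ v, co _ q y (fr _ p y v) = fderiv ℝ f z v := fun v => by
    have h := co_mfderiv (φ := (id : M → M)) contMDiff_id (p := p) (q := q) hyp hyq (fr _ p y v)
    rw [mfderiv_id, co_fr hyp, hzy] at h
    exact h
  have hθ : ∀ v, S.thL p z v = S.thL q (f z) (fderiv ℝ f z v) := fun v => by
    rw [← hco, hfz, formL_co S.θ hyq, ← formL_co S.θ hyp, hzy, co_fr hyp]
  have hω : ∀ u v, levi (S.thL p) z u v = levi (S.thL q) (f z) (fderiv ℝ f z u) (fderiv ℝ f z v) :=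
    fun u v => by
    rw [← hco, ← hco, hfz, ← S.dθ_chart hyq, S.dθ_chart hyp, hzy, co_fr hyp, co_fr hyp]
  simp only [den, volL, hθ, hω]
  exact volPoly_det (eb _) (S.thL q (f z)).toLinearMap (LinearMap.mk₂ ℝ
    (fun u v => levi (S.thL q) (f z) u v) (by simp) (by simp) (by simp) (by simp))
    (fderiv ℝ f z).toLinearMap

variable [MeasurableSpace M] [BorelSpace M]

omit [BorelSpace M] in
lemma chartMeasure_eq : S.chartMeasure p = Measure.map (ch (2 * m + 1) p).symm
    ((volume.restrict (ch (2 * m + 1) p).target).withDensity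
      fun z => ENNReal.ofReal |S.den p z|) := by
  rw [chartMeasure]
  congr 1
  refine withDensity_congr_ae ?_
  filter_upwards [ae_restrict_mem (target_open p).measurableSet] with z hz
  rw [S.volForm_coordinate hz]

omit [IsManifold (𝓡 (2 * m + 1)) ∞ M] in
lemma aemeasurable_symm (ρ : Mod (2 * m + 1) → ENNReal) : AEMeasurable (ch (2 * m + 1) p).symm
    ((volume.restrict (ch (2 * m + 1) p).target).withDensity ρ) :=
  ((continuousOn_extChartAt_symm p).aemeasurable (target_open p).measurableSet).mono_ac
    (withDensity_absolutelyContinuous _ _)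

lemma chartMeasure_apply {s : Set M} (hs : MeasurableSet s) : S.chartMeasure p s
    = ∫⁻ z in (ch (2 * m + 1) p).target ∩ (ch (2 * m + 1) p).symm ⁻¹' s,
      ENNReal.ofReal |S.den p z| := by
  rw [S.chartMeasure_eq, Measure.map_apply_of_aemeasurable (aemeasurable_symm _) hs,
    withDensity_apply', Measure.restrict_restrict' (target_open p).measurableSet, Set.inter_comm]

lemma chartMeasure_inter_source {s : Set M} (hs : MeasurableSet s) :
    S.chartMeasure p (s ∩ (ch (2 * m + 1) p).source) = S.chartMeasure p s := by
  rw [S.chartMeasure_apply hs, S.chartMeasure_apply (hs.inter (source_open p).measurableSet)]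
  congr 2
  ext z
  simp only [Set.mem_inter_iff, Set.mem_preimage, and_congr_right_iff, and_iff_left_iff_imp]
  exact fun hz _ => symm_mem hz

/-- The chart measures agree on overlaps. -/
lemma chartMeasure_overlap {s : Set M} (hs : MeasurableSet s)
    (hp : s ⊆ (ch (2 * m + 1) p).source) (hq : s ⊆ (ch (2 * m + 1) q).source) :
    S.chartMeasure q s = S.chartMeasure p s := by
  rw [S.chartMeasure_apply hs, S.chartMeasure_apply hs]
  set f := lm (2 * m + 1) (2 * m + 1) (id : M → M) p q with hf
  set A := (ch (2 * m + 1) p).target ∩ (ch (2 * m + 1) p).symm ⁻¹' s with hA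
  have hAm : MeasurableSet A := measurableSet_inter_preimage_of_continuousOn (target_open p)
    (continuousOn_extChartAt_symm p) hs
  have hov : A ⊆ ov (2 * m + 1) (2 * m + 1) (id : M → M) p q := fun z hz => ⟨hz.1, hq hz.2⟩
  have hinj : Set.InjOn f A := by
    intro z hz w hw h
    have h1 := (ch _ q).injOn (hq hz.2) (hq hw.2) h
    exact (ch _ p).symm.injOn hz.1 hw.1 h1
  have himg : (ch (2 * m + 1) q).target ∩ (ch (2 * m + 1) q).symm ⁻¹' s = f '' A := by
    ext w
    constructor
    · rintro ⟨hw, hws⟩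
      refine ⟨ch _ p ((ch _ q).symm w), ⟨map_mem (hp hws), ?_⟩, ?_⟩
      · rw [Set.mem_preimage, (ch _ p).left_inv (hp hws)]; exact hws
      · change ch _ q ((ch _ p).symm (ch _ p ((ch _ q).symm w))) = w
        rw [(ch _ p).left_inv (hp hws), (ch _ q).right_inv hw]
    · rintro ⟨z, hz, rfl⟩
      refine ⟨map_mem (hq hz.2), ?_⟩
      change (ch _ q).symm (ch _ q ((ch _ p).symm z)) ∈ s
      rw [(ch _ q).left_inv (hq hz.2)]
      exact hz.2
  rw [himg, lintegral_image_eq_lintegral_abs_det_fderiv_mul volume hAm (f' := fun z => fderiv ℝ f z)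
    (fun z hz => (differentiableAt_lm contMDiff_id (hov hz)).hasFDerivAt.hasFDerivWithinAt) hinj]
  refine setLIntegral_congr_fun hAm fun z hz => ?_
  rw [← ENNReal.ofReal_mul (abs_nonneg _), ← abs_mul, ← S.den_transition (hov hz)]

/-- On this source every chart measure is dominated by that of p, because chart measures agree on
overlaps, and that of p is one of the measures in the supremum. -/
lemma volMeasure_restrict_source :
    S.volMeasure.restrict (ch (2 * m + 1) p).source = S.chartMeasure p := by
  have hsrc := (source_open (k := 2 * m + 1) p).measurableSet
  refine le_antisymm ?_ ?_
  -- A supremum of measures is not computed setwise, so it is bounded by exhibiting a measure above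
  -- all chart measures: that of p, plus the supremum restricted to the complement of the source.
  · have hle : S.volMeasure ≤ S.chartMeasure p
        + S.volMeasure.restrict (ch (2 * m + 1) p).sourceᶜ := by
      refine iSup_le fun q => Measure.le_iff.2 fun s hs => ?_
      have hs' := hs.inter hsrc
      rw [← measure_inter_add_sdiff s hsrc, Measure.add_apply, Measure.restrict_apply hs]
      refine add_le_add ?_ (le_iSup (fun p => S.chartMeasure p) q _)
      rw [← S.chartMeasure_inter_source hs',
        S.chartMeasure_overlap (p := p) (hs'.inter (source_open q).measurableSet)
          (fun x hx => hx.1.2) (fun x hx => hx.2)]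
      exact measure_mono fun x hx => hx.1.1
    refine Measure.le_iff.2 fun s hs => ?_
    rw [Measure.restrict_apply hs]
    refine (hle _).trans ?_
    rw [Measure.add_apply, Measure.restrict_apply (hs.inter hsrc), Set.inter_assoc,
      Set.inter_compl_self, Set.inter_empty, measure_empty, add_zero]
    exact measure_mono Set.inter_subset_left
  · refine Measure.le_iff.2 fun s hs => ?_
    rw [Measure.restrict_apply hs, ← S.chartMeasure_inter_source hs]
    exact le_iSup (fun p => S.chartMeasure p) p _

instance : IsLocallyFiniteMeasure S.volMeasure := by
  refine ⟨fun x => ?_⟩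
  have hx := mem_extChartAt_source (I := 𝓡 (2 * m + 1)) x
  set z₀ := ch (2 * m + 1) x x with hz₀
  have hz := map_mem hx
  have hc : ContinuousAt (fun z => |S.den x z|) z₀ :=
    (S.continuousOn_den.continuousAt ((target_open x).mem_nhds hz)).abs
  obtain ⟨O, hO, hO', hzO⟩ := _root_.mem_nhds_iff.1 (Filter.inter_mem
    (hc.eventually (gt_mem_nhds (lt_add_one |S.den x z₀|))) (Metric.ball_mem_nhds z₀ one_pos))
  refine ⟨(ch _ x).source ∩ ch _ x ⁻¹' O, Filter.inter_mem ((source_open x).mem_nhds hx)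
    ((continuousAt_extChartAt x).preimage_mem_nhds (hO'.mem_nhds hzO)), ?_⟩
  have hs : MeasurableSet ((ch (2 * m + 1) x).source ∩ ch (2 * m + 1) x ⁻¹' O) :=
    ((continuousOn_extChartAt x).isOpen_inter_preimage (source_open x) hO').measurableSet
  have e : S.volMeasure ((ch (2 * m + 1) x).source ∩ ch (2 * m + 1) x ⁻¹' O)
      = S.chartMeasure x ((ch (2 * m + 1) x).source ∩ ch (2 * m + 1) x ⁻¹' O) := by
    rw [← S.volMeasure_restrict_source, Measure.restrict_apply hs]
    congr 1
    exact (Set.inter_eq_left.2 Set.inter_subset_left).symm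
  rw [e, S.chartMeasure_apply hs]
  have hsub : (ch (2 * m + 1) x).target ∩ (ch (2 * m + 1) x).symm ⁻¹'
      ((ch (2 * m + 1) x).source ∩ ch (2 * m + 1) x ⁻¹' O) ⊆ O := by
    rintro z ⟨hz, -, hz'⟩
    rwa [Set.mem_preimage, (ch _ x).right_inv hz] at hz'
  calc _ ≤ ∫⁻ z in O, ENNReal.ofReal |S.den x z| := lintegral_mono_set hsub
    _ ≤ ∫⁻ z in O, ENNReal.ofReal (|S.den x z₀| + 1) :=
        setLIntegral_mono measurable_const fun z hz => ENNReal.ofReal_le_ofReal (hO hz).1.le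
    _ = ENNReal.ofReal (|S.den x z₀| + 1) * volume O := setLIntegral_const _ _
    _ < ⊤ := ENNReal.mul_lt_top ENNReal.ofReal_lt_top
        ((measure_mono fun z hz => (hO hz).2).trans_lt measure_ball_lt_top)

/-- Integrals of functions that are supported in a chart. -/
lemma integral_chart {F : M → ℝ} (hF : Continuous F)
    (h0 : ∀ y, y ∉ (ch (2 * m + 1) p).source → F y = 0) :
    ∫ y, F y ∂S.volMeasure
      = ∫ z in (ch (2 * m + 1) p).target, |S.den p z| * F ((ch (2 * m + 1) p).symm z) := by
  rw [← setIntegral_eq_integral_of_forall_compl_eq_zero h0, S.volMeasure_restrict_source,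
    S.chartMeasure_eq, integral_map (aemeasurable_symm _) hF.stronglyMeasurable.aestronglyMeasurable,
    integral_withDensity_eq_integral_toReal_smul₀]
  · refine integral_congr_ae (Filter.Eventually.of_forall fun z => ?_)
    simp only [ENNReal.toReal_ofReal (abs_nonneg _), smul_eq_mul]
  · exact (S.continuousOn_den.abs.aemeasurable (target_open p).measurableSet).ennreal_ofReal
  · exact Filter.Eventually.of_forall fun z => ENNReal.ofReal_lt_top

end StrictlyPseudoconvexCR

/-! ### The divergence theorem -/

/-- Vanishing off a compact subset of O makes g differentiable everywhere with integrable
derivative; then integrate by parts against the constant 1. -/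
lemma setIntegral_fderiv_eq_zero {E : Type*} [NormedAddCommGroup E] [NormedSpace ℝ E]
    [FiniteDimensional ℝ E] [MeasurableSpace E] [BorelSpace E] {μ : Measure E} [μ.IsAddHaarMeasure]
    {g : E → ℝ} {T O : Set E} (hT : IsCompact T) (hTO : T ⊆ O)
    (h0 : ∀ x, x ∉ T → g x = 0) (hd : ∀ x ∈ O, DifferentiableAt ℝ g x) {v : E}
    (hc : ContinuousOn (fun x => fderiv ℝ g x v) O) :
    IntegrableOn (fun x => fderiv ℝ g x v) O μ ∧ ∫ x in O, fderiv ℝ g x v ∂μ = 0 := by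
  have ev : ∀ x, x ∉ T → g =ᶠ[𝓝 x] fun _ => 0 := fun x hx =>
    Filter.eventually_of_mem (hT.isClosed.isOpen_compl.mem_nhds hx) h0
  have hd' : Differentiable ℝ g := fun x => by
    by_cases hx : x ∈ T
    · exact hd x (hTO hx)
    · exact (differentiableAt_const 0).congr_of_eventuallyEq (ev x hx)
  have h0' : ∀ x, x ∉ T → fderiv ℝ g x v = 0 := fun x hx => by
    rw [(ev x hx).fderiv_eq]; simp
  have hgi : Integrable g μ := (integrableOn_iff_integrable_of_support_subset
    (fun x hx => by by_contra h; exact hx (h0 x h))).1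
    (hd'.continuous.continuousOn.integrableOn_compact hT)
  have hgi' : Integrable (fun x => fderiv ℝ g x v) μ := (integrableOn_iff_integrable_of_support_subset
    (fun x hx => by by_contra h; exact hx (h0' x h))).1 ((hc.mono hTO).integrableOn_compact hT)
  refine ⟨hgi'.integrableOn, ?_⟩
  rw [setIntegral_eq_integral_of_forall_compl_eq_zero fun x hx => h0' x fun h => hx (hTO h)]
  have := integral_mul_fderiv_eq_neg_fderiv_mul_of_integrable (μ := μ) (f := fun _ => (1 : ℝ))
    (g := g) (v := v) (by simp) (by simpa using hgi') (by simpa using hgi)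
    (fun x _ => differentiableAt_const _) (fun x _ => hd' x)
  simpa using this

namespace StrictlyPseudoconvexCR

variable {m : ℕ} {M : Type*} [TopologicalSpace M] [ChartedSpace (Mod (2 * m + 1)) M]
  [IsManifold (𝓡 (2 * m + 1)) ∞ M] (S : StrictlyPseudoconvexCR m M) {p : M}

/-- The divergence of a vector field in the chart at `p`. -/
def divC (p : M) (X : (y : M) → TangentSpace (𝓡 (2 * m + 1)) y) (z : Mod (2 * m + 1)) : ℝ :=
  ∑ k, cf (eb _) k (fderiv ℝ (rep _ p X) z (eb _ k))
    + ∑ k, cf (eb _) k (twL S p z (rep _ p X z) (eb _ k))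

/-- The divergence of `χ X`, computed in the chart at `p`. -/
def divCut (p : M) (χ : M → ℝ) (X : (y : M) → TangentSpace (𝓡 (2 * m + 1)) y) (y : M) : ℝ :=
  χ y * S.divC p X (ch _ p y) + mvfderiv (𝓡 (2 * m + 1)) χ y (X y)

variable {X : (y : M) → TangentSpace (𝓡 (2 * m + 1)) y} {χ : M → ℝ}

lemma divCut_eq_zero {y : M} (hy : y ∉ tsupport χ) : S.divCut p χ X y = 0 := by
  have ev : χ =ᶠ[𝓝 y] fun _ => 0 :=
    Filter.eventually_of_mem ((isClosed_tsupport χ).isOpen_compl.mem_nhds hy) fun x hx =>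
      image_eq_zero_of_notMem_tsupport hx
  have : mvfderiv (𝓡 (2 * m + 1)) χ y = mvfderiv (𝓡 (2 * m + 1)) (fun _ => (0 : ℝ)) y := ev.mfderiv_eq
  rw [divCut, ev.eq_of_nhds, this, mvfderiv_chart (mem_extChartAt_source (I := 𝓡 (2 * m + 1)) y)
    mdifferentiableAt_const]
  simp

variable (hX : ContDiffOn ℝ ∞ (rep _ p X) (ch (2 * m + 1) p).target)
  (hχ : ContMDiff (𝓡 (2 * m + 1)) 𝓘(ℝ, ℝ) ∞ χ)

include hχ in
lemma divCut_chart {z : Mod (2 * m + 1)} (hz : z ∈ (ch (2 * m + 1) p).target) :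
    S.divCut p χ X ((ch _ p).symm z) = χ ((ch _ p).symm z) * S.divC p X z
      + fderiv ℝ (fun z => χ ((ch (2 * m + 1) p).symm z)) z (rep _ p X z) := by
  rw [divCut, mvfderiv_chart (symm_mem hz) (hχ.mdifferentiableAt (by simp)), (ch _ p).right_inv hz]
  rfl

include hX

lemma continuousOn_divC : ContinuousOn (S.divC p X) (ch (2 * m + 1) p).target := by
  have h1 := (smoothOn_fderiv (target_open p) hX).continuousOn
  have h2 := (S.localCR p).smooth_gamma.continuousOn
  have h3 := hX.continuousOn
  refine ContinuousOn.add (continuousOn_finsetSum _ fun k _ => ?_)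
    (continuousOn_finsetSum _ fun k _ => ?_)
  · exact (cf (eb _) k).continuous.comp_continuousOn (h1.clm_apply continuousOn_const)
  · exact (cf (eb _) k).continuous.comp_continuousOn ((h2.clm_apply h3).clm_apply continuousOn_const)

include hχ

lemma continuousOn_divCut_symm : ContinuousOn (fun z => χ ((ch (2 * m + 1) p).symm z) * S.divC p X z
      + fderiv ℝ (fun z => χ ((ch (2 * m + 1) p).symm z)) z (rep _ p X z))
    (ch (2 * m + 1) p).target := by
  have hχ' := contMDiffOn_iff_chart.1 (hχ.contMDiffOn (s := (ch (2 * m + 1) p).source))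
  exact (hχ'.continuousOn.mul (S.continuousOn_divC hX)).add
    ((smoothOn_fderiv (target_open p) hχ').continuousOn.clm_apply hX.continuousOn)

variable (hs : tsupport χ ⊆ (ch (2 * m + 1) p).source)

include hs

lemma continuous_divCut : Continuous (S.divCut p χ X) := by
  refine continuous_iff_continuousAt.2 fun y => ?_
  by_cases hy : y ∈ (ch (2 * m + 1) p).source
  · have h := (S.continuousOn_divCut_symm hX hχ).continuousAt ((target_open p).mem_nhds (map_mem hy))
    refine (h.comp (continuousAt_extChartAt' hy)
      ).congr_of_eventuallyEq ?_
    filter_upwards [(source_open p).mem_nhds hy] with x hx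
    rw [Function.comp_apply, ← S.divCut_chart hχ (map_mem hx), (ch _ p).left_inv hx]
  · have hy' : y ∉ tsupport χ := fun h => hy (hs h)
    refine (continuousAt_const (y := (0 : ℝ))).congr_of_eventuallyEq ?_
    filter_upwards [(isClosed_tsupport χ).isOpen_compl.mem_nhds hy'] with x hx
    exact S.divCut_eq_zero hx

variable [CompactSpace M] [MeasurableSpace M] [BorelSpace M]

/-- The divergence theorem for vector fields with support in a chart. -/
lemma integral_divCut : ∫ y, S.divCut p χ X y ∂S.volMeasure = 0 := by
  have hχ' := contMDiffOn_iff_chart.1 (hχ.contMDiffOn (s := (ch (2 * m + 1) p).source))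
  have H := S.localCR p
  have ho := target_open (k := 2 * m + 1) p
  rw [S.integral_chart (S.continuous_divCut hX hχ hs) fun y hy =>
    S.divCut_eq_zero fun h => hy (hs h)]
  set ρ : Mod (2 * m + 1) → ℝ := fun z => |S.den p z| with hρ
  set x := rep _ p X with hx
  set c : Mod (2 * m + 1) → ℝ := fun z => χ ((ch (2 * m + 1) p).symm z) with hc
  let T := ch (2 * m + 1) p '' tsupport χ
  have hT : IsCompact T := (isClosed_tsupport χ).isCompact.image_of_continuousOn
    ((continuousOn_extChartAt p).mono hs)
  have hTO : T ⊆ (ch (2 * m + 1) p).target := by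
    rintro _ ⟨y, hy, rfl⟩
    exact map_mem (hs hy)
  -- The components of χ ρ X in the chart, extended by zero; they vanish off the compact image of
  -- the support of χ.
  let g : Fin (2 * m + 1) → Mod (2 * m + 1) → ℝ := fun k =>
    (ch (2 * m + 1) p).target.indicator fun z => c z * ρ z * cf (eb _) k (x z)
  have hg0 : ∀ k z, z ∉ T → g k z = 0 := by
    intro k z hz
    by_cases hz' : z ∈ (ch (2 * m + 1) p).target
    · have : χ ((ch (2 * m + 1) p).symm z) = 0 := image_eq_zero_of_notMem_tsupport fun h =>
        hz ⟨_, h, (ch _ p).right_inv hz'⟩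
      simp only [g, Set.indicator_of_mem hz', c, this, zero_mul]
    · exact Set.indicator_of_notMem hz' _
  have dρ : ∀ z ∈ (ch (2 * m + 1) p).target, DifferentiableAt ℝ ρ z ∧ ∀ a, fderiv ℝ ρ z a
      = (∑ l, cf (eb _) l (twL S p z a (eb _ l))) * ρ z := fun z hz =>
    hasFDerivAt_abs_of_logarithmic
      (differentiableAt_of_smoothOn ho (H.smoothOn_volL (eb _)) hz) (H.fderiv_volL (eb _) hz)
  have dx := fun z (hz : z ∈ (ch (2 * m + 1) p).target) => differentiableAt_of_smoothOn ho hX hz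
  have dc := fun z (hz : z ∈ (ch (2 * m + 1) p).target) => differentiableAt_of_smoothOn ho hχ' hz
  have dcx : ∀ k, ∀ z ∈ (ch (2 * m + 1) p).target,
      DifferentiableAt ℝ (fun z => cf (eb _) k (x z)) z := fun k z hz =>
    (cf (eb _) k).differentiableAt.comp z (dx z hz)
  have ev : ∀ k, ∀ z ∈ (ch (2 * m + 1) p).target,
      g k =ᶠ[𝓝 z] fun z => c z * ρ z * cf (eb _) k (x z) := fun k z hz =>
    Filter.eventually_of_mem (ho.mem_nhds hz) fun w hw => Set.indicator_of_mem hw _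
  have hgd : ∀ k, ∀ z ∈ (ch (2 * m + 1) p).target, DifferentiableAt ℝ (g k) z := fun k z hz =>
    (((dc z hz).fun_mul (dρ z hz).1).fun_mul (dcx k z hz)).congr_of_eventuallyEq (ev k z hz)
  have hg' : ∀ k, ∀ z ∈ (ch (2 * m + 1) p).target, ∀ a, fderiv ℝ (g k) z a
      = ρ z * (c z * cf (eb _) k (fderiv ℝ x z a) + fderiv ℝ c z a * cf (eb _) k (x z)
        + c z * (cf (eb _) k (x z) * ∑ l, cf (eb _) l (twL S p z a (eb _ l)))) := by
    intro k z hz a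
    have : fderiv ℝ (fun z => cf (eb _) k (x z)) z a = cf (eb _) k (fderiv ℝ x z a) := by
      rw [fderiv_clm_app (differentiableAt_const (cf (eb _) k)) (dx z hz)]
      simp
    rw [(ev k z hz).fderiv_eq, fderiv_fun_mul ((dc z hz).fun_mul (dρ z hz).1) (dcx k z hz),
      fderiv_fun_mul (dc z hz) (dρ z hz).1]
    simp only [add_apply, smul_apply, smul_eq_mul, this, (dρ z hz).2]
    ring
  have hcont : ∀ k a, ContinuousOn (fun z => fderiv ℝ (g k) z a) (ch (2 * m + 1) p).target := by
    intro k a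
    refine ContinuousOn.congr ?_ fun z hz => hg' k z hz a
    have h1 := (smoothOn_fderiv ho hX).continuousOn
    have h2 := (smoothOn_fderiv ho hχ').continuousOn
    have h3 := H.smooth_gamma.continuousOn
    have h4 : ContinuousOn ρ (ch (2 * m + 1) p).target := S.continuousOn_den.abs
    have h5 := hX.continuousOn
    have h6 := hχ'.continuousOn
    have hk := (cf (eb (2 * m + 1)) k).continuous
    have h7 := hk.comp_continuousOn h5
    refine h4.mul (((h6.mul (hk.comp_continuousOn (h1.clm_apply continuousOn_const))).add
      ((h2.clm_apply continuousOn_const).mul h7)).add (h6.mul (h7.mul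
        (continuousOn_finsetSum _ fun l _ => ?_))))
    exact (cf (eb _) l).continuous.comp_continuousOn
      ((h3.clm_apply continuousOn_const).clm_apply continuousOn_const)
  have key := fun k => setIntegral_fderiv_eq_zero (μ := volume) hT hTO (hg0 k) (hgd k)
    (hcont k (eb _ k))
  rw [← Finset.sum_eq_zero fun k (_ : k ∈ Finset.univ) => (key k).2,
    ← integral_finsetSum _ fun k _ => (key k).1]
  refine setIntegral_congr_fun ho.measurableSet fun z hz => ?_
  simp only [hg' _ z hz, S.divCut_chart hχ hz, divC, ← Finset.mul_sum, Finset.sum_add_distrib]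
  have e1 : ∑ k, fderiv ℝ c z (eb _ k) * cf (eb _) k (x z) = fderiv ℝ c z (x z) := by
    have := sum_cf_map (eb _) (fderiv ℝ c z).toLinearMap (x z)
    simp only [smul_eq_mul, ContinuousLinearMap.coe_coe] at this
    rw [← this]
    exact Finset.sum_congr rfl fun _ _ => mul_comm _ _
  -- The derivative of the density contributes the trace of Γ_X, which is the second sum of `divC`.
  have e2 : ∑ k, cf (eb _) k (x z) * ∑ l, cf (eb _) l (twL S p z (eb _ k) (eb _ l))
      = ∑ l, cf (eb _) l (twL S p z (x z) (eb _ l)) := by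
    simp only [Finset.mul_sum]
    rw [Finset.sum_comm]
    refine Finset.sum_congr rfl fun l _ => ?_
    exact sum_cf_map (eb _) ((cf (eb _) l).comp ((twL S p z).flip (eb _ l))).toLinearMap (x z)
  rw [e1, e2]
  ring

omit hX hχ hs

variable [T2Space M]

/-- A continuous function that is bounded by the divergence of a vector field has nonpositive
integral. -/
lemma integral_nonpos_of_le_div {F : M → ℝ} (hF : Continuous F)
    (hX : ∀ p, ContDiffOn ℝ ∞ (rep _ p X) (ch (2 * m + 1) p).target)
    (hle : ∀ p, ∀ y ∈ (ch (2 * m + 1) p).source, F y ≤ S.divC p X (ch _ p y)) :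
    ∫ y, F y ∂S.volMeasure ≤ 0 := by
  obtain ⟨t, ht⟩ := isCompact_univ.elim_finite_subcover (fun p : M => (ch (2 * m + 1) p).source)
    (fun p => source_open p) fun x _ => Set.mem_iUnion.2 ⟨x, mem_extChartAt_source (I := 𝓡 (2 * m + 1)) x⟩
  obtain ⟨f, hf⟩ := SmoothPartitionOfUnity.exists_isSubordinate (𝓡 (2 * m + 1)) isClosed_univ
    (fun p : t => (ch (2 * m + 1) (p : M)).source) (fun p => source_open (p : M)) (fun x hx => by
      obtain ⟨p, hp, hx'⟩ := Set.mem_iUnion₂.1 (ht hx)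
      exact Set.mem_iUnion.2 ⟨⟨p, hp⟩, hx'⟩)
  have hsum : ∀ x, ∑ i, f i x = 1 := fun x => by
    rw [← finsum_eq_sum_of_fintype]
    exact f.sum_eq_one (Set.mem_univ x)
  have hfs : ∀ i, ContMDiff (𝓡 (2 * m + 1)) 𝓘(ℝ, ℝ) ∞ (f i) := fun i => (f i).contMDiff
  -- The partition functions sum to 1, so their differentials cancel and only the weighted
  -- divergences remain.
  have hd : ∀ y, ∑ i, mvfderiv (𝓡 (2 * m + 1)) (f i) y (X y) = 0 := by
    intro y
    have hy := mem_extChartAt_source (I := 𝓡 (2 * m + 1)) y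
    have h1 : ∀ i, DifferentiableAt ℝ (fun z => f i ((ch _ y).symm z)) (ch _ y y) := fun i =>
      differentiableAt_of_smoothOn (target_open y)
        (contMDiffOn_iff_chart.1 ((hfs i).contMDiffOn (s := (ch (2 * m + 1) y).source))) (map_mem hy)
    simp only [mvfderiv_chart hy ((hfs _).mdifferentiableAt (by simp))]
    rw [← sum_apply, ← fderiv_fun_sum fun i _ => h1 i]
    simp only [hsum]
    simp
  have hint : ∀ i : t, Integrable (S.divCut (i : M) (f i) X) S.volMeasure := fun i =>
    (S.continuous_divCut (hX i) (hfs i) (hf i)).integrable_of_hasCompactSupport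
      (HasCompactSupport.of_compactSpace _)
  have hFi : Integrable F S.volMeasure :=
    hF.integrable_of_hasCompactSupport (HasCompactSupport.of_compactSpace _)
  have h0 : ∫ y, ∑ i : t, S.divCut (i : M) (f i) X y ∂S.volMeasure = 0 := by
    rw [integral_finsetSum _ fun i _ => hint i]
    exact Finset.sum_eq_zero fun i _ => S.integral_divCut (hX i) (hfs i) (hf i)
  rw [← h0]
  -- Each weight multiplies the divergence computed in its own chart. The bound on F holds in every
  -- chart, so the weighted sum can be compared without knowing that the divergence is independent
  -- of the chart.
  refine integral_mono hFi (integrable_finsetSum _ fun i _ => hint i) fun y => ?_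
  simp only [divCut, Finset.sum_add_distrib, hd, add_zero]
  calc F y = ∑ i, f i y * F y := by rw [← Finset.sum_mul, hsum, one_mul]
    _ ≤ _ := Finset.sum_le_sum fun i _ => by
      by_cases hy : y ∈ tsupport (f i)
      · exact mul_le_mul_of_nonneg_left (hle _ y (hf i hy)) (f.nonneg i y)
      · rw [image_eq_zero_of_notMem_tsupport hy, zero_mul, zero_mul]

end StrictlyPseudoconvexCR

end CRGeom

end

/-! ### Integration of the Bochner inequality. -/

theorem theorem4p1 {m n : ℕ} (hm : 2 ≤ m)
    {M : Type*} [TopologicalSpace M] [T2Space M] [CompactSpace M]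
    [ChartedSpace (EuclideanSpace ℝ (Fin (2 * m + 1))) M] [IsManifold (𝓡 (2 * m + 1)) ∞ M]
    [MeasurableSpace M] [BorelSpace M]
    (S : CRGeom.StrictlyPseudoconvexCR m M)
    {N : Type*} [TopologicalSpace N] [T2Space N]
    [ChartedSpace (EuclideanSpace ℝ (Fin n)) N] [IsManifold (𝓡 n) ∞ N]
    (h : CRGeom.Metric n N) (hN : CRGeom.NonposHermitianCurvature h)
    (φ : M → N) (hφ : ContMDiff (𝓡 (2 * m + 1)) (𝓡 n) ∞ φ)
    (e : (x : M) → Fin m → TangentSpace (𝓡 (2 * m + 1)) x) (he : ∀ x, S.IsCRFrame x (e x))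
    (E : (x : M) → Fin n → TangentSpace (𝓡 n) (φ x))
    (hE : ∀ x, CRGeom.IsOrthonormalFrame h (E x)) :
    Integrable (fun x => CRGeom.paneitzPairing S h φ (e x) (E x)) S.volMeasure ∧
      0 ≤ -∫ x, CRGeom.paneitzPairing S h φ (e x) (E x) ∂S.volMeasure := by
  have hc := CRGeom.continuous_paneitzPairing he hφ hE
  refine ⟨hc.integrable_of_hasCompactSupport (HasCompactSupport.of_compactSpace _), ?_⟩
  have hm1 : (1 : ℝ) < m := by exact_mod_cast hm
  -- Here m ≥ 2 is needed: for m = 1 the trace-free part is zero and the coefficient of the pairing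
  -- vanishes.
  have hk : 0 < 2 * (((m : ℝ) - 1) / m) := by
    have : 0 < (m : ℝ) - 1 := by linarith
    positivity
  have key := S.integral_nonpos_of_le_div
    (F := fun y => 2 * (((m : ℝ) - 1) / m) * CRGeom.paneitzPairing S h φ (e y) (E y))
    (continuous_const.mul hc)
    (fun p => CRGeom.smoothOn_bochnerField hφ he (p := p))
    fun p y hy => CRGeom.le_div_bochnerField hφ he hm hN hy (hE y)
  rw [integral_const_mul] at key
  exact neg_nonneg.2 (nonpos_of_mul_nonpos_right key hk)
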